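/- Let $n\ge 1$, let $\Omega\subset\mathbb{R}^n$ be a bounded open set (in particular, any bounded domain), and let $\sigma\colon\Omega\to[0,\infty]$ be measurable. Write $D_0=\sigma^{-1}(\{0\})$ and $D_\infty=\sigma^{-1}(\{\infty\})$, and suppose that - $D_0$ and $D_\infty$ are open; - $\overline{D_0}$, $\overline{D_\infty}$ and $\partial\Omega$ are pairwise disjoint; - there are constants $0<m\le M<\infty$ with $m\le\sigma\le M$ almost everywhere in $\Omega\setminus(D_0\cup D_\infty)$; - $D_0$ has Lipschitz boundary, that is, near each of its boundary points it is, in suitable orthonormal coordinates, the region above the graph of a Lipschitz function. Let $1<p<\infty$ and $f\in W^{1,p}(\Omega)$. Let $W^{1,p}_0(\Omega)$ be the closure of $C_c^\infty(\Omega)$ in $W^{1,p}(\Omega)$, and for $u\in W^{1,p}(\Omega)$ put $$E(u)=\int_\Omega\sigma\,|\nabla u|^p\,dx\in[0,\infty],\qquad \infty\cdot 0=0,$$ where $\nabla u$ is the weak gradient. Then $E$ has a minimizer in $f+W^{1,p}_0(\Omega)$, and every minimizer $u$ has the following properties. 1. $E(u)<\infty$. 2. A function $v$ is a minimizer of $E$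 in $f+W^{1,p}_0(\Omega)$ if and only if $v-u\in W^{1,p}_0(\Omega)$ and $\nabla(v-u)=0$ almost everywhere in $\Omega\setminus D_0$. That is, the minimizer is unique exactly up to functions that have zero gradient outside $D_0$ and zero boundary values on $\partial\Omega$. 3. $\operatorname{div}(\sigma|\nabla u|^{p-2}\nabla u)=0$ in $U=\Omega\setminus(\overline{D_0}\cup\overline{D_\infty})$ in the weak sense: $\sigma|\nabla u|^{p-2}\nabla u$ is locally integrable in $U$, and $\int_U\sigma|\nabla u|^{p-2}\nabla u\cdot\nabla\varphi\,dx=0$ for all $\varphi\in C_c^\infty(U)$. 4. $\nabla u=0$ in $D_\infty$ in the weak sense. -/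

import Mathlib

open MeasureTheory Filter Topology
open scoped ENNReal NNReal ContDiff

/-- `φ ∈ C_c^∞(Ω)`. -/
structure IsTestFunction {n : ℕ} (Ω : Set (EuclideanSpace ℝ (Fin n)))
    (φ : EuclideanSpace ℝ (Fin n) → ℝ) : Prop where
  contDiff : ContDiff ℝ ∞ φ
  hasCompactSupport : HasCompactSupport φ
  tsupport_subset : tsupport φ ⊆ Ω

/-- `G` is a weak (distributional) gradient of `u` in the open set `Ω`:
both are locally integrable in `Ω`, and `∫_Ω u ∇φ = - ∫_Ω φ G` for all `φ ∈ C_c^∞(Ω)`. -/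
structure HasWeakGradient {n : ℕ} (Ω : Set (EuclideanSpace ℝ (Fin n)))
    (u : EuclideanSpace ℝ (Fin n) → ℝ)
    (G : EuclideanSpace ℝ (Fin n) → EuclideanSpace ℝ (Fin n)) : Prop where
  locallyIntegrableOn : LocallyIntegrableOn u Ω volume
  locallyIntegrableOn_grad : LocallyIntegrableOn G Ω volume
  integral_eq : ∀ φ : EuclideanSpace ℝ (Fin n) → ℝ, IsTestFunction Ω φ →
    ∫ x in Ω, u x • gradient φ x = - ∫ x in Ω, φ x • G x

open Classical in
/-- The weak gradient of `u` in `Ω` (a representative of it, which is unique up to null sets).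
It has the junk value `0` if `u` is not weakly differentiable in `Ω`. -/
noncomputable def weakGradient {n : ℕ} (Ω : Set (EuclideanSpace ℝ (Fin n)))
    (u : EuclideanSpace ℝ (Fin n) → ℝ) : EuclideanSpace ℝ (Fin n) → EuclideanSpace ℝ (Fin n) :=
  if h : ∃ G, HasWeakGradient Ω u G then h.choose else 0

/-- `u ∈ W^{1,p}(Ω)`. -/
structure MemSobolev {n : ℕ} (p : ℝ) (Ω : Set (EuclideanSpace ℝ (Fin n)))
    (u : EuclideanSpace ℝ (Fin n) → ℝ) : Prop where
  memLp : MemLp u (ENNReal.ofReal p) (volume.restrict Ω)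
  exists_hasWeakGradient : ∃ G, HasWeakGradient Ω u G
  memLp_weakGradient : MemLp (weakGradient Ω u) (ENNReal.ofReal p) (volume.restrict Ω)

/-- `u ∈ W^{1,p}_0(Ω)`: `u` is in the closure of `C_c^∞(Ω)` in `W^{1,p}(Ω)`. -/
structure MemSobolevZero {n : ℕ} (p : ℝ) (Ω : Set (EuclideanSpace ℝ (Fin n)))
    (u : EuclideanSpace ℝ (Fin n) → ℝ) : Prop where
  memSobolev : MemSobolev p Ω u
  exists_approx : ∃ φ : ℕ → EuclideanSpace ℝ (Fin n) → ℝ, (∀ k, IsTestFunction Ω (φ k)) ∧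
    Tendsto (fun k => eLpNorm (fun x => u x - φ k x) (ENNReal.ofReal p) (volume.restrict Ω))
      atTop (𝓝 0) ∧
    Tendsto (fun k => eLpNorm (fun x => weakGradient Ω u x - gradient (φ k) x)
      (ENNReal.ofReal p) (volume.restrict Ω)) atTop (𝓝 0)

/-- The set `D` has Lipschitz boundary: near each of its boundary points it is, for a suitable
direction `ν` of the vertical axis, the set of points that lie above the graph of a Lipschitz
function. The graph function takes the horizontal part `y - ⟪ν, y⟫ ν` of a point `y` as argument
(only its values on the hyperplane orthogonal to `ν` play a role). -/
def HasLipschitzBoundary {n : ℕ} (D : Set (EuclideanSpace ℝ (Fin n))) : Prop :=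
  ∀ x₀ ∈ frontier D, ∃ (ν : EuclideanSpace ℝ (Fin n)) (γ : EuclideanSpace ℝ (Fin n) → ℝ)
    (K : ℝ≥0) (r : ℝ), ‖ν‖ = 1 ∧ LipschitzWith K γ ∧ 0 < r ∧
      ∀ y ∈ Metric.ball x₀ r, (y ∈ D ↔ γ (y - inner ℝ ν y • ν) < inner ℝ ν y)

/-- The level set `σ⁻¹(c)` of a conductivity `σ : Ω → [0,∞]`. -/
def levelSet {n : ℕ} (Ω : Set (EuclideanSpace ℝ (Fin n)))
    (σ : EuclideanSpace ℝ (Fin n) → ℝ≥0∞) (c : ℝ≥0∞) : Set (EuclideanSpace ℝ (Fin n)) :=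
  {x ∈ Ω | σ x = c}

/-- The energy `∫_Ω σ |∇u|^p ∈ [0,∞]`, where `∞ · 0 = 0`. -/
noncomputable def pEnergy {n : ℕ} (p : ℝ) (Ω : Set (EuclideanSpace ℝ (Fin n)))
    (σ : EuclideanSpace ℝ (Fin n) → ℝ≥0∞) (u : EuclideanSpace ℝ (Fin n) → ℝ) : ℝ≥0∞ :=
  ∫⁻ x in Ω, σ x * ENNReal.ofReal (‖weakGradient Ω u x‖ ^ p)

/-- `u` minimizes the energy in the class `f + W^{1,p}_0(Ω)`. -/
def IsEnergyMinimizer {n : ℕ} (p : ℝ) (Ω : Set (EuclideanSpace ℝ (Fin n)))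
    (σ : EuclideanSpace ℝ (Fin n) → ℝ≥0∞) (f u : EuclideanSpace ℝ (Fin n) → ℝ) : Prop :=
  MemSobolevZero p Ω (u - f) ∧ ∀ v, MemSobolevZero p Ω (v - f) → pEnergy p Ω σ u ≤ pEnergy p Ω σ v

/-- `u` is a weak solution of `div (σ |∇u|^{p-2} ∇u) = 0` in the open set `U`, for a conductivity
`σ` that is finite in `U`: `u` is weakly differentiable, the flux `σ |∇u|^{p-2} ∇u` is locally
integrable (so that the integrals below exist) and has zero distributional divergence. -/
structure IsWeakSolution {n : ℕ} (p : ℝ) (U : Set (EuclideanSpace ℝ (Fin n)))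
    (σ : EuclideanSpace ℝ (Fin n) → ℝ≥0∞) (u : EuclideanSpace ℝ (Fin n) → ℝ) : Prop where
  exists_hasWeakGradient : ∃ G, HasWeakGradient U u G
  locallyIntegrableOn_flux : LocallyIntegrableOn
    (fun x => ((σ x).toReal * ‖weakGradient U u x‖ ^ (p - 2)) • weakGradient U u x) U volume
  integral_eq_zero : ∀ φ : EuclideanSpace ℝ (Fin n) → ℝ, IsTestFunction U φ →
    ∫ x in U, inner ℝ (((σ x).toReal * ‖weakGradient U u x‖ ^ (p - 2)) • weakGradient U u x)
      (gradient φ x) = 0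

/-!
The energy controls gradients only outside the set `D₀` where the conductivity vanishes. Since `∂D₀`
is Lipschitz and `D₀` stays away from `∂Ω`, functions can be reflected across `∂D₀` locally, which
replaces a function on `D₀` by one whose `W^{1,p}` norm there is controlled by its values outside
`D₀`. Together with a finite-rank approximation of Rellich type and Peetre's lemma this shows that
the gradients of `W^{1,p}_0(Ω)` functions, restricted to the complement of `D₀`, form a closed
subspace of `L^p`. By uniform convexity of the energy the gradients of a minimizing sequence are
Cauchy outside `D₀`, so their limit is realized by an admissible function, which is a minimizer by
Fatou's lemma; uniform convexity also gives the uniqueness. Cutting off `f` near `D_∞` gives a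
competitor of finite energy, the Euler–Lagrange equation is the first variation, and finite energy
forces `∇u = 0` where `σ = ∞`.
-/

local notation "𝔼" n:max => EuclideanSpace ℝ (Fin n)

section CompactlySupportedWeights

variable {X F : Type*} [TopologicalSpace X] [T2Space X] [MeasurableSpace X]
  [OpensMeasurableSpace X] {μ : Measure X} [NormedAddCommGroup F] [NormedSpace ℝ F] {s : Set X}

lemma integrable_smul_of_tsupport_subset_left {φ : X → ℝ} {g : X → F}
    (hg : LocallyIntegrableOn g s μ) (hφ : Continuous φ) (hc : HasCompactSupport φ)
    (hs : tsupport φ ⊆ s) : Integrable (fun x => φ x • g x) μ := by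
  have hint : IntegrableOn (fun x => φ x • g x) (tsupport φ) μ :=
    (hg.integrableOn_compact_subset hs hc).continuousOn_smul hφ.continuousOn hc
  rw [← integrableOn_univ]
  exact hint.of_forall_sdiff_eq_zero MeasurableSet.univ
    fun x hx => by simp [image_eq_zero_of_notMem_tsupport hx.2]

lemma integrable_smul_of_tsupport_subset_right [SecondCountableTopology X] {u : X → ℝ} {φ : X → F}
    (hu : LocallyIntegrableOn u s μ) (hφ : Continuous φ) (hc : HasCompactSupport φ)
    (hs : tsupport φ ⊆ s) : Integrable (fun x => u x • φ x) μ := by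
  have hint : IntegrableOn (fun x => u x • φ x) (tsupport φ) μ :=
    (hu.integrableOn_compact_subset hs hc).smul_continuousOn hφ.continuousOn hc
  rw [← integrableOn_univ]
  exact hint.of_forall_sdiff_eq_zero MeasurableSet.univ
    fun x hx => by simp [image_eq_zero_of_notMem_tsupport hx.2]

end CompactlySupportedWeights

section Gradient

variable {E : Type*} [NormedAddCommGroup E] [InnerProductSpace ℝ E] [CompleteSpace E]

lemma gradient_add {φ ψ : E → ℝ} {x : E} (hφ : DifferentiableAt ℝ φ x)
    (hψ : DifferentiableAt ℝ ψ x) : gradient (φ + ψ) x = gradient φ x + gradient ψ x := by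
  simp [gradient, fderiv_add hφ hψ]

lemma gradient_mul {φ ψ : E → ℝ} {x : E} (hφ : DifferentiableAt ℝ φ x)
    (hψ : DifferentiableAt ℝ ψ x) :
    gradient (φ * ψ) x = φ x • gradient ψ x + ψ x • gradient φ x := by
  simp only [gradient, fderiv_mul hφ hψ, map_add, map_smul]

lemma gradient_comp_const_sub {φ : E → ℝ} (hφ : Differentiable ℝ φ) (x y : E) :
    gradient (fun y => φ (x - y)) y = -gradient φ (x - y) := by
  have hderiv : fderiv ℝ (fun y => φ (x - y)) y = -fderiv ℝ φ (x - y) :=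
    ((hφ (x - y)).hasFDerivAt.comp y ((hasFDerivAt_id y).const_sub x)).fderiv.trans (by ext; simp)
  simp [gradient, hderiv]

lemma norm_gradient (φ : E → ℝ) (x : E) : ‖gradient φ x‖ = ‖fderiv ℝ φ x‖ :=
  LinearIsometryEquiv.norm_map _ _

lemma continuous_gradient {φ : E → ℝ} (hφ : ContDiff ℝ 1 φ) : Continuous (gradient φ) :=
  (LinearIsometryEquiv.continuous _).comp (hφ.continuous_fderiv one_ne_zero)

lemma tsupport_gradient_subset (φ : E → ℝ) : tsupport (gradient φ) ⊆ tsupport φ := by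
  refine (closure_mono fun x hx => ?_).trans (tsupport_fderiv_subset ℝ)
  simpa [gradient, Function.mem_support] using hx

end Gradient

section WeakGradients

variable {n : ℕ} {Ω U : Set (𝔼 n)} {u v φ ψ : 𝔼 n → ℝ} {G H : 𝔼 n → 𝔼 n}

namespace IsTestFunction

lemma continuous (hφ : IsTestFunction Ω φ) : Continuous φ := hφ.contDiff.continuous

lemma differentiable (hφ : IsTestFunction Ω φ) : Differentiable ℝ φ :=
  hφ.contDiff.differentiable (by simp)

lemma continuous_gradient (hφ : IsTestFunction Ω φ) : Continuous (gradient φ) :=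
  _root_.continuous_gradient (hφ.contDiff.of_le (by simp))

lemma hasCompactSupport_gradient (hφ : IsTestFunction Ω φ) : HasCompactSupport (gradient φ) :=
  hφ.hasCompactSupport.of_isClosed_subset (isClosed_tsupport _) (tsupport_gradient_subset φ)

lemma mono (hφ : IsTestFunction U φ) (hU : U ⊆ Ω) : IsTestFunction Ω φ :=
  ⟨hφ.contDiff, hφ.hasCompactSupport, hφ.tsupport_subset.trans hU⟩

lemma zero : IsTestFunction Ω (0 : 𝔼 n → ℝ) :=
  ⟨contDiff_const, HasCompactSupport.zero, by simp [tsupport]⟩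

lemma add (hφ : IsTestFunction Ω φ) (hψ : IsTestFunction Ω ψ) : IsTestFunction Ω (φ + ψ) :=
  ⟨hφ.contDiff.add hψ.contDiff, hφ.hasCompactSupport.add hψ.hasCompactSupport,
    (tsupport_add φ ψ).trans (Set.union_subset hφ.tsupport_subset hψ.tsupport_subset)⟩

lemma const_smul (c : ℝ) (hφ : IsTestFunction Ω φ) : IsTestFunction Ω (c • φ) :=
  ⟨hφ.contDiff.const_smul c, hφ.hasCompactSupport.smul_left (f := fun _ => c),
    (closure_mono (Function.support_const_smul_subset c φ)).trans hφ.tsupport_subset⟩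

lemma mul_left (hψ : ContDiff ℝ ∞ ψ) (hφ : IsTestFunction Ω φ) : IsTestFunction Ω (ψ * φ) :=
  ⟨hψ.mul hφ.contDiff, hφ.hasCompactSupport.mul_left,
    tsupport_mul_subset_right.trans hφ.tsupport_subset⟩

lemma support_subset (hφ : IsTestFunction Ω φ) : Function.support φ ⊆ Ω :=
  (subset_tsupport φ).trans hφ.tsupport_subset

lemma support_gradient_subset (hφ : IsTestFunction Ω φ) : Function.support (gradient φ) ⊆ Ω :=
  (subset_tsupport _).trans ((tsupport_gradient_subset φ).trans hφ.tsupport_subset)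

lemma eq_zero_of_notMem (hφ : IsTestFunction Ω φ) {x : 𝔼 n} (hx : x ∉ Ω) : φ x = 0 :=
  Function.notMem_support.mp fun h => hx (hφ.support_subset h)

lemma gradient_eq_zero_of_notMem (hφ : IsTestFunction Ω φ) {x : 𝔼 n} (hx : x ∉ Ω) :
    gradient φ x = 0 :=
  Function.notMem_support.mp fun h => hx (hφ.support_gradient_subset h)

lemma setIntegral_smul (hφ : IsTestFunction Ω φ) (G : 𝔼 n → 𝔼 n) :
    ∫ x in Ω, φ x • G x = ∫ x, φ x • G x :=
  setIntegral_eq_integral_of_forall_compl_eq_zero fun x hx => by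
    rw [hφ.eq_zero_of_notMem hx, zero_smul]

lemma setIntegral_smul_gradient (hφ : IsTestFunction Ω φ) (u : 𝔼 n → ℝ) :
    ∫ x in Ω, u x • gradient φ x = ∫ x, u x • gradient φ x :=
  setIntegral_eq_integral_of_forall_compl_eq_zero fun x hx => by
    rw [hφ.gradient_eq_zero_of_notMem hx, smul_zero]

lemma integrable_smul (hφ : IsTestFunction Ω φ) (hG : LocallyIntegrableOn G Ω) :
    Integrable (fun x => φ x • G x) :=
  integrable_smul_of_tsupport_subset_left hG hφ.continuous hφ.hasCompactSupport hφ.tsupport_subset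

lemma integrable_smul_gradient (hφ : IsTestFunction Ω φ) (hu : LocallyIntegrableOn u Ω) :
    Integrable (fun x => u x • gradient φ x) :=
  integrable_smul_of_tsupport_subset_right hu hφ.continuous_gradient hφ.hasCompactSupport_gradient
    ((tsupport_gradient_subset φ).trans hφ.tsupport_subset)

end IsTestFunction

namespace HasWeakGradient

lemma integral_univ_eq (h : HasWeakGradient Ω u G) (hφ : IsTestFunction Ω φ) :
    ∫ x, u x • gradient φ x = -∫ x, φ x • G x := by
  rw [← hφ.setIntegral_smul_gradient, ← hφ.setIntegral_smul, h.integral_eq φ hφ]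

lemma of_integral_univ_eq (hu : LocallyIntegrableOn u Ω) (hG : LocallyIntegrableOn G Ω)
    (h : ∀ φ, IsTestFunction Ω φ → ∫ x, u x • gradient φ x = -∫ x, φ x • G x) :
    HasWeakGradient Ω u G :=
  ⟨hu, hG, fun φ hφ => by rw [hφ.setIntegral_smul_gradient, hφ.setIntegral_smul, h φ hφ]⟩

lemma mono (h : HasWeakGradient Ω u G) (hU : U ⊆ Ω) : HasWeakGradient U u G :=
  of_integral_univ_eq (h.locallyIntegrableOn.mono_set hU) (h.locallyIntegrableOn_grad.mono_set hU)
    fun _ hφ => h.integral_univ_eq (hφ.mono hU)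

lemma ae_unique (hΩ : IsOpen Ω) (h : HasWeakGradient Ω u G) (h' : HasWeakGradient Ω u H) :
    G =ᵐ[volume.restrict Ω] H := by
  rw [EventuallyEq, ae_restrict_iff' hΩ.measurableSet]
  have hsub := hΩ.ae_eq_zero_of_integral_contDiff_smul_eq_zero
    (h.locallyIntegrableOn_grad.sub h'.locallyIntegrableOn_grad) fun φ hφ hc hs => by
      have hφ : IsTestFunction Ω φ := ⟨hφ, hc, hs⟩
      simp only [Pi.sub_apply, smul_sub]
      rw [integral_sub (hφ.integrable_smul h.locallyIntegrableOn_grad)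
        (hφ.integrable_smul h'.locallyIntegrableOn_grad), sub_eq_zero, ← neg_inj,
        ← h.integral_univ_eq hφ, ← h'.integral_univ_eq hφ]
  filter_upwards [hsub] with x hx hxΩ
  exact sub_eq_zero.mp (hx hxΩ)

lemma congr_ae (h : HasWeakGradient Ω u G) (hu : u =ᵐ[volume.restrict Ω] v)
    (hG : G =ᵐ[volume.restrict Ω] H) : HasWeakGradient Ω v H := by
  refine ⟨h.locallyIntegrableOn.congr hu, h.locallyIntegrableOn_grad.congr hG, fun φ hφ => ?_⟩
  calc ∫ x in Ω, v x • gradient φ x = ∫ x in Ω, u x • gradient φ x :=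
        integral_congr_ae (hu.mono fun x hx => by simp only [hx])
    _ = -∫ x in Ω, φ x • G x := h.integral_eq φ hφ
    _ = -∫ x in Ω, φ x • H x :=
        congrArg Neg.neg (integral_congr_ae (hG.mono fun x hx => by simp only [hx]))

lemma add (h : HasWeakGradient Ω u G) (h' : HasWeakGradient Ω v H) :
    HasWeakGradient Ω (u + v) (G + H) := by
  refine of_integral_univ_eq (h.1.add h'.1) (h.2.add h'.2) fun φ hφ => ?_
  simp only [Pi.add_apply, add_smul, smul_add]
  rw [integral_add (hφ.integrable_smul_gradient h.1) (hφ.integrable_smul_gradient h'.1),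
    integral_add (hφ.integrable_smul h.2) (hφ.integrable_smul h'.2), h.integral_univ_eq hφ,
    h'.integral_univ_eq hφ, neg_add]

lemma const_smul (c : ℝ) (h : HasWeakGradient Ω u G) : HasWeakGradient Ω (c • u) (c • G) := by
  refine of_integral_univ_eq (h.1.smul c) (h.2.smul c) fun φ hφ => ?_
  simp only [Pi.smul_apply, smul_assoc, smul_comm (φ _) c]
  rw [integral_smul, integral_smul, h.integral_univ_eq hφ, smul_neg]

lemma sub (h : HasWeakGradient Ω u G) (h' : HasWeakGradient Ω v H) :
    HasWeakGradient Ω (u - v) (G - H) := by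
  simpa [sub_eq_add_neg] using h.add (h'.const_smul (-1))

lemma hasWeakGradient_weakGradient (h : ∃ G, HasWeakGradient Ω u G) :
    HasWeakGradient Ω u (weakGradient Ω u) := by
  rw [weakGradient, dif_pos h]
  exact h.choose_spec

lemma weakGradient_ae_eq (h : HasWeakGradient Ω u G) (hΩ : IsOpen Ω) :
    weakGradient Ω u =ᵐ[volume.restrict Ω] G :=
  (hasWeakGradient_weakGradient ⟨G, h⟩).ae_unique hΩ h

end HasWeakGradient

namespace MemSobolev

variable {p : ℝ}

lemma hasWeakGradient (h : MemSobolev p Ω u) : HasWeakGradient Ω u (weakGradient Ω u) :=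
  HasWeakGradient.hasWeakGradient_weakGradient h.exists_hasWeakGradient

lemma of_hasWeakGradient (hΩ : IsOpen Ω) (h : HasWeakGradient Ω u G)
    (hu : MemLp u (ENNReal.ofReal p) (volume.restrict Ω))
    (hG : MemLp G (ENNReal.ofReal p) (volume.restrict Ω)) : MemSobolev p Ω u :=
  ⟨hu, ⟨G, h⟩, hG.ae_eq (h.weakGradient_ae_eq hΩ).symm⟩

lemma add (hΩ : IsOpen Ω) (h : MemSobolev p Ω u) (h' : MemSobolev p Ω v) :
    MemSobolev p Ω (u + v) :=
  of_hasWeakGradient hΩ (h.hasWeakGradient.add h'.hasWeakGradient) (h.memLp.add h'.memLp)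
    (h.memLp_weakGradient.add h'.memLp_weakGradient)

end MemSobolev

end WeakGradients

section Mollification

open ContinuousLinearMap (lsmul)
open scoped Convolution

variable {q : ℝ≥0∞}

lemma eLpNorm_le_of_enorm_le_lintegral {X T F F' : Type*} [MeasurableSpace X] {ν : Measure X}
    [SFinite ν] [MeasurableSpace T] {μ : Measure T} [IsProbabilityMeasure μ]
    [NormedAddCommGroup F] [NormedAddCommGroup F'] (hq1 : 1 ≤ q) (hq : q ≠ ⊤) {f : X → F'}
    {H : X → T → F} (hH : AEStronglyMeasurable (Function.uncurry H) (ν.prod μ))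
    (hfH : ∀ x, ‖f x‖ₑ ≤ ∫⁻ t, ‖H x t‖ₑ ∂μ) {C : ℝ≥0∞}
    (hC : ∀ᵐ t ∂μ, eLpNorm (fun x => H x t) q ν ≤ C) : eLpNorm f q ν ≤ C := by
  have hq0 : q ≠ 0 := (zero_lt_one.trans_le hq1).ne'
  have hr0 : 0 < q.toReal := ENNReal.toReal_pos hq0 hq
  rw [eLpNorm_eq_lintegral_rpow_enorm_toReal hq0 hq, one_div, ENNReal.rpow_inv_le_iff hr0]
  calc ∫⁻ x, ‖f x‖ₑ ^ q.toReal ∂ν ≤ ∫⁻ x, ∫⁻ t, ‖H x t‖ₑ ^ q.toReal ∂μ ∂ν := by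
        refine lintegral_mono_ae (hH.prodMk_left.mono fun x hx => ?_)
        have hmean := eLpNorm_le_eLpNorm_of_exponent_le hq1 hx
        rw [eLpNorm_one_eq_lintegral_enorm, eLpNorm_eq_lintegral_rpow_enorm_toReal hq0 hq,
          one_div, ENNReal.le_rpow_inv_iff hr0] at hmean
        exact (ENNReal.rpow_le_rpow (hfH x) hr0.le).trans hmean
    _ = ∫⁻ t, ∫⁻ x, ‖H x t‖ₑ ^ q.toReal ∂ν ∂μ := lintegral_lintegral_swap (hH.enorm.pow_const _)
    _ ≤ ∫⁻ _, C ^ q.toReal ∂μ := lintegral_mono_ae (hC.mono fun t ht => by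
        rwa [eLpNorm_eq_lintegral_rpow_enorm_toReal hq0 hq, one_div,
          ENNReal.rpow_inv_le_iff hr0] at ht)
    _ = C ^ q.toReal := by simp

lemma tendsto_eLpNorm_sub_translate {E F : Type*} [NormedAddCommGroup E]
    [MeasurableSpace E] [BorelSpace E] {μ : Measure E} [μ.IsAddRightInvariant]
    [μ.InnerRegularCompactLTTop] [IsLocallyFiniteMeasure μ] [NormedAddCommGroup F] (hq1 : 1 ≤ q)
    (hq : q ≠ ⊤) {g : E → F} (hg : MemLp g q μ) :
    Tendsto (fun t => eLpNorm (fun x => g x - g (x - t)) q μ) (𝓝 0) (𝓝 0) := by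
  have : Fact (1 ≤ q) := ⟨hq1⟩
  let Φ : C(E × E, E) := ⟨fun z => z.2 - z.1, by fun_prop⟩
  have hmp : ∀ t, MeasurePreserving (Φ.curry t) μ μ := measurePreserving_sub_right μ
  have htrans : ∀ t, Lp.compMeasurePreserving (Φ.curry t) (hmp t) (hg.toLp g)
      =ᵐ[μ] fun x => g (x - t) := fun t =>
    (Lp.coeFn_compMeasurePreserving _ (hmp t)).trans
      ((hmp t).quasiMeasurePreserving.ae_eq_comp hg.coeFn_toLp)
  have hlim := (tendsto_const_nhds (x := hg.toLp g)).compMeasurePreservingLp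
    (Φ.curry.continuous.tendsto 0) hmp (hmp 0) hq
  rw [Lp.tendsto_Lp_iff_tendsto_eLpNorm'] at hlim
  refine hlim.congr fun t => ?_
  rw [eLpNorm_sub_comm]
  refine eLpNorm_congr_ae ?_
  filter_upwards [htrans t, htrans 0] with x hx hx0
  rw [Pi.sub_apply, hx, hx0, sub_zero]

lemma enorm_sub_convolution_le {E F : Type*} [NormedAddCommGroup E] [ProperSpace E]
    [MeasurableSpace E] [BorelSpace E] {μ : Measure E} [μ.IsAddHaarMeasure]
    [NormedAddCommGroup F] [NormedSpace ℝ F] [CompleteSpace F] {η : E → ℝ} (hη0 : ∀ x, 0 ≤ η x)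
    (hηc : Continuous η) (hηs : HasCompactSupport η) (hη1 : ∫ x, η x ∂μ = 1) {g : E → F}
    (hg : LocallyIntegrable g μ) (x : E) :
    ‖g x - (η ⋆[lsmul ℝ ℝ, μ] g) x‖ₑ
      ≤ ∫⁻ t, ‖g x - g (x - t)‖ₑ ∂μ.withDensity fun t => ENNReal.ofReal (η t) := by
  have hconv : Integrable (fun t => η t • g (x - t)) μ :=
    (hηs.convolutionExists_left (lsmul ℝ ℝ) hηc hg x).integrable
  have hdiff : AEMeasurable (fun t => ‖g x - g (x - t)‖ₑ) μ :=
    (aestronglyMeasurable_const.sub (hg.aestronglyMeasurable.comp_quasiMeasurePreserving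
      (Measure.measurePreserving_sub_left μ x).quasiMeasurePreserving)).enorm
  have havg : g x - (η ⋆[lsmul ℝ ℝ, μ] g) x = ∫ t, η t • (g x - g (x - t)) ∂μ := by
    simp_rw [smul_sub]
    rw [integral_sub ((hηc.integrable_of_hasCompactSupport hηs).smul_const _) hconv,
      integral_smul_const, hη1, one_smul]
    rfl
  rw [havg, lintegral_withDensity_eq_lintegral_mul₀ hηc.measurable.ennreal_ofReal.aemeasurable
    hdiff]
  refine (enorm_integral_le_lintegral_enorm _).trans_eq (lintegral_congr fun t => ?_)
  rw [enorm_smul, Pi.mul_apply, Real.enorm_of_nonneg (hη0 t)]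

lemma eLpNorm_sub_convolution_le {E F : Type*} [NormedAddCommGroup E] [ProperSpace E]
    [MeasurableSpace E] [BorelSpace E] {μ : Measure E} [μ.IsAddHaarMeasure]
    [NormedAddCommGroup F] [NormedSpace ℝ F] [CompleteSpace F] (hq1 : 1 ≤ q) (hq : q ≠ ⊤)
    {η : E → ℝ} (hη0 : ∀ x, 0 ≤ η x) (hηc : Continuous η) (hηs : HasCompactSupport η)
    (hη1 : ∫ x, η x ∂μ = 1) {g : E → F} (hg : MemLp g q μ) {C : ℝ≥0∞}
    (hC : ∀ t ∈ Function.support η, eLpNorm (fun x => g x - g (x - t)) q μ ≤ C) :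
    eLpNorm (fun x => g x - (η ⋆[lsmul ℝ ℝ, μ] g) x) q μ ≤ C := by
  have hηm : Measurable fun t => ENNReal.ofReal (η t) := hηc.measurable.ennreal_ofReal
  let ν : Measure E := μ.withDensity fun t => ENNReal.ofReal (η t)
  have : IsProbabilityMeasure ν := ⟨by
    rw [withDensity_apply _ MeasurableSet.univ, Measure.restrict_univ,
      ← ofReal_integral_eq_lintegral_ofReal (hηc.integrable_of_hasCompactSupport hηs)
        (ae_of_all _ hη0), hη1, ENNReal.ofReal_one]⟩
  have hdiff : AEStronglyMeasurable (Function.uncurry fun x t => g x - g (x - t)) (μ.prod ν) :=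
    hg.1.comp_fst.sub <| hg.1.comp_quasiMeasurePreserving <|
      (quasiMeasurePreserving_sub_of_right_invariant μ μ).mono_left <|
        Measure.AbsolutelyContinuous.rfl.prod (withDensity_absolutelyContinuous _ _)
  refine eLpNorm_le_of_enorm_le_lintegral (μ := ν) hq1 hq hdiff
    (enorm_sub_convolution_le hη0 hηc hηs hη1 (hg.locallyIntegrable hq1)) ?_
  rw [ae_withDensity_iff hηm]
  refine ae_of_all _ fun t ht => hC t fun h => ht ?_
  rw [h, ENNReal.ofReal_zero]

section Gradient

variable {E : Type*} [NormedAddCommGroup E] [InnerProductSpace ℝ E]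

lemma sub_translate_eq_integral {φ : E → ℝ} (hφ : ContDiff ℝ 1 φ) (x t : E) :
    φ x - φ (x - t) = ∫ s in Set.Ioc (0 : ℝ) 1, fderiv ℝ φ (x - t + s • t) t := by
  have hderiv : ∀ s ∈ Set.uIcc (0 : ℝ) 1, HasDerivAt (fun s : ℝ => φ (x - t + s • t))
      (fderiv ℝ φ (x - t + s • t) t) s := fun s _ =>
    (hφ.differentiable one_ne_zero _).hasFDerivAt.comp_hasDerivAt s <| by
      simpa using ((hasDerivAt_id s).smul_const t).const_add (x - t)
  have hcont : Continuous fun s : ℝ => fderiv ℝ φ (x - t + s • t) t :=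
    ((hφ.continuous_fderiv one_ne_zero).comp (by fun_prop)).clm_apply continuous_const
  rw [← intervalIntegral.integral_of_le zero_le_one,
    intervalIntegral.integral_eq_sub_of_hasDerivAt hderiv (hcont.intervalIntegrable 0 1)]
  simp

variable [FiniteDimensional ℝ E] [MeasurableSpace E] [BorelSpace E] {μ : Measure E}
  [μ.IsAddHaarMeasure]

lemma eLpNorm_sub_translate_le (hq1 : 1 ≤ q) (hq : q ≠ ⊤) {φ : E → ℝ} (hφ : ContDiff ℝ 1 φ)
    (t : E) :
    eLpNorm (fun x => φ x - φ (x - t)) q μ ≤ ‖t‖ₑ * eLpNorm (gradient φ) q μ := by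
  have hprob : IsProbabilityMeasure (volume.restrict (Set.Ioc (0 : ℝ) 1)) := ⟨by simp⟩
  have : Continuous (fderiv ℝ φ) := hφ.continuous_fderiv one_ne_zero
  have hcont_prod : Continuous fun z : E × ℝ => fderiv ℝ φ (z.1 - t + z.2 • t) t := by fun_prop
  refine eLpNorm_le_of_enorm_le_lintegral (μ := volume.restrict (Set.Ioc (0 : ℝ) 1)) hq1 hq
    (H := fun x s => fderiv ℝ φ (x - t + s • t) t) hcont_prod.aestronglyMeasurable (fun x => ?_)
    (ae_of_all _ fun s => ?_)
  · rw [sub_translate_eq_integral hφ]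
    exact enorm_integral_le_lintegral_enorm _
  have htrans : MeasurePreserving (fun x : E => x - t + s • t) μ μ := by
    simpa [sub_eq_add_neg, add_assoc] using measurePreserving_add_right μ (-t + s • t)
  have hcont_apply : Continuous fun x => fderiv ℝ φ x t := by fun_prop
  calc eLpNorm (fun x => fderiv ℝ φ (x - t + s • t) t) q μ
      = eLpNorm (fun x => fderiv ℝ φ x t) q μ :=
        eLpNorm_comp_measurePreserving (g := fun x => fderiv ℝ φ x t)
          hcont_apply.aestronglyMeasurable htrans
    _ ≤ ‖t‖ₑ * eLpNorm (gradient φ) q μ := by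
        rw [← ofReal_norm]
        refine eLpNorm_le_mul_eLpNorm_of_ae_le_mul (ae_of_all _ fun x => ?_) q
        rw [norm_gradient, mul_comm]
        exact (fderiv ℝ φ x).le_opNorm t

lemma eLpNorm_sub_convolution_le_mul_gradient (hq1 : 1 ≤ q) (hq : q ≠ ⊤) {η : E → ℝ}
    (hη0 : ∀ x, 0 ≤ η x) (hηc : Continuous η) (hηs : HasCompactSupport η)
    (hη1 : ∫ x, η x ∂μ = 1) {r : ℝ} (hηr : Function.support η ⊆ Metric.ball 0 r) {φ : E → ℝ}
    (hφ : ContDiff ℝ 1 φ) (hφq : MemLp φ q μ) :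
    eLpNorm (fun x => φ x - (η ⋆[lsmul ℝ ℝ, μ] φ) x) q μ
      ≤ ENNReal.ofReal r * eLpNorm (gradient φ) q μ := by
  refine eLpNorm_sub_convolution_le hq1 hq hη0 hηc hηs hη1 hφq fun t ht => ?_
  refine (eLpNorm_sub_translate_le hq1 hq hφ t).trans ?_
  gcongr
  rw [← ofReal_norm]
  exact ENNReal.ofReal_le_ofReal (mem_ball_zero_iff.mp (hηr ht)).le

end Gradient

variable {n : ℕ} {w : 𝔼 n → ℝ} {G : 𝔼 n → 𝔼 n} {η : 𝔼 n → ℝ}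

lemma isTestFunction_comp_const_sub (hη : ContDiff ℝ ∞ η) (hηs : HasCompactSupport η) (x : 𝔼 n) :
    IsTestFunction Set.univ fun y => η (x - y) :=
  ⟨hη.comp (contDiff_const.sub contDiff_id), hηs.comp_homeomorph (Homeomorph.subLeft x),
    Set.subset_univ _⟩

lemma HasWeakGradient.gradient_convolution (h : HasWeakGradient Set.univ w G)
    (hη : ContDiff ℝ ∞ η) (hηs : HasCompactSupport η) (x : 𝔼 n) :
    gradient (η ⋆[lsmul ℝ ℝ] w) x = (η ⋆[lsmul ℝ ℝ] G) x := by
  have hw : LocallyIntegrable w := locallyIntegrableOn_univ.mp h.locallyIntegrableOn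
  have hderiv := hηs.hasFDerivAt_convolution_left (lsmul ℝ ℝ) (hη.of_le (by simp)) hw x
  have hint : ∫ y, w y • gradient η (x - y) = ∫ y, η (x - y) • G y := by
    have := h.integral_univ_eq (isTestFunction_comp_const_sub hη hηs x)
    simp_rw [gradient_comp_const_sub (hη.differentiable (by simp)), smul_neg] at this
    rwa [integral_neg, neg_inj] at this
  let grad : (𝔼 n →L[ℝ] ℝ) →L[ℝ] 𝔼 n :=
    (InnerProductSpace.toDual ℝ (𝔼 n)).symm.toContinuousLinearEquiv.toContinuousLinearMap
  calc gradient (η ⋆[lsmul ℝ ℝ] w) x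
      = grad (∫ y, (lsmul ℝ ℝ).precompL (𝔼 n) (fderiv ℝ η (x - y)) (w y)) := by
        rw [gradient, hderiv.fderiv, convolution_eq_swap]
        rfl
    _ = ∫ y, w y • gradient η (x - y) := by
        rw [← grad.integral_comp_comm ((hηs.fderiv (𝕜 := ℝ)).convolutionExists_left _
          (hη.continuous_fderiv (by simp)) hw x).integrable_swap]
        refine integral_congr_ae (ae_of_all _ fun y => ?_)
        simp only [gradient, ← map_smul]
        refine congrArg (InnerProductSpace.toDual ℝ (𝔼 n)).symm ?_
        ext v
        simp [ContinuousLinearMap.precompL_apply, mul_comm]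
    _ = (η ⋆[lsmul ℝ ℝ] G) x := by
        rw [hint, convolution_eq_swap]
        rfl

lemma HasWeakGradient.exists_isTestFunction_eLpNorm_sub_le (hq1 : 1 ≤ q) (hq : q ≠ ⊤)
    (h : HasWeakGradient Set.univ w G) (hw : MemLp w q) (hG : MemLp G q) {K Ω : Set (𝔼 n)}
    (hK : IsCompact K) (hΩ : IsOpen Ω) (hKΩ : K ⊆ Ω) (hwK : Function.support w ⊆ K) {ε : ℝ≥0∞}
    (hε : ε ≠ 0) :
    ∃ φ, IsTestFunction Ω φ ∧ eLpNorm (fun x => w x - φ x) q ≤ ε ∧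
      eLpNorm (fun x => G x - gradient φ x) q ≤ ε := by
  obtain ⟨δ, hδ, hδK⟩ := hK.exists_cthickening_subset_open hΩ hKΩ
  have hsmall : ∀ᶠ t in 𝓝 (0 : 𝔼 n), eLpNorm (fun x => w x - w (x - t)) q ≤ ε ∧
      eLpNorm (fun x => G x - G (x - t)) q ≤ ε ∧ ‖t‖ ≤ δ :=
    ((tendsto_eLpNorm_sub_translate hq1 hq hw).eventually_le_const hε.bot_lt).and <|
      ((tendsto_eLpNorm_sub_translate hq1 hq hG).eventually_le_const hε.bot_lt).and <|
        (continuous_norm.tendsto' _ _ norm_zero).eventually_le_const hδ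
  obtain ⟨r, hr, hr_small⟩ := Metric.eventually_nhds_iff_ball.mp hsmall
  let bump : ContDiffBump (0 : 𝔼 n) := ⟨r / 2, r, by positivity, by linarith⟩
  let η := bump.normed volume
  have hη : ContDiff ℝ ∞ η := bump.contDiff_normed
  have hηs : HasCompactSupport η := bump.hasCompactSupport_normed
  have hη_small : ∀ t ∈ Function.support η, _ := fun t ht =>
    hr_small t (bump.support_normed_eq.le ht)
  have htsupport : tsupport (η ⋆[lsmul ℝ ℝ] w) ⊆ Metric.cthickening δ K := by
    refine closure_minimal ((support_convolution_subset _).trans ?_) Metric.isClosed_cthickening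
    rintro _ ⟨a, ha, b, hb, rfl⟩
    exact Metric.mem_cthickening_of_dist_le _ b _ K (hwK hb) (by simpa using (hη_small a ha).2.2)
  refine ⟨η ⋆[lsmul ℝ ℝ] w, ⟨?_, ?_, htsupport.trans hδK⟩, ?_, ?_⟩
  · exact hηs.contDiff_convolution_left _ hη (locallyIntegrableOn_univ.mp h.locallyIntegrableOn)
  · exact hK.cthickening.of_isClosed_subset (isClosed_tsupport _) htsupport
  · exact eLpNorm_sub_convolution_le hq1 hq bump.nonneg_normed hη.continuous hηs
      bump.integral_normed hw fun t ht => (hη_small t ht).1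
  · simp_rw [h.gradient_convolution hη hηs]
    exact eLpNorm_sub_convolution_le hq1 hq bump.nonneg_normed hη.continuous hηs
      bump.integral_normed hG fun t ht => (hη_small t ht).2.1

end Mollification

section Lipschitz

variable {E : Type*} [NormedAddCommGroup E] [InnerProductSpace ℝ E] {K : ℝ≥0} {f : E → ℝ}

lemma norm_gradient_le_of_lipschitzWith [CompleteSpace E] (hf : LipschitzWith K f) (x : E) :
    ‖gradient f x‖ ≤ K :=
  (norm_gradient f x).trans_le (norm_fderiv_le_of_lipschitz ℝ hf)

variable [MeasurableSpace E]

lemma measurable_gradient [CompleteSpace E] [BorelSpace E] (f : E → ℝ) :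
    Measurable (gradient f) :=
  (LinearIsometryEquiv.continuous _).measurable.comp (measurable_fderiv ℝ f)

variable [FiniteDimensional ℝ E] [BorelSpace E] {μ : Measure E}

lemma locallyIntegrable_gradient_of_lipschitzWith [IsLocallyFiniteMeasure μ]
    (hf : LipschitzWith K f) : LocallyIntegrable (gradient f) μ :=
  (locallyIntegrable_const (K : ℝ)).mono (measurable_gradient f).aestronglyMeasurable
    (ae_of_all _ fun x => by simpa using norm_gradient_le_of_lipschitzWith hf x)

lemma gradient_ae_eq_zero_of_lipschitzWith [μ.IsAddHaarMeasure] (hf : LipschitzWith K f) {s : Set E}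
    (hs : MeasurableSet s) (hfs : ∀ x ∈ s, f x = 0) : ∀ᵐ x ∂μ.restrict s, gradient f x = 0 := by
  rcases subsingleton_or_nontrivial E with hE | hE
  · exact ae_of_all _ fun x => Subsingleton.elim _ _
  obtain ⟨v, hv⟩ := exists_ne (0 : E)
  let t := {x | x ∈ s ∧ DifferentiableAt ℝ f x}
  have ht : MeasurableSet t := hs.inter (measurableSet_of_differentiableAt ℝ f)
  have happrox : ApproximatesLinearOn (fun x => f x • v) (0 : E →L[ℝ] E) t 0 := by
    intro x hx y hy
    simp [hfs x hx.1, hfs y hy.1]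
  have hderiv := happrox.norm_fderiv_sub_le μ ht (fun x => (fderiv ℝ f x).smulRight v)
    fun x hx => (hx.2.hasFDerivAt.smul_const v).hasFDerivWithinAt
  rw [ae_restrict_iff' ht] at hderiv
  rw [ae_restrict_iff' hs]
  filter_upwards [hderiv, hf.ae_differentiableAt] with x hx hd hxs
  have hfderiv : fderiv ℝ f x = 0 := by simpa [hv] using hx ⟨hxs, hd⟩
  simp [gradient, hfderiv]

end Lipschitz

section SobolevZero

variable {n : ℕ} {Ω : Set (𝔼 n)}

lemma hasWeakGradient_of_lipschitzWith {K : ℝ≥0} {f : 𝔼 n → ℝ} (hf : LipschitzWith K f) :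
    HasWeakGradient Set.univ f (gradient f) := by
  have hf_loc : LocallyIntegrableOn f Set.univ :=
    hf.continuous.locallyIntegrable.locallyIntegrableOn _
  have hgrad_loc : LocallyIntegrableOn (gradient f) Set.univ :=
    (locallyIntegrable_gradient_of_lipschitzWith hf).locallyIntegrableOn _
  refine .of_integral_univ_eq hf_loc hgrad_loc fun φ hφ => ext_inner_left ℝ fun e => ?_
  obtain ⟨C, hC⟩ := hφ.contDiff.lipschitzWith_of_hasCompactSupport hφ.hasCompactSupport (by simp)
  calc inner ℝ e (∫ x, f x • gradient φ x)
      = -∫ x, lineDeriv ℝ φ x (-e) * f x := by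
        rw [← integral_inner (hφ.integrable_smul_gradient hf_loc), ← integral_neg]
        refine integral_congr_ae (ae_of_all _ fun x => ?_)
        simp only [(hφ.differentiable x).lineDeriv_eq_fderiv, real_inner_smul_right,
          inner_gradient_right, map_neg]
        simp [mul_comm]
    _ = -∫ x, lineDeriv ℝ f x e * φ x := by
        rw [hf.integral_lineDeriv_mul_eq (μ := volume) hC hφ.hasCompactSupport e]
    _ = inner ℝ e (-∫ x, φ x • gradient f x) := by
        rw [inner_neg_right, ← integral_inner (hφ.integrable_smul hgrad_loc), neg_inj]
        refine integral_congr_ae (hf.ae_differentiableAt.mono fun x hx => ?_)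
        simp [hx.lineDeriv_eq_fderiv, real_inner_smul_right, inner_gradient_right, mul_comm]

namespace IsTestFunction

variable {φ : 𝔼 n → ℝ}

lemma hasWeakGradient (hφ : IsTestFunction Ω φ) : HasWeakGradient Set.univ φ (gradient φ) := by
  obtain ⟨C, hC⟩ := hφ.contDiff.lipschitzWith_of_hasCompactSupport hφ.hasCompactSupport (by simp)
  exact hasWeakGradient_of_lipschitzWith hC

lemma memLp (hφ : IsTestFunction Ω φ) (q : ℝ≥0∞) (μ : Measure (𝔼 n))
    [IsFiniteMeasureOnCompacts μ] : MemLp φ q μ :=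
  hφ.continuous.memLp_of_hasCompactSupport hφ.hasCompactSupport

lemma memLp_gradient (hφ : IsTestFunction Ω φ) (q : ℝ≥0∞) (μ : Measure (𝔼 n))
    [IsFiniteMeasureOnCompacts μ] : MemLp (gradient φ) q μ :=
  hφ.continuous_gradient.memLp_of_hasCompactSupport hφ.hasCompactSupport_gradient

end IsTestFunction

lemma eLpNorm_eq_enorm_of_support_subset {X F : Type*} [MeasurableSpace X] {μ : Measure X}
    {s : Set X} [NormedAddCommGroup F] {q : ℝ≥0∞} {f : X → F} (hf : Function.support f ⊆ s)
    {g : Lp F q (μ.restrict s)} (hgf : g =ᵐ[μ.restrict s] f) : eLpNorm f q μ = ‖g‖ₑ := by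
  rw [Lp.enorm_def, eLpNorm_congr_ae hgf, eLpNorm_restrict_eq_of_support_subset hf]

lemma continuous_integral_clm_apply₂ {X F F₁ F₂ : Type*} [TopologicalSpace X] [MeasurableSpace X]
    [OpensMeasurableSpace X] {μ : Measure X} [IsFiniteMeasureOnCompacts μ] {q : ℝ≥0∞}
    [Fact (1 ≤ q)] [NormedAddCommGroup F] [NormedSpace ℝ F] [CompleteSpace F]
    [NormedAddCommGroup F₁] [NormedSpace ℝ F₁] [NormedAddCommGroup F₂] [NormedSpace ℝ F₂]
    (B : F₁ →L[ℝ] F₂ →L[ℝ] F) {g : X → F₁} (hg : Continuous g) (hc : HasCompactSupport g) :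
    Continuous fun x : Lp F₂ q μ => ∫ y, B (g y) (x y) ∂μ := by
  have : Fact (1 ≤ q.conjExponent) := ⟨by simp [ENNReal.conjExponent]⟩
  have hgq : MemLp g q.conjExponent μ := hg.memLp_of_hasCompactSupport hc
  convert ((B.lpPairing μ q.conjExponent q) (hgq.toLp g)).continuous with x
  rw [ContinuousLinearMap.lpPairing_eq_integral]
  exact integral_congr_ae (hgq.coeFn_toLp.mono fun y hy => by simp only [hy])

/-- The space `L^q(Ω) × L^q(Ω; ℝⁿ)`, in which `W^{1,q}(Ω)` embeds by `u ↦ (u, ∇u)`. -/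
abbrev LpPair (q : ℝ≥0∞) (Ω : Set (𝔼 n)) : Type :=
  Lp ℝ q (volume.restrict Ω) × Lp (𝔼 n) q (volume.restrict Ω)

/-- The vector space `C_c^∞(Ω)`. -/
def testFunctions (Ω : Set (𝔼 n)) : Submodule ℝ (𝔼 n → ℝ) where
  carrier := {φ | IsTestFunction Ω φ}
  zero_mem' := IsTestFunction.zero
  add_mem' := IsTestFunction.add
  smul_mem' := fun c _ => IsTestFunction.const_smul c

section

variable (q : ℝ≥0∞) (Ω : Set (𝔼 n))

lemma locallyIntegrableOn_coeFn {F : Type*} [NormedAddCommGroup F] {q : ℝ≥0∞} [Fact (1 ≤ q)]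
    {Ω : Set (𝔼 n)} (g : Lp F q (volume.restrict Ω)) : LocallyIntegrableOn g Ω :=
  locallyIntegrableOn_of_locallyIntegrable_restrict ((Lp.memLp g).locallyIntegrable Fact.out)

/-- The Sobolev space `W^{1,q}(Ω)`, as the space of the pairs `(u, ∇u)`. -/
def sobolevPairs : Submodule ℝ (LpPair q Ω) where
  carrier := {x | HasWeakGradient Ω x.1 x.2}
  zero_mem' := by
    have hzero : HasWeakGradient Ω (0 : 𝔼 n → ℝ) 0 :=
      ⟨locallyIntegrableOn_zero, locallyIntegrableOn_zero, by simp⟩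
    exact hzero.congr_ae (Lp.coeFn_zero _ _ _).symm (Lp.coeFn_zero _ _ _).symm
  add_mem' := fun {x y} hx hy =>
    (HasWeakGradient.add hx hy).congr_ae (Lp.coeFn_add x.1 y.1).symm (Lp.coeFn_add x.2 y.2).symm
  smul_mem' := fun c x hx =>
    (HasWeakGradient.const_smul c hx).congr_ae (Lp.coeFn_smul c x.1).symm
      (Lp.coeFn_smul c x.2).symm

/-- The pairs `(u, ∇u)` for those `u ∈ W^{1,q}(Ω)` that have a representative in `S`. -/
def sobolevPairsOf (S : Submodule ℝ (𝔼 n → ℝ)) : Submodule ℝ (LpPair q Ω) where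
  carrier := {x | x ∈ sobolevPairs q Ω ∧ ∃ w ∈ S, x.1 =ᵐ[volume.restrict Ω] w}
  zero_mem' := ⟨zero_mem _, 0, S.zero_mem, Lp.coeFn_zero _ _ _⟩
  add_mem' := by
    rintro x y ⟨hx, v, hv, hxv⟩ ⟨hy, w, hw, hyw⟩
    exact ⟨add_mem hx hy, v + w, S.add_mem hv hw, (Lp.coeFn_add x.1 y.1).trans (hxv.add hyw)⟩
  smul_mem' := by
    rintro c x ⟨hx, w, hw, hxw⟩
    exact ⟨Submodule.smul_mem _ c hx, c • w, S.smul_mem c hw,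
      (Lp.coeFn_smul c x.1).trans (hxw.const_smul c)⟩

/-- The space `W^{1,q}_0(Ω)`, as the space of the pairs `(u, ∇u)`. -/
noncomputable def sobolevZero [Fact (1 ≤ q)] : Submodule ℝ (LpPair q Ω) :=
  (sobolevPairsOf q Ω (testFunctions Ω)).topologicalClosure

end

variable {q : ℝ≥0∞} {x y : LpPair q Ω} {u v φ : 𝔼 n → ℝ}

lemma eq_of_mem_sobolevPairs (hΩ : IsOpen Ω) (hx : x ∈ sobolevPairs q Ω)
    (hy : y ∈ sobolevPairs q Ω) (hxy : x.1 = y.1) : x = y := by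
  refine Prod.ext hxy (Lp.ext (HasWeakGradient.ae_unique hΩ hx ?_))
  rw [hxy]
  exact hy

lemma IsTestFunction.toLp_mem_sobolevPairsOf (hφ : IsTestFunction Ω φ) :
    ((hφ.memLp q _).toLp φ, (hφ.memLp_gradient q _).toLp (gradient φ)) ∈
      sobolevPairsOf q Ω (testFunctions Ω) :=
  ⟨(hφ.hasWeakGradient.mono (Set.subset_univ Ω)).congr_ae (hφ.memLp q _).coeFn_toLp.symm
    (hφ.memLp_gradient q _).coeFn_toLp.symm, φ, hφ, (hφ.memLp q _).coeFn_toLp⟩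

lemma snd_ae_eq_gradient (hΩ : IsOpen Ω) (hx : x ∈ sobolevPairs q Ω) (hφ : IsTestFunction Ω φ)
    (hxφ : x.1 =ᵐ[volume.restrict Ω] φ) : x.2 =ᵐ[volume.restrict Ω] gradient φ :=
  (HasWeakGradient.congr_ae hx hxφ .rfl).ae_unique hΩ (hφ.hasWeakGradient.mono (Set.subset_univ Ω))

lemma weakGradient_ae_eq_snd (hΩ : IsOpen Ω) (hx : x ∈ sobolevPairs q Ω)
    (hxu : x.1 =ᵐ[volume.restrict Ω] u) : weakGradient Ω u =ᵐ[volume.restrict Ω] x.2 :=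
  (HasWeakGradient.congr_ae hx hxu .rfl).weakGradient_ae_eq hΩ

variable [Fact (1 ≤ q)]

lemma isClosed_sobolevPairs : IsClosed (sobolevPairs q Ω : Set (LpPair q Ω)) := by
  have hset : (sobolevPairs q Ω : Set (LpPair q Ω)) = ⋂ φ, ⋂ _ : IsTestFunction Ω φ,
      {x | ∫ y in Ω, x.1 y • gradient φ y = -∫ y in Ω, φ y • x.2 y} := by
    ext x
    simp only [Set.mem_iInter]
    exact ⟨fun hx => hx.integral_eq, fun hx =>
      ⟨locallyIntegrableOn_coeFn x.1, locallyIntegrableOn_coeFn x.2, hx⟩⟩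
  rw [hset]
  refine isClosed_iInter fun φ => isClosed_iInter fun hφ => isClosed_eq ?_ (Continuous.neg ?_)
  · have := continuous_integral_clm_apply₂ (μ := volume.restrict Ω) (q := q)
      (ContinuousLinearMap.lsmul ℝ ℝ (E := 𝔼 n)).flip hφ.continuous_gradient
      hφ.hasCompactSupport_gradient
    simpa [Function.comp_def] using this.comp continuous_fst
  · have := continuous_integral_clm_apply₂ (μ := volume.restrict Ω) (q := q)
      (ContinuousLinearMap.lsmul ℝ ℝ (E := 𝔼 n)) hφ.continuous hφ.hasCompactSupport
    simpa [Function.comp_def] using this.comp continuous_snd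

lemma sobolevZero_le_sobolevPairs : sobolevZero q Ω ≤ sobolevPairs q Ω :=
  Submodule.topologicalClosure_minimal _ (fun _ hx => hx.1) isClosed_sobolevPairs

lemma mem_sobolevZero_iff_exists_seq (hΩ : IsOpen Ω) :
    x ∈ sobolevZero q Ω ↔ ∃ φ : ℕ → 𝔼 n → ℝ, (∀ k, IsTestFunction Ω (φ k)) ∧
      Tendsto (fun k => eLpNorm (fun y => x.1 y - φ k y) q (volume.restrict Ω)) atTop (𝓝 0) ∧
      Tendsto (fun k => eLpNorm (fun y => x.2 y - gradient (φ k) y) q (volume.restrict Ω))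
        atTop (𝓝 0) := by
  rw [sobolevZero, ← SetLike.mem_coe, Submodule.topologicalClosure_coe,
    mem_closure_iff_seq_limit]
  constructor
  · rintro ⟨y, hy, hlim⟩
    choose hpair φ hφ hyφ using hy
    have hyφ' := fun k => snd_ae_eq_gradient hΩ (hpair k) (hφ k) (hyφ k)
    rw [Prod.tendsto_iff, Lp.tendsto_Lp_iff_tendsto_eLpNorm', Lp.tendsto_Lp_iff_tendsto_eLpNorm']
      at hlim
    refine ⟨φ, hφ, hlim.1.congr fun k => ?_, hlim.2.congr fun k => ?_⟩
    · rw [eLpNorm_sub_comm]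
      exact eLpNorm_congr_ae (EventuallyEq.rfl.sub (hyφ k))
    · rw [eLpNorm_sub_comm]
      exact eLpNorm_congr_ae (EventuallyEq.rfl.sub (hyφ' k))
  · rintro ⟨φ, hφ, hlim, hlim_grad⟩
    refine ⟨fun k => _, fun k => (hφ k).toLp_mem_sobolevPairsOf, ?_⟩
    rw [Prod.tendsto_iff, Lp.tendsto_Lp_iff_tendsto_eLpNorm', Lp.tendsto_Lp_iff_tendsto_eLpNorm']
    refine ⟨hlim.congr fun k => ?_, hlim_grad.congr fun k => ?_⟩
    · rw [eLpNorm_sub_comm]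
      exact eLpNorm_congr_ae (EventuallyEq.rfl.sub ((hφ k).memLp q _).coeFn_toLp.symm)
    · rw [eLpNorm_sub_comm]
      exact eLpNorm_congr_ae (EventuallyEq.rfl.sub ((hφ k).memLp_gradient q _).coeFn_toLp.symm)

lemma exists_mem_sobolevZero_of_support_subset (hq : q ≠ ⊤) {w : 𝔼 n → ℝ} {G : 𝔼 n → 𝔼 n}
    (h : HasWeakGradient Set.univ w G) (hw : MemLp w q) (hG : MemLp G q) {K : Set (𝔼 n)}
    (hK : IsCompact K) (hΩ : IsOpen Ω) (hKΩ : K ⊆ Ω) (hwK : Function.support w ⊆ K) :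
    ∃ x ∈ sobolevZero q Ω, x.1 =ᵐ[volume.restrict Ω] w := by
  refine ⟨((hw.restrict Ω).toLp, (hG.restrict Ω).toLp), ?_, (hw.restrict Ω).coeFn_toLp⟩
  rw [sobolevZero, ← SetLike.mem_coe, Submodule.topologicalClosure_coe, EMetric.mem_closure_iff]
  intro ε hε
  obtain ⟨δ, hδ, hδε⟩ := exists_between hε
  obtain ⟨φ, hφ, hwφ, hGφ⟩ :=
    h.exists_isTestFunction_eLpNorm_sub_le Fact.out hq hw hG hK hΩ hKΩ hwK hδ.ne'
  refine ⟨_, hφ.toLp_mem_sobolevPairsOf, ?_⟩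
  rw [Prod.edist_eq, Lp.edist_toLp_toLp, Lp.edist_toLp_toLp, max_lt_iff]
  exact ⟨((eLpNorm_restrict_le _ _ _ Ω).trans hwφ).trans_lt hδε,
    ((eLpNorm_restrict_le _ _ _ Ω).trans hGφ).trans_lt hδε⟩

variable {p : ℝ} [Fact (1 ≤ ENNReal.ofReal p)]

lemma memSobolevZero_iff (hΩ : IsOpen Ω) :
    MemSobolevZero p Ω u ↔ ∃ x ∈ sobolevZero (ENNReal.ofReal p) Ω, x.1 =ᵐ[volume.restrict Ω] u := by
  constructor
  · rintro ⟨h, φ, hφ, hlim, hlim_grad⟩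
    refine ⟨(h.memLp.toLp, h.memLp_weakGradient.toLp), ?_, h.memLp.coeFn_toLp⟩
    refine (mem_sobolevZero_iff_exists_seq hΩ).mpr ⟨φ, hφ, hlim.congr fun k => ?_,
      hlim_grad.congr fun k => ?_⟩
    · exact eLpNorm_congr_ae (h.memLp.coeFn_toLp.symm.sub .rfl)
    · exact eLpNorm_congr_ae (h.memLp_weakGradient.coeFn_toLp.symm.sub .rfl)
  · rintro ⟨x, hx, hxu⟩
    have hgrad : HasWeakGradient Ω u x.2 := (sobolevZero_le_sobolevPairs hx).congr_ae hxu .rfl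
    have hgrad_ae := (hgrad.weakGradient_ae_eq hΩ).symm
    obtain ⟨φ, hφ, hlim, hlim_grad⟩ := (mem_sobolevZero_iff_exists_seq hΩ).mp hx
    refine ⟨.of_hasWeakGradient hΩ hgrad ((Lp.memLp x.1).ae_eq hxu) (Lp.memLp x.2), φ, hφ,
      hlim.congr fun k => eLpNorm_congr_ae (hxu.sub .rfl),
      hlim_grad.congr fun k => eLpNorm_congr_ae (hgrad_ae.sub .rfl)⟩

namespace MemSobolevZero

lemma add (hΩ : IsOpen Ω) (hu : MemSobolevZero p Ω u) (hv : MemSobolevZero p Ω v) :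
    MemSobolevZero p Ω (u + v) := by
  obtain ⟨x, hx, hxu⟩ := (memSobolevZero_iff hΩ).mp hu
  obtain ⟨y, hy, hyv⟩ := (memSobolevZero_iff hΩ).mp hv
  exact (memSobolevZero_iff hΩ).mpr
    ⟨x + y, add_mem hx hy, (Lp.coeFn_add x.1 y.1).trans (hxu.add hyv)⟩

lemma const_smul (hΩ : IsOpen Ω) (c : ℝ) (hu : MemSobolevZero p Ω u) :
    MemSobolevZero p Ω (c • u) := by
  obtain ⟨x, hx, hxu⟩ := (memSobolevZero_iff hΩ).mp hu
  exact (memSobolevZero_iff hΩ).mpr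
    ⟨c • x, Submodule.smul_mem _ c hx, (Lp.coeFn_smul c x.1).trans (hxu.const_smul c)⟩

lemma sub (hΩ : IsOpen Ω) (hu : MemSobolevZero p Ω u) (hv : MemSobolevZero p Ω v) :
    MemSobolevZero p Ω (u - v) := by
  simpa [sub_eq_add_neg] using hu.add hΩ (hv.const_smul hΩ (-1))

end MemSobolevZero

end SobolevZero

section ClosedRange

variable {V W U : Type*} [NormedAddCommGroup V] [NormedSpace ℝ V] [NormedAddCommGroup W]
  [NormedSpace ℝ W] [NormedAddCommGroup U] [NormedSpace ℝ U]

/-- On the subspace `X`, the operator `J` is bounded by finitely many continuous functionals, up to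
an arbitrarily small multiple of the norm. This form of compactness of `J` on `X` passes directly
to the closure of `X`. -/
def IsAlmostFiniteRankOn (J : V →L[ℝ] U) (X : Submodule ℝ V) : Prop :=
  ∀ ε : ℝ, 0 < ε → ∃ (N : ℕ) (P : V →L[ℝ] (Fin N → ℝ)), ∀ x ∈ X, ‖J x‖ ≤ ε * ‖x‖ + ‖P x‖

lemma IsAlmostFiniteRankOn.topologicalClosure {J : V →L[ℝ] U} {X : Submodule ℝ V}
    (hJ : IsAlmostFiniteRankOn J X) : IsAlmostFiniteRankOn J X.topologicalClosure := by
  intro ε hε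
  obtain ⟨N, P, hP⟩ := hJ ε hε
  have hclosed : IsClosed {x | ‖J x‖ ≤ ε * ‖x‖ + ‖P x‖} := isClosed_le (by fun_prop) (by fun_prop)
  exact ⟨N, P, closure_minimal hP hclosed⟩

lemma isClosed_map_of_norm_le_add_norm [CompleteSpace V] {F : Type*} [NormedAddCommGroup F]
    [NormedSpace ℝ F] [FiniteDimensional ℝ F] {R : V →L[ℝ] W} {P : V →L[ℝ] F} {X : Submodule ℝ V}
    (hX : IsClosed (X : Set V)) {C : ℝ} (hC : ∀ x ∈ X, ‖x‖ ≤ C * (‖R x‖ + ‖P x‖)) :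
    IsClosed (X.map R.toLinearMap : Set W) := by
  have : CompleteSpace X := hX.completeSpace_coe
  let R' : X →L[ℝ] W := R.comp X.subtypeL
  let P' : X →L[ℝ] F := P.comp X.subtypeL
  let S : Submodule ℝ X := LinearMap.ker P'.toLinearMap
  have : CompleteSpace S := P'.isClosed_ker.completeSpace_coe
  have hanti : AntilipschitzWith C.toNNReal (R'.comp S.subtypeL) := by
    refine ContinuousLinearMap.antilipschitz_of_bound _ fun x => ?_
    have hPx : P ((x : X) : V) = 0 := x.2
    have hx := hC x x.1.2
    rw [hPx, norm_zero, add_zero] at hx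
    exact hx.trans (mul_le_mul_of_nonneg_right (Real.le_coe_toNNReal C) (norm_nonneg _))
  have hker : IsClosed (S.map R'.toLinearMap : Set W) := by
    convert hanti.isClosed_range (R'.comp S.subtypeL).uniformContinuous using 1
    ext y
    simp [R']
  have : S.CoFG := Submodule.CoFG.ker _
  convert LinearMap.isClosed_range_of_isClosed_map_of_finiteDimensional_quotient hker using 1
  ext y
  simp [R']

lemma IsAlmostFiniteRankOn.isClosed_map [CompleteSpace V] {R : V →L[ℝ] W} {J : V →L[ℝ] U}
    {X : Submodule ℝ V} (hJ : IsAlmostFiniteRankOn J X) (hX : IsClosed (X : Set V)) {C : ℝ}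
    (hC : ∀ x ∈ X, ‖x‖ ≤ C * (‖R x‖ + ‖J x‖)) : IsClosed (X.map R.toLinearMap : Set W) := by
  have hB : 0 < max C 1 := by positivity
  obtain ⟨N, P, hP⟩ := hJ (2 * max C 1)⁻¹ (by positivity)
  refine isClosed_map_of_norm_le_add_norm (P := P) (C := 2 * max C 1) hX fun x hx => ?_
  have hbound : ‖x‖ ≤ max C 1 * (‖R x‖ + ((2 * max C 1)⁻¹ * ‖x‖ + ‖P x‖)) :=
    (hC x hx).trans (mul_le_mul (le_max_left _ _) (by gcongr; exact hP x hx) (by positivity) hB.le)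
  have habsorb : max C 1 * ((2 * max C 1)⁻¹ * ‖x‖) = ‖x‖ / 2 := by field_simp
  linarith

lemma IsAlmostFiniteRankOn.isClosed_map_topologicalClosure [CompleteSpace V] {R : V →L[ℝ] W}
    {J : V →L[ℝ] U} {A B : Submodule ℝ V} (hJ : IsAlmostFiniteRankOn J A)
    (hBA : B ≤ A.topologicalClosure) (hAB : A.map R.toLinearMap ≤ B.map R.toLinearMap) {C : ℝ}
    (hC : ∀ x ∈ B, ‖x‖ ≤ C * (‖R x‖ + ‖J x‖)) :
    IsClosed (A.topologicalClosure.map R.toLinearMap : Set W) := by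
  have hB_le : B.topologicalClosure ≤ A.topologicalClosure :=
    Submodule.topologicalClosure_minimal _ hBA A.isClosed_topologicalClosure
  have hBR : IsClosed (B.topologicalClosure.map R.toLinearMap : Set W) := by
    have hclosed : IsClosed {x | ‖x‖ ≤ C * (‖R x‖ + ‖J x‖)} :=
      isClosed_le (by fun_prop) (by fun_prop)
    exact IsAlmostFiniteRankOn.isClosed_map (fun ε hε => (hJ.topologicalClosure ε hε).imp
      fun _ => Exists.imp fun _ hP x hx => hP x (hB_le hx)) B.isClosed_topologicalClosure
      (closure_minimal hC hclosed)
  suffices A.topologicalClosure.map R.toLinearMap = B.topologicalClosure.map R.toLinearMap by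
    rwa [this]
  refine le_antisymm (Submodule.map_le_iff_le_comap.mpr ?_) (Submodule.map_mono hB_le)
  exact Submodule.topologicalClosure_minimal _ (Submodule.map_le_iff_le_comap.mp
    (hAB.trans (Submodule.map_mono B.le_topologicalClosure))) (hBR.preimage R.continuous)

lemma exists_norm_le_add_norm_pi_of_totallyBounded {L : Set (V →L[ℝ] U)} (hL : TotallyBounded L)
    {ε : ℝ} (hε : 0 < ε) :
    ∃ (N : ℕ) (ℓ : Fin N → V →L[ℝ] U), ∀ f ∈ L, ∀ x, ‖f x‖ ≤ ε * ‖x‖ + ‖fun i => ℓ i x‖ := by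
  obtain ⟨T, -, hT, hLT⟩ := Metric.finite_approx_of_totallyBounded hL ε hε
  obtain ⟨N, ℓ, -, rfl⟩ := hT.fin_param
  refine ⟨N, ℓ, fun f hf x => ?_⟩
  obtain ⟨_, ⟨i, rfl⟩, hfi⟩ := Set.mem_iUnion₂.mp (hLT hf)
  calc ‖f x‖ ≤ ‖f x - ℓ i x‖ + ‖ℓ i x‖ := norm_le_norm_sub_add _ _
    _ ≤ ε * ‖x‖ + ‖fun i => ℓ i x‖ := by
      refine add_le_add ((f - ℓ i).le_of_opNorm_le ?_ x) (norm_le_pi_norm (fun i => ℓ i x) i)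
      rw [← dist_eq_norm]
      exact (Metric.mem_ball.mp hfi).le

end ClosedRange

section Rellich

lemma exists_lipschitzWith_eq_integral_smul {E : Type*} [NormedAddCommGroup E] [MeasurableSpace E]
    [BorelSpace E] {μ : Measure E} [IsFiniteMeasure μ] {q : ℝ≥0∞} [Fact (1 ≤ q)] {η : E → ℝ}
    {K : ℝ≥0} (hη : LipschitzWith K η) (hηs : HasCompactSupport η) :
    ∃ (ℓ : E → Lp ℝ q μ →L[ℝ] ℝ) (C : ℝ≥0), LipschitzWith C ℓ ∧
      ∀ z w, ℓ z w = ∫ t, η (z - t) • w t ∂μ := by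
  have : Fact (1 ≤ q.conjExponent) := ⟨by simp [ENNReal.conjExponent]⟩
  have hmem : ∀ z, MemLp (fun t => η (z - t)) q.conjExponent μ := fun z =>
    (hη.continuous.comp (continuous_sub_left z)).memLp_of_hasCompactSupport
      (hηs.comp_homeomorph (Homeomorph.subLeft z))
  let pairing := (ContinuousLinearMap.lsmul ℝ ℝ (E := ℝ)).lpPairing μ q.conjExponent q
  let A := measureUnivNNReal μ ^ q.conjExponent.toReal⁻¹ * K
  have htranslates : LipschitzWith A fun z => (hmem z).toLp := by
    refine LipschitzWith.of_dist_le_mul fun z z' => ?_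
    rw [dist_eq_norm, ← MemLp.toLp_sub]
    refine (Lp.norm_le_of_ae_bound (C := K * dist z z') (by positivity) ?_).trans_eq ?_
    · filter_upwards [((hmem z).sub (hmem z')).coeFn_toLp] with t ht
      rw [ht, Pi.sub_apply, ← dist_eq_norm]
      simpa using hη.dist_le_mul (z - t) (z' - t)
    · simp [A, mul_assoc]
  refine ⟨fun z => pairing (hmem z).toLp, ‖pairing‖₊ * A, pairing.lipschitz.comp htranslates,
    fun z w => ?_⟩
  simp only [pairing, ContinuousLinearMap.lpPairing_eq_integral]
  exact integral_congr_ae ((hmem z).coeFn_toLp.mono fun t ht => by simp [ht])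

lemma exists_eLpNorm_integral_smul_le {E : Type*} [NormedAddCommGroup E] [ProperSpace E]
    [MeasurableSpace E] [BorelSpace E] {μ : Measure E} [IsFiniteMeasure μ] {s : Set E}
    (hs : Bornology.IsBounded s) (hμs : ∀ᵐ z ∂μ, z ∈ s) {q : ℝ≥0∞} [Fact (1 ≤ q)] {η : E → ℝ}
    {K : ℝ≥0} (hη : LipschitzWith K η) (hηs : HasCompactSupport η) {ε : ℝ} (hε : 0 < ε) :
    ∃ (N : ℕ) (P : Lp ℝ q μ →L[ℝ] (Fin N → ℝ)), ∀ w : Lp ℝ q μ,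
      eLpNorm (fun z => ∫ t, η (z - t) • w t ∂μ) q μ ≤ ENNReal.ofReal (ε * ‖w‖ + ‖P w‖) := by
  obtain ⟨ℓ, C, hℓ, hℓη⟩ := exists_lipschitzWith_eq_integral_smul (μ := μ) (q := q) hη hηs
  let A : ℝ := (μ Set.univ ^ q.toReal⁻¹).toReal
  have hA : 0 ≤ A := ENNReal.toReal_nonneg
  obtain ⟨N, ℓ', hℓ'⟩ := exists_norm_le_add_norm_pi_of_totallyBounded
    (hs.isCompact_closure.totallyBounded.image hℓ.uniformContinuous) (ε := ε / (A + 1))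
    (by positivity)
  refine ⟨N, A • ContinuousLinearMap.pi ℓ', fun w => ?_⟩
  have hbound : ∀ᵐ z ∂μ, ‖∫ t, η (z - t) • w t ∂μ‖ ≤ ε / (A + 1) * ‖w‖ + ‖fun i => ℓ' i w‖ := by
    filter_upwards [hμs] with z hz
    rw [← hℓη]
    exact hℓ' _ (Set.mem_image_of_mem ℓ (subset_closure hz)) w
  have hεA : A * (ε / (A + 1)) ≤ ε := by
    rw [mul_div_left_comm]
    exact mul_le_of_le_one_right hε.le ((div_le_one (by positivity)).mpr (by linarith))
  calc eLpNorm (fun z => ∫ t, η (z - t) • w t ∂μ) q μ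
      ≤ μ Set.univ ^ q.toReal⁻¹ * ENNReal.ofReal (ε / (A + 1) * ‖w‖ + ‖fun i => ℓ' i w‖) :=
        eLpNorm_le_of_ae_bound hbound
    _ = ENNReal.ofReal (A * (ε / (A + 1) * ‖w‖ + ‖fun i => ℓ' i w‖)) := by
        rw [ENNReal.ofReal_mul hA, ENNReal.ofReal_toReal
          (ENNReal.rpow_ne_top_of_nonneg (by positivity) (measure_ne_top μ _))]
    _ ≤ ENNReal.ofReal (ε * ‖w‖ + ‖(A • ContinuousLinearMap.pi ℓ') w‖) := by
        rw [smul_apply, norm_smul, Real.norm_of_nonneg hA, mul_add, ← mul_assoc]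
        gcongr
        rfl

open ContinuousLinearMap (lsmul)
open scoped Convolution

variable {n : ℕ} {q : ℝ≥0∞} [Fact (1 ≤ q)] {Ω : Set (𝔼 n)}

lemma IsTestFunction.convolution_eq_setIntegral {φ : 𝔼 n → ℝ} (hφ : IsTestFunction Ω φ)
    (η : 𝔼 n → ℝ) (z : 𝔼 n) : (η ⋆[lsmul ℝ ℝ] φ) z = ∫ t in Ω, η (z - t) • φ t := by
  rw [convolution_eq_swap]
  exact (setIntegral_eq_integral_of_forall_compl_eq_zero fun t ht => by
    simp [hφ.eq_zero_of_notMem ht]).symm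

lemma eLpNorm_sub_convolution_bump_le_norm_snd (hq : q ≠ ⊤) (hΩ : IsOpen Ω) {x : LpPair q Ω}
    (hx : x ∈ sobolevPairs q Ω) {φ : 𝔼 n → ℝ} (hφ : IsTestFunction Ω φ)
    (hxφ : x.1 =ᵐ[volume.restrict Ω] φ) (bump : ContDiffBump (0 : 𝔼 n)) :
    eLpNorm (fun z => φ z - (bump.normed volume ⋆[lsmul ℝ ℝ] φ) z) q (volume.restrict Ω) ≤
      ENNReal.ofReal (bump.rOut * ‖x.2‖) := by
  rw [ENNReal.ofReal_mul bump.rOut_pos.le, ofReal_norm, ← eLpNorm_eq_enorm_of_support_subset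
    hφ.support_gradient_subset (snd_ae_eq_gradient hΩ hx hφ hxφ)]
  exact (eLpNorm_restrict_le _ _ _ _).trans (eLpNorm_sub_convolution_le_mul_gradient Fact.out hq
    bump.nonneg_normed bump.continuous_normed bump.hasCompactSupport_normed bump.integral_normed
    bump.support_normed_eq.le (hφ.contDiff.of_le (by simp)) (hφ.memLp q _))

lemma isAlmostFiniteRankOn_fst_testFunctions (hq : q ≠ ⊤) (hΩ : IsOpen Ω)
    (hΩb : Bornology.IsBounded Ω) :
    IsAlmostFiniteRankOn (ContinuousLinearMap.fst ℝ _ _ : LpPair q Ω →L[ℝ] _)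
      (sobolevPairsOf q Ω (testFunctions Ω)) := by
  intro ε hε
  have : IsFiniteMeasure ((volume : Measure (𝔼 n)).restrict Ω) :=
    isFiniteMeasure_restrict.mpr hΩb.measure_lt_top.ne
  let bump : ContDiffBump (0 : 𝔼 n) := ⟨ε / 4, ε / 2, by positivity, by linarith⟩
  let η := bump.normed volume
  have hη : ContDiff ℝ ∞ η := bump.contDiff_normed
  have hηs : HasCompactSupport η := bump.hasCompactSupport_normed
  obtain ⟨K, hK⟩ := hη.lipschitzWith_of_hasCompactSupport hηs (by simp)
  obtain ⟨N, P, hP⟩ := exists_eLpNorm_integral_smul_le (q := q) (μ := volume.restrict Ω) hΩb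
    (ae_restrict_mem hΩ.measurableSet) hK hηs (half_pos hε)
  refine ⟨N, P.comp (ContinuousLinearMap.fst ℝ _ _), ?_⟩
  rintro x ⟨hx, φ, hφ : IsTestFunction Ω φ, hxφ⟩
  have hconv : (η ⋆[lsmul ℝ ℝ] φ) = fun z => ∫ t in Ω, η (z - t) • x.1 t := by
    ext z
    rw [hφ.convolution_eq_setIntegral]
    exact integral_congr_ae (hxφ.mono fun t ht => by simp only [ht])
  have hmollify : eLpNorm (fun z => φ z - (η ⋆[lsmul ℝ ℝ] φ) z) q (volume.restrict Ω)
      ≤ ENNReal.ofReal (ε / 2 * ‖x.2‖) :=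
    eLpNorm_sub_convolution_bump_le_norm_snd hq hΩ hx hφ hxφ bump
  have hφ_eq : φ = (fun z => φ z - (η ⋆[lsmul ℝ ℝ] φ) z) + (η ⋆[lsmul ℝ ℝ] φ) := by
    ext z
    simp
  have hconv_cont : Continuous (η ⋆[lsmul ℝ ℝ] φ) :=
    hηs.continuous_convolution_left _ hη.continuous hφ.continuous.locallyIntegrable
  have hsum : ENNReal.ofReal ‖x.1‖
      ≤ ENNReal.ofReal (ε / 2 * ‖x.2‖ + (ε / 2 * ‖x.1‖ + ‖P x.1‖)) := by
    rw [ofReal_norm, Lp.enorm_def, eLpNorm_congr_ae hxφ, hφ_eq,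
      ENNReal.ofReal_add (by positivity) (by positivity)]
    refine (eLpNorm_add_le (hφ.continuous.sub hconv_cont).aestronglyMeasurable
      hconv_cont.aestronglyMeasurable Fact.out).trans (add_le_add hmollify ?_)
    rw [hconv]
    exact hP x.1
  rw [ENNReal.ofReal_le_ofReal_iff (by positivity)] at hsum
  calc ‖x.1‖ ≤ ε / 2 * ‖x.2‖ + (ε / 2 * ‖x.1‖ + ‖P x.1‖) := hsum
    _ ≤ ε / 2 * ‖x‖ + (ε / 2 * ‖x‖ + ‖P x.1‖) := by
        gcongr
        · exact norm_snd_le x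
        · exact norm_fst_le x
    _ = ε * ‖x‖ + ‖P x.1‖ := by ring

end Rellich

section Reflection

lemma map_le_smul_of_lipschitzWith_of_involutive {E : Type*} [NormedAddCommGroup E]
    [InnerProductSpace ℝ E] [FiniteDimensional ℝ E] [MeasurableSpace E] [BorelSpace E]
    {Φ : E → E} {L : ℝ≥0} (hL : LipschitzWith L Φ) (hinv : Function.Involutive Φ) (μ : Measure E)
    [μ.IsAddHaarMeasure] : μ.map Φ ≤ (L : ℝ≥0∞) ^ Module.finrank ℝ E • μ := by
  obtain ⟨c, hc⟩ : ∃ c : ℝ≥0, μ = c • Measure.hausdorffMeasure (Module.finrank ℝ E) :=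
    ⟨_, Measure.isAddLeftInvariant_eq_smul_of_regular _ _⟩
  refine Measure.le_iff.mpr fun s hs => ?_
  have himage := hL.hausdorffMeasure_image_le (d := Module.finrank ℝ E) (by positivity) s
  rw [ENNReal.rpow_natCast] at himage
  rw [Measure.map_apply hL.continuous.measurable hs, ← hinv.image_eq_preimage_symm, hc]
  simp only [Measure.smul_apply, ENNReal.smul_def, smul_eq_mul]
  rw [mul_left_comm]
  gcongr

lemma eq_of_mem_frontier_of_eventually_mem_iff_lt {X : Type*} [TopologicalSpace X] {D : Set X}
    {f g : X → ℝ} (hf : Continuous f) (hg : Continuous g) (hD : IsOpen D) {x : X}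
    (hx : x ∈ frontier D) (hDx : ∀ᶠ y in 𝓝 x, y ∈ D ↔ f y < g y) : f x = g x := by
  rw [hD.frontier_eq] at hx
  refine le_antisymm (closure_lt_subset_le hf hg ?_) ?_
  · rw [mem_closure_iff_frequently]
    exact ((mem_closure_iff_frequently.mp hx.1).and_eventually hDx).mono fun y hy => hy.2.mp hy.1
  · exact not_lt.mp fun hlt => hx.2 (hDx.self_of_nhds.mpr hlt)

section GraphReflection

variable {E : Type*} [NormedAddCommGroup E] [InnerProductSpace ℝ E]

/-- The map that exchanges the two sides of the graph `{y | ⟪ν, y⟫ = γ (y - ⟪ν, y⟫ ν)}` of a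
function `γ`, by reflecting each line parallel to the unit vector `ν` at its point in the graph. -/
noncomputable def graphReflection (ν : E) (γ : E → ℝ) (y : E) : E :=
  y + (2 * (γ (y - inner ℝ ν y • ν) - inner ℝ ν y)) • ν

variable {ν : E} {γ : E → ℝ} {K : ℝ≥0}

lemma inner_graphReflection (hν : ‖ν‖ = 1) (y : E) :
    inner ℝ ν (graphReflection ν γ y) = 2 * γ (y - inner ℝ ν y • ν) - inner ℝ ν y := by
  rw [graphReflection, inner_add_right, real_inner_smul_right, real_inner_self_eq_norm_sq, hν]
  ring

lemma graphReflection_sub_inner_smul (hν : ‖ν‖ = 1) (y : E) :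
    graphReflection ν γ y - inner ℝ ν (graphReflection ν γ y) • ν = y - inner ℝ ν y • ν := by
  rw [inner_graphReflection hν, graphReflection]
  module

lemma graphReflection_eq_self {y : E} (hy : γ (y - inner ℝ ν y • ν) = inner ℝ ν y) :
    graphReflection ν γ y = y := by
  simp [graphReflection, hy]

lemma involutive_graphReflection (hν : ‖ν‖ = 1) : Function.Involutive (graphReflection ν γ) := by
  intro y
  rw [graphReflection, graphReflection_sub_inner_smul hν, inner_graphReflection hν,
    graphReflection]
  module

lemma exists_lipschitzWith_graphReflection (ν : E) (hγ : LipschitzWith K γ) :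
    ∃ L : ℝ≥0, LipschitzWith L (graphReflection ν γ) := by
  let height : E →L[ℝ] ℝ := innerSL ℝ ν
  let horizontal : E →L[ℝ] E := ContinuousLinearMap.id ℝ E - height.smulRight ν
  let vertical : ℝ →L[ℝ] E := (2 : ℝ) • ContinuousLinearMap.toSpanSingleton ℝ ν
  have heq : graphReflection ν γ = fun y => y + vertical (γ (horizontal y) - height y) := by
    ext y
    simp [graphReflection, vertical, horizontal, height, mul_smul]
  rw [heq]
  exact ⟨_, LipschitzWith.id.add (vertical.lipschitz.comp
    ((hγ.comp horizontal.lipschitz).sub height.lipschitz))⟩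

end GraphReflection

variable {n : ℕ} {D : Set (𝔼 n)}

lemma HasLipschitzBoundary.exists_reflection (hD : HasLipschitzBoundary D) (hDo : IsOpen D)
    {x₀ : 𝔼 n} (hx₀ : x₀ ∈ frontier D) :
    ∃ (Φ : 𝔼 n → 𝔼 n) (L : ℝ≥0) (ρ : ℝ), 0 < ρ ∧ LipschitzWith L Φ ∧ Function.Involutive Φ ∧
      (∀ y ∈ Metric.ball x₀ ρ, y ∈ D → Φ y ∉ D) ∧
      (∀ y ∈ Metric.ball x₀ ρ, y ∈ frontier D → Φ y = y) := by
  obtain ⟨ν, γ, K, r, hν, hγ, hr, hDγ⟩ := hD x₀ hx₀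
  obtain ⟨L, hL⟩ := exists_lipschitzWith_graphReflection ν hγ
  have hfixed : ∀ y ∈ Metric.ball x₀ r, y ∈ frontier D → graphReflection ν γ y = y := by
    intro y hy hyD
    have hγc := hγ.continuous
    exact graphReflection_eq_self (eq_of_mem_frontier_of_eventually_mem_iff_lt (by fun_prop)
      (by fun_prop) hDo hyD (eventually_of_mem (Metric.isOpen_ball.mem_nhds hy) hDγ))
  have hnear : ∀ᶠ y in 𝓝 x₀, graphReflection ν γ y ∈ Metric.ball x₀ r := by
    refine hL.continuous.continuousAt.eventually_mem ?_
    rw [hfixed x₀ (Metric.mem_ball_self hr) hx₀]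
    exact Metric.ball_mem_nhds x₀ hr
  obtain ⟨ρ, hρ, hball⟩ := Metric.eventually_nhds_iff_ball.mp
    (hnear.and (Metric.ball_mem_nhds x₀ hr))
  refine ⟨graphReflection ν γ, L, ρ, hρ, hL, involutive_graphReflection hν,
    fun y hy hyD hΦD => ?_, fun y hy => hfixed y (hball y hy).2⟩
  have habove := (hDγ y (hball y hy).2).mp hyD
  have hΦ_above := (hDγ _ (hball y hy).1).mp hΦD
  rw [graphReflection_sub_inner_smul hν, inner_graphReflection hν] at hΦ_above
  linarith

/-- Finitely many involutions `Φ i` with Lipschitz constant `L`, which move points of `D` near the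
boundary out of `D` and fix the boundary points, together with cutoff functions `χ i` that add up
to one on the boundary; these properties of `Φ i` are required only in the support of `χ i`. -/
structure IsReflectionCover {ι : Type*} [Fintype ι] (D : Set (𝔼 n)) (χ : ι → 𝔼 n → ℝ)
    (Φ : ι → 𝔼 n → 𝔼 n) (L : ℝ≥0) : Prop where
  contDiff : ∀ i, ContDiff ℝ ∞ (χ i)
  hasCompactSupport : ∀ i, HasCompactSupport (χ i)
  sum_eq_one : ∀ y ∈ frontier D, ∑ i, χ i y = 1
  lipschitzWith : ∀ i, LipschitzWith L (Φ i)
  involutive : ∀ i, Function.Involutive (Φ i)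
  apply_notMem : ∀ i, ∀ y ∈ tsupport (χ i), y ∈ D → Φ i y ∉ D
  apply_eq : ∀ i, ∀ y ∈ tsupport (χ i), y ∈ frontier D → Φ i y = y

open scoped Manifold in
lemma HasLipschitzBoundary.exists_isReflectionCover (hD : HasLipschitzBoundary D)
    (hDo : IsOpen D) (hDb : Bornology.IsBounded D) :
    ∃ (T : Finset (𝔼 n)) (χ : T → 𝔼 n → ℝ) (Φ : T → 𝔼 n → 𝔼 n) (L : ℝ≥0),
      IsReflectionCover D χ Φ L := by
  have hcompact : IsCompact (frontier D) :=
    hDb.isCompact_closure.of_isClosed_subset isClosed_frontier frontier_subset_closure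
  choose! Φ L ρ hρ hL hinv hmem hfixed using fun x₀ (hx₀ : x₀ ∈ frontier D) =>
    hD.exists_reflection hDo hx₀
  obtain ⟨T, hT, hcover⟩ := hcompact.elim_nhds_subcover (fun x => Metric.ball x (ρ x))
    fun x hx => Metric.ball_mem_nhds x (hρ x hx)
  obtain ⟨χ, hχ⟩ := SmoothPartitionOfUnity.exists_isSubordinate 𝓘(ℝ, 𝔼 n)
    (isClosed_frontier (s := D)) (fun x : T => Metric.ball (x : 𝔼 n) (ρ x))
    (fun _ => Metric.isOpen_ball) (by rwa [Set.iUnion_subtype])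
  exact ⟨T, fun x => χ x, fun x => Φ x, ∑ x ∈ T, L x, {
    contDiff := fun x => (χ x).contMDiff.contDiff
    hasCompactSupport := fun x => Metric.isBounded_ball.isCompact_closure.of_isClosed_subset
      (isClosed_tsupport _) ((hχ x).trans subset_closure)
    sum_eq_one := fun y hy => by
      rw [← finsum_eq_sum_of_fintype]
      exact χ.sum_eq_one hy
    lipschitzWith := fun x =>
      (hL x (hT x x.2)).weaken (Finset.single_le_sum (f := L) (by simp) x.2)
    involutive := fun x => hinv x (hT x x.2)
    apply_notMem := fun x y hy => hmem x (hT x x.2) y (hχ x hy)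
    apply_eq := fun x y hy => hfixed x (hT x x.2) y (hχ x hy) }⟩

end Reflection

section LipschitzFunctions

lemma lipschitzWith_mul_of_norm_le {X : Type*} [PseudoMetricSpace X] {f g : X → ℝ}
    {K L A B : ℝ≥0} (hf : LipschitzWith K f) (hg : LipschitzWith L g) (hA : ∀ x, ‖f x‖ ≤ A)
    (hB : ∀ x, ‖g x‖ ≤ B) : LipschitzWith (A * L + B * K) fun x => f x * g x := by
  refine LipschitzWith.of_dist_le_mul fun x y => ?_
  calc dist (f x * g x) (f y * g y)
      ≤ dist (f x * g x) (f x * g y) + dist (f x * g y) (f y * g y) := dist_triangle _ _ _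
    _ = ‖f x‖ * dist (g x) (g y) + ‖g y‖ * dist (f x) (f y) := by
        rw [dist_eq_norm, ← mul_sub, norm_mul, dist_eq_norm, ← sub_mul, norm_mul, dist_eq_norm,
          dist_eq_norm, mul_comm ‖f x - f y‖]
    _ ≤ A * (L * dist x y) + B * (K * dist x y) := by
        gcongr
        exacts [hA x, hg.dist_le_mul x y, hB y, hf.dist_le_mul x y]
    _ = (A * L + B * K : ℝ≥0) * dist x y := by
        push_cast
        ring

lemma lipschitzWith_finset_sum {X F ι : Type*} [PseudoMetricSpace X] [SeminormedAddCommGroup F]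
    (s : Finset ι) {f : ι → X → F} {K : ι → ℝ≥0} (hf : ∀ i ∈ s, LipschitzWith (K i) (f i)) :
    LipschitzWith (∑ i ∈ s, K i) fun x => ∑ i ∈ s, f i x := by
  refine LipschitzWith.of_dist_le_mul fun x y => (dist_sum_sum_le _ _ _).trans ?_
  rw [NNReal.coe_sum, Finset.sum_mul]
  exact Finset.sum_le_sum fun i hi => (hf i hi).dist_le_mul x y

lemma exists_mem_segment_frontier {V : Type*} [AddCommGroup V] [Module ℝ V] [TopologicalSpace V]
    [ContinuousAdd V] [ContinuousSMul ℝ V] {D : Set V} (hD : IsOpen D) {x y : V} (hx : x ∈ D)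
    (hy : y ∉ D) : ∃ z ∈ segment ℝ x y, z ∈ frontier D := by
  rw [hD.frontier_eq]
  by_contra! hne
  obtain ⟨z, -, hzD, hzc⟩ := (convex_segment x y).isPreconnected D (closure D)ᶜ hD
    isClosed_closure.isOpen_compl
    (fun z hz => or_iff_not_imp_left.mpr fun hzD hzc => hne z hz ⟨hzc, hzD⟩)
    ⟨x, left_mem_segment ℝ x y, hx⟩
    ⟨y, right_mem_segment ℝ x y, fun hyc => hne y (right_mem_segment ℝ x y) ⟨hyc, hy⟩⟩
  exact hzc (subset_closure hzD)

lemma lipschitzWith_indicator_of_eq_zero_on_frontier {V F : Type*} [SeminormedAddCommGroup V]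
    [NormedSpace ℝ V] [SeminormedAddCommGroup F] {f : V → F} {K : ℝ≥0} (hf : LipschitzWith K f)
    {D : Set V} (hD : IsOpen D) (hf0 : ∀ x ∈ frontier D, f x = 0) :
    LipschitzWith K (D.indicator f) := by
  have hcross : ∀ x ∈ D, ∀ y ∉ D, dist (f x) 0 ≤ K * dist x y := by
    intro x hx y hy
    obtain ⟨z, hz, hzD⟩ := exists_mem_segment_frontier hD hx hy
    calc dist (f x) 0 = dist (f x) (f z) := by rw [hf0 z hzD]
      _ ≤ K * dist x z := hf.dist_le_mul x z
      _ ≤ K * dist x y := by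
        rw [← dist_add_dist_of_mem_segment hz]
        gcongr
        exact le_add_of_nonneg_right dist_nonneg
  refine LipschitzWith.of_dist_le_mul fun x y => ?_
  by_cases hx : x ∈ D <;> by_cases hy : y ∈ D
  · simpa [hx, hy] using hf.dist_le_mul x y
  · simpa [hx, hy] using hcross x hx y hy
  · simpa [hx, hy, dist_comm] using hcross y hy x hx
  · simp only [Set.indicator_of_notMem hx, Set.indicator_of_notMem hy, dist_self]
    positivity

lemma exists_norm_le_and_lipschitzWith {E F : Type*} [NormedAddCommGroup E] [NormedSpace ℝ E]
    [NormedAddCommGroup F] [NormedSpace ℝ F] {f : E → F} (hf : ContDiff ℝ 1 f)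
    (hfs : HasCompactSupport f) : ∃ C : ℝ≥0, (∀ x, ‖f x‖ ≤ C) ∧ LipschitzWith C f := by
  obtain ⟨A, hA⟩ := hf.continuous.bounded_above_of_compact_support hfs
  obtain ⟨K, hK⟩ := hf.lipschitzWith_of_hasCompactSupport hfs one_ne_zero
  exact ⟨max A.toNNReal K, fun x => (hA x).trans ((Real.le_coe_toNNReal A).trans
    (NNReal.coe_le_coe.mpr (le_max_left _ _))), hK.weaken (le_max_right _ _)⟩

lemma norm_fderiv_mul_comp_le {E : Type*} [NormedAddCommGroup E] [NormedSpace ℝ E]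
    {χ φ : E → ℝ} {Φ : E → E} {y : E} (hχ : DifferentiableAt ℝ χ y)
    (hφ : DifferentiableAt ℝ φ (Φ y)) (hΦ : DifferentiableAt ℝ Φ y) :
    ‖fderiv ℝ (fun z => χ z * φ (Φ z)) y‖ ≤
      ‖χ y‖ * (‖fderiv ℝ φ (Φ y)‖ * ‖fderiv ℝ Φ y‖) + ‖φ (Φ y)‖ * ‖fderiv ℝ χ y‖ := by
  have hderiv : HasFDerivAt (fun z => χ z * φ (Φ z))
      (χ y • (fderiv ℝ φ (Φ y)).comp (fderiv ℝ Φ y) + φ (Φ y) • fderiv ℝ χ y) y :=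
    hχ.hasFDerivAt.mul (hφ.hasFDerivAt.comp y hΦ.hasFDerivAt)
  rw [hderiv.fderiv]
  refine (norm_add_le _ _).trans ?_
  rw [norm_smul, norm_smul]
  gcongr
  exact ContinuousLinearMap.opNorm_comp_le _ _

end LipschitzFunctions

section LpBounds

variable {X Y F : Type*} [MeasurableSpace X] [MeasurableSpace Y] [NormedAddCommGroup F]
  {μ : Measure X} {ν : Measure Y} {q : ℝ≥0∞}

lemma eLpNorm_comp_le_of_map_le_smul {Φ : X → Y} (hΦ : AEMeasurable Φ μ) {c : ℝ≥0∞}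
    (hle : μ.map Φ ≤ c • ν) (hq : q ≠ ⊤) {g : Y → F} (hg : AEStronglyMeasurable g ν) :
    eLpNorm (g ∘ Φ) q μ ≤ c ^ (1 / q).toReal * eLpNorm g q ν := by
  have hac : μ.map Φ ≪ ν :=
    (Measure.absolutelyContinuous_of_le hle).trans Measure.smul_absolutelyContinuous
  calc eLpNorm (g ∘ Φ) q μ = eLpNorm g q (μ.map Φ) :=
        (eLpNorm_map_measure (hg.mono_ac hac) hΦ).symm
    _ ≤ eLpNorm g q (c • ν) := eLpNorm_mono_measure _ hle
    _ = c ^ (1 / q).toReal * eLpNorm g q ν := by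
        rw [eLpNorm_smul_measure_of_ne_top hq, smul_eq_mul]

lemma eLpNorm_le_restrict_add_restrict_compl {s : Set X} (hs : MeasurableSet s) (hq : 1 ≤ q)
    {f : X → F} (hf : AEStronglyMeasurable f μ) :
    eLpNorm f q μ ≤ eLpNorm f q (μ.restrict s) + eLpNorm f q (μ.restrict sᶜ) := by
  rw [← eLpNorm_indicator_eq_eLpNorm_restrict hs,
    ← eLpNorm_indicator_eq_eLpNorm_restrict hs.compl]
  nth_rewrite 1 [← s.indicator_self_add_compl f]
  exact eLpNorm_add_le (hf.indicator hs) (hf.indicator hs.compl) hq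

lemma eLpNorm_restrict_restrict_of_support_subset {s t : Set X} (hs : MeasurableSet s)
    {f : X → F} (hf : Function.support f ⊆ t) :
    eLpNorm f q ((μ.restrict t).restrict s) = eLpNorm f q (μ.restrict s) := by
  rw [Measure.restrict_comm hs, eLpNorm_restrict_eq_of_support_subset hf]

end LpBounds

section Extension

/-- The operator that keeps the values of a function outside `D`, and replaces its values in `D` by
values outside `D`, which are transported by the maps `Φ i` and weighted by the functions `χ i`. -/
noncomputable def reflectionExtension {X ι : Type*} [Fintype ι] (D : Set X) (χ : ι → X → ℝ)
    (Φ : ι → X → X) : (X → ℝ) →ₗ[ℝ] (X → ℝ) where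
  toFun φ := φ + D.indicator fun y => ∑ i, χ i y * φ (Φ i y) - φ y
  map_add' φ ψ := by
    ext y
    by_cases hy : y ∈ D <;> simp [hy, mul_add, Finset.sum_add_distrib]
  map_smul' c φ := by
    ext y
    by_cases hy : y ∈ D <;> simp [hy, Finset.mul_sum, mul_left_comm]

section

variable {X ι : Type*} [Fintype ι] {D : Set X} {χ : ι → X → ℝ} {Φ : ι → X → X} {φ : X → ℝ} {y : X}

lemma reflectionExtension_apply_of_notMem (hy : y ∉ D) : reflectionExtension D χ Φ φ y = φ y := by
  simp [reflectionExtension, hy]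

lemma reflectionExtension_apply_of_mem (hy : y ∈ D) :
    reflectionExtension D χ Φ φ y = ∑ i, χ i y * φ (Φ i y) := by
  simp [reflectionExtension, hy]

lemma support_reflectionExtension_subset [TopologicalSpace X] :
    Function.support (reflectionExtension D χ Φ φ) ⊆ tsupport φ ∪ closure D := by
  intro y hy
  by_cases hyD : y ∈ D
  · exact Or.inr (subset_closure hyD)
  · refine Or.inl (subset_tsupport _ ?_)
    rwa [Function.mem_support, reflectionExtension_apply_of_notMem hyD] at hy

end

namespace IsReflectionCover

variable {n : ℕ} {ι : Type*} [Fintype ι] {D Ω : Set (𝔼 n)} {χ : ι → 𝔼 n → ℝ} {Φ : ι → 𝔼 n → 𝔼 n}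
  {L : ℝ≥0} {φ : 𝔼 n → ℝ} (h : IsReflectionCover D χ Φ L)

include h

lemma exists_norm_le_and_lipschitzWith :
    ∃ C : ℝ≥0, ∀ i, (∀ y, ‖χ i y‖ ≤ C) ∧ LipschitzWith C (χ i) := by
  choose C hC hC_lip using fun i => _root_.exists_norm_le_and_lipschitzWith
    ((h.contDiff i).of_le (by simp)) (h.hasCompactSupport i)
  have hle : ∀ i, C i ≤ Finset.univ.sup C := fun i => Finset.le_sup (Finset.mem_univ i)
  exact ⟨Finset.univ.sup C, fun i =>
    ⟨fun y => (hC i y).trans (NNReal.coe_le_coe.mpr (hle i)), (hC_lip i).weaken (hle i)⟩⟩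

lemma sum_apply_eq_of_mem_frontier {y : 𝔼 n} (hy : y ∈ frontier D) :
    ∑ i, χ i y * φ (Φ i y) = φ y := by
  have hterm : ∀ i, χ i y * φ (Φ i y) = χ i y * φ y := by
    intro i
    by_cases hi : y ∈ tsupport (χ i)
    · rw [h.apply_eq i y hi hy]
    · simp [image_eq_zero_of_notMem_tsupport hi]
  rw [Finset.sum_congr rfl fun i _ => hterm i, ← Finset.sum_mul, h.sum_eq_one y hy, one_mul]

lemma exists_lipschitzWith_indicator_sub (hφ : IsTestFunction Ω φ) (hD : IsOpen D) :
    ∃ K : ℝ≥0, LipschitzWith K (D.indicator fun y => ∑ i, χ i y * φ (Φ i y) - φ y) := by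
  obtain ⟨A, hA⟩ := h.exists_norm_le_and_lipschitzWith
  obtain ⟨B, hB, hB_lip⟩ := _root_.exists_norm_le_and_lipschitzWith
    (hφ.contDiff.of_le (by simp)) hφ.hasCompactSupport
  have hsum := lipschitzWith_finset_sum Finset.univ fun i _ => lipschitzWith_mul_of_norm_le
    (hA i).2 (hB_lip.comp (h.lipschitzWith i)) (hA i).1 fun y => hB (Φ i y)
  exact ⟨_, lipschitzWith_indicator_of_eq_zero_on_frontier (hsum.sub hB_lip) hD fun y hy =>
    sub_eq_zero.mpr (h.sum_apply_eq_of_mem_frontier hy)⟩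

lemma exists_lipschitzWith_reflectionExtension (hφ : IsTestFunction Ω φ) (hD : IsOpen D) :
    ∃ K : ℝ≥0, LipschitzWith K (reflectionExtension D χ Φ φ) := by
  obtain ⟨K, hK⟩ := h.exists_lipschitzWith_indicator_sub hφ hD
  obtain ⟨B, -, hB⟩ := _root_.exists_norm_le_and_lipschitzWith
    (hφ.contDiff.of_le (by simp)) hφ.hasCompactSupport
  exact ⟨_, hB.add hK⟩

lemma gradient_reflectionExtension_ae_eq (hφ : IsTestFunction Ω φ) (hD : IsOpen D) :
    gradient (reflectionExtension D χ Φ φ) =ᵐ[volume.restrict Dᶜ] gradient φ := by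
  obtain ⟨K, hK⟩ := h.exists_lipschitzWith_indicator_sub hφ hD
  filter_upwards [ae_restrict_of_ae hK.ae_differentiableAt, gradient_ae_eq_zero_of_lipschitzWith hK
    hD.measurableSet.compl fun x hx => Set.indicator_of_notMem hx _] with y hyd hy
  rw [show reflectionExtension D χ Φ φ = φ + _ from rfl, gradient_add (hφ.differentiable y) hyd,
    hy, add_zero]

lemma norm_fderiv_mul_comp_le {C : ℝ≥0} (hC : ∀ i, (∀ y, ‖χ i y‖ ≤ C) ∧ LipschitzWith C (χ i))
    (hφ : Differentiable ℝ φ) {i : ι} {y : 𝔼 n} (hy : y ∈ D) (hΦ : DifferentiableAt ℝ (Φ i) y) :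
    ‖fderiv ℝ (fun z => χ i z * φ (Φ i z)) y‖ ≤
      C * (L + 1) * Dᶜ.indicator (fun z => ‖φ z‖ + ‖gradient φ z‖) (Φ i y) := by
  have hprod := _root_.norm_fderiv_mul_comp_le ((h.contDiff i).differentiable (by simp) y)
    (hφ (Φ i y)) hΦ
  by_cases hi : y ∈ tsupport (χ i)
  · rw [Set.indicator_of_mem (h.apply_notMem i y hi hy), norm_gradient]
    calc ‖fderiv ℝ (fun z => χ i z * φ (Φ i z)) y‖
        ≤ C * (‖fderiv ℝ φ (Φ i y)‖ * L) + ‖φ (Φ i y)‖ * C := by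
          refine hprod.trans ?_
          gcongr
          exacts [(hC i).1 y, norm_fderiv_le_of_lipschitz ℝ (h.lipschitzWith i),
            norm_fderiv_le_of_lipschitz ℝ (hC i).2]
      _ ≤ C * (L + 1) * (‖φ (Φ i y)‖ + ‖fderiv ℝ φ (Φ i y)‖) := by
          have hφ_nonneg : 0 ≤ (C : ℝ) * L * ‖φ (Φ i y)‖ := by positivity
          have hφ'_nonneg : 0 ≤ (C : ℝ) * ‖fderiv ℝ φ (Φ i y)‖ := by positivity
          linarith
  · have hfderiv : fderiv ℝ (χ i) y = 0 :=
      image_eq_zero_of_notMem_tsupport (f := fderiv ℝ (χ i)) fun hy' =>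
        hi (tsupport_fderiv_subset ℝ hy')
    rw [image_eq_zero_of_notMem_tsupport hi, hfderiv, norm_zero, norm_zero, zero_mul, mul_zero,
      add_zero] at hprod
    exact hprod.trans (mul_nonneg (by positivity)
      (Set.indicator_nonneg (fun _ _ => by positivity) _))

lemma exists_norm_gradient_reflectionExtension_le (hD : IsOpen D) :
    ∃ C : ℝ≥0, ∀ φ : 𝔼 n → ℝ, IsTestFunction Ω φ → ∀ᵐ y ∂volume.restrict D,
      ‖gradient (reflectionExtension D χ Φ φ) y‖ ≤
        C * ∑ i, Dᶜ.indicator (fun z => ‖φ z‖ + ‖gradient φ z‖) (Φ i y) := by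
  obtain ⟨C, hC⟩ := h.exists_norm_le_and_lipschitzWith
  refine ⟨C * (L + 1), fun φ hφ => ?_⟩
  have hdiff : ∀ᵐ y : 𝔼 n, ∀ i, DifferentiableAt ℝ (Φ i) y :=
    ae_all_iff.mpr fun i => (h.lipschitzWith i).ae_differentiableAt
  filter_upwards [ae_restrict_mem hD.measurableSet, ae_restrict_of_ae hdiff] with y hy hyΦ
  have hlocal : reflectionExtension D χ Φ φ =ᶠ[𝓝 y] fun y => ∑ i, χ i y * φ (Φ i y) :=
    (hD.eventually_mem hy).mono fun z hz => reflectionExtension_apply_of_mem hz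
  have hterm : ∀ i, DifferentiableAt ℝ (fun y => χ i y * φ (Φ i y)) y := fun i =>
    ((h.contDiff i).differentiable (by simp) y).mul ((hφ.differentiable (Φ i y)).comp y (hyΦ i))
  rw [norm_gradient, hlocal.fderiv_eq, fderiv_fun_sum fun i _ => hterm i, Finset.mul_sum]
  push_cast
  exact norm_sum_le_of_le _ fun i _ => h.norm_fderiv_mul_comp_le hC hφ.differentiable hy (hyΦ i)

lemma eLpNorm_comp_le {q : ℝ≥0∞} (hq : q ≠ ⊤) {g : 𝔼 n → ℝ} (hg : AEStronglyMeasurable g)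
    (i : ι) : eLpNorm (g ∘ Φ i) q ≤ ((L ^ n) ^ (1 / q).toReal : ℝ≥0) * eLpNorm g q := by
  have hmap := map_le_smul_of_lipschitzWith_of_involutive (h.lipschitzWith i) (h.involutive i)
    volume
  rw [finrank_euclideanSpace_fin] at hmap
  convert eLpNorm_comp_le_of_map_le_smul (h.lipschitzWith i).continuous.aemeasurable hmap hq hg
    using 2
  simp [ENNReal.coe_rpow_of_nonneg]

lemma exists_eLpNorm_gradient_reflectionExtension_le {q : ℝ≥0∞} (hq1 : 1 ≤ q) (hq : q ≠ ⊤)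
    (hD : IsOpen D) :
    ∃ C : ℝ≥0, ∀ φ : 𝔼 n → ℝ, IsTestFunction Ω φ →
      eLpNorm (gradient (reflectionExtension D χ Φ φ)) q (volume.restrict D) ≤
        C * (eLpNorm φ q (volume.restrict Dᶜ) + eLpNorm (gradient φ) q (volume.restrict Dᶜ)) := by
  obtain ⟨C, hC⟩ := h.exists_norm_gradient_reflectionExtension_le (Ω := Ω) hD
  let A : ℝ≥0 := (L ^ n) ^ (1 / q).toReal
  refine ⟨C * (Fintype.card ι * A), fun φ hφ => ?_⟩
  let g : 𝔼 n → ℝ := Dᶜ.indicator fun z => ‖φ z‖ + ‖gradient φ z‖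
  have hgm : StronglyMeasurable g :=
    (hφ.continuous.norm.add hφ.continuous_gradient.norm).stronglyMeasurable.indicator
      hD.measurableSet.compl
  have hg : eLpNorm g q volume ≤
      eLpNorm φ q (volume.restrict Dᶜ) + eLpNorm (gradient φ) q (volume.restrict Dᶜ) := by
    rw [eLpNorm_indicator_eq_eLpNorm_restrict hD.measurableSet.compl, ← eLpNorm_norm φ,
      ← eLpNorm_norm (gradient φ)]
    exact eLpNorm_add_le hφ.continuous.norm.aestronglyMeasurable
      hφ.continuous_gradient.norm.aestronglyMeasurable hq1
  calc eLpNorm (gradient (reflectionExtension D χ Φ φ)) q (volume.restrict D)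
      ≤ ENNReal.ofReal C * eLpNorm (∑ i, g ∘ Φ i) q (volume.restrict D) := by
        refine eLpNorm_le_mul_eLpNorm_of_ae_le_mul ((hC φ hφ).mono fun y hy => hy.trans ?_) q
        gcongr
        simp only [Finset.sum_apply]
        exact Real.le_norm_self _
    _ ≤ C * eLpNorm (∑ i, g ∘ Φ i) q volume := by
        rw [ENNReal.ofReal_coe_nnreal]
        gcongr
        exact Measure.restrict_le_self
    _ ≤ C * ∑ i, eLpNorm (g ∘ Φ i) q volume := by
        gcongr
        exact eLpNorm_sum_le (fun i _ => (hgm.comp_measurable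
          (h.lipschitzWith i).continuous.measurable).aestronglyMeasurable) hq1
    _ ≤ C * ∑ _i : ι, A * eLpNorm g q volume := by
        gcongr with i
        exact h.eLpNorm_comp_le hq hgm.aestronglyMeasurable i
    _ = (C * (Fintype.card ι * A) : ℝ≥0) * eLpNorm g q volume := by
        rw [Finset.sum_const, Finset.card_univ, nsmul_eq_mul]
        push_cast
        ring
    _ ≤ _ := by gcongr

end IsReflectionCover

end Extension

section ClosedRange

variable {n : ℕ} {q : ℝ≥0∞} {D Ω : Set (𝔼 n)} {ι : Type*} [Fintype ι] {χ : ι → 𝔼 n → ℝ}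
  {Φ : ι → 𝔼 n → 𝔼 n} {L : ℝ≥0} {φ : 𝔼 n → ℝ}

lemma IsReflectionCover.snd_ae_eq_gradient_reflectionExtension {x : LpPair q Ω}
    (h : IsReflectionCover D χ Φ L) (hD : IsOpen D) (hΩ : IsOpen Ω) (hφ : IsTestFunction Ω φ)
    (hx : x ∈ sobolevPairs q Ω) (hxφ : x.1 =ᵐ[volume.restrict Ω] reflectionExtension D χ Φ φ) :
    x.2 =ᵐ[volume.restrict Ω] gradient (reflectionExtension D χ Φ φ) := by
  obtain ⟨K, hK⟩ := h.exists_lipschitzWith_reflectionExtension hφ hD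
  exact (HasWeakGradient.congr_ae hx hxφ .rfl).ae_unique hΩ
    ((hasWeakGradient_of_lipschitzWith hK).mono (Set.subset_univ Ω))

variable [Fact (1 ≤ q)]

lemma exists_mem_sobolevZero_of_lipschitzWith (hq : q ≠ ⊤) (hΩ : IsOpen Ω) {L : ℝ≥0}
    {f : 𝔼 n → ℝ} (hf : LipschitzWith L f) {K : Set (𝔼 n)} (hK : IsCompact K) (hKΩ : K ⊆ Ω)
    (hfK : Function.support f ⊆ K) : ∃ x ∈ sobolevZero q Ω, x.1 =ᵐ[volume.restrict Ω] f := by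
  have hfs : tsupport f ⊆ K := closure_minimal hfK hK.isClosed
  have hmem : MemLp f q :=
    hf.continuous.memLp_of_hasCompactSupport (hK.of_isClosed_subset (isClosed_tsupport f) hfs)
  have hmem_grad : MemLp (gradient f) q :=
    (memLp_top_of_bound (measurable_gradient f).aestronglyMeasurable L
      (ae_of_all _ (norm_gradient_le_of_lipschitzWith hf))).mono_exponent_of_measure_support_ne_top
      (fun _ hx => image_eq_zero_of_notMem_tsupport fun hx' =>
        hx (hfs (tsupport_gradient_subset f hx'))) hK.measure_lt_top.ne le_top
  exact exists_mem_sobolevZero_of_support_subset hq (hasWeakGradient_of_lipschitzWith hf) hmem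
    hmem_grad hK hΩ hKΩ hfK

/-- The operator sending a pair `(u, ∇u)` to the restriction of `∇u` to `Ω \ D`. -/
noncomputable def gradientRestrict (q : ℝ≥0∞) [Fact (1 ≤ q)] (D Ω : Set (𝔼 n)) :
    LpPair q Ω →L[ℝ] Lp (𝔼 n) q ((volume.restrict Ω).restrict Dᶜ) :=
  (LpToLpRestrictCLM (𝔼 n) (𝔼 n) ℝ (volume.restrict Ω) q Dᶜ).comp (ContinuousLinearMap.snd ℝ _ _)

lemma gradientRestrict_ae_eq (x : LpPair q Ω) :
    gradientRestrict q D Ω x =ᵐ[(volume.restrict Ω).restrict Dᶜ] x.2 :=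
  LpToLpRestrictCLM_coeFn ℝ Dᶜ x.2

lemma eLpNorm_restrict_compl_le_enorm_of_ae_eq {x : LpPair q Ω} (hD : IsOpen D)
    (hφ : IsTestFunction Ω φ) (hxφ : x.1 =ᵐ[volume.restrict Ω] reflectionExtension D χ Φ φ) :
    eLpNorm φ q (volume.restrict Dᶜ) ≤ ‖x.1‖ₑ := by
  have hDm := hD.measurableSet.compl
  have hφE : φ =ᵐ[(volume.restrict Ω).restrict Dᶜ] reflectionExtension D χ Φ φ :=
    (ae_restrict_mem hDm).mono fun y hy => (reflectionExtension_apply_of_notMem hy).symm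
  rw [← eLpNorm_restrict_restrict_of_support_subset hDm hφ.support_subset, eLpNorm_congr_ae
    (hφE.trans hxφ.symm.restrict),
    Lp.enorm_def]
  exact eLpNorm_mono_measure _ Measure.restrict_le_self

namespace IsReflectionCover

variable {x : LpPair q Ω} (h : IsReflectionCover D χ Φ L) (hD : IsOpen D) (hΩ : IsOpen Ω)

include h hD hΩ

lemma gradientRestrict_ae_eq_gradient (hφ : IsTestFunction Ω φ) (hx : x ∈ sobolevPairs q Ω)
    (hxφ : x.1 =ᵐ[volume.restrict Ω] reflectionExtension D χ Φ φ) :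
    gradientRestrict q D Ω x =ᵐ[(volume.restrict Ω).restrict Dᶜ] gradient φ := by
  have hgrad : gradient (reflectionExtension D χ Φ φ)
      =ᵐ[(volume.restrict Ω).restrict Dᶜ] gradient φ := by
    rw [Measure.restrict_comm hD.measurableSet.compl]
    exact (h.gradient_reflectionExtension_ae_eq hφ hD).restrict
  exact (gradientRestrict_ae_eq x).trans
    ((h.snd_ae_eq_gradient_reflectionExtension hD hΩ hφ hx hxφ).restrict.trans hgrad)

lemma exists_mem_sobolevZero_reflectionExtension (hq : q ≠ ⊤) (hDc : IsCompact (closure D))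
    (hDΩ : closure D ⊆ Ω) (hφ : IsTestFunction Ω φ) :
    ∃ x ∈ sobolevZero q Ω, x.1 =ᵐ[volume.restrict Ω] reflectionExtension D χ Φ φ := by
  obtain ⟨K, hK⟩ := h.exists_lipschitzWith_reflectionExtension hφ hD
  exact exists_mem_sobolevZero_of_lipschitzWith hq hΩ hK (hφ.hasCompactSupport.isCompact.union hDc)
    (Set.union_subset hφ.tsupport_subset hDΩ) support_reflectionExtension_subset

lemma sobolevPairsOf_map_reflectionExtension_le (hq : q ≠ ⊤) (hDc : IsCompact (closure D))
    (hDΩ : closure D ⊆ Ω) :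
    sobolevPairsOf q Ω ((testFunctions Ω).map (reflectionExtension D χ Φ)) ≤ sobolevZero q Ω := by
  rintro x ⟨hx, _, ⟨φ, hφ, rfl⟩, hxφ⟩
  obtain ⟨z, hz, hzφ⟩ := h.exists_mem_sobolevZero_reflectionExtension hD hΩ hq hDc hDΩ hφ
  rwa [eq_of_mem_sobolevPairs hΩ hx (sobolevZero_le_sobolevPairs hz)
    (Lp.ext (hxφ.trans hzφ.symm))]

lemma map_gradientRestrict_testFunctions_le (hq : q ≠ ⊤) (hDc : IsCompact (closure D))
    (hDΩ : closure D ⊆ Ω) :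
    (sobolevPairsOf q Ω (testFunctions Ω)).map (gradientRestrict q D Ω).toLinearMap ≤
      (sobolevPairsOf q Ω ((testFunctions Ω).map (reflectionExtension D χ Φ))).map
        (gradientRestrict q D Ω).toLinearMap := by
  rintro _ ⟨x, ⟨hx, φ, hφ, hxφ⟩, rfl⟩
  obtain ⟨z, hz, hzφ⟩ := h.exists_mem_sobolevZero_reflectionExtension hD hΩ hq hDc hDΩ hφ
  have hz' := sobolevZero_le_sobolevPairs hz
  refine ⟨z, ⟨hz', _, ⟨φ, hφ, rfl⟩, hzφ⟩, Lp.ext ?_⟩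
  exact (h.gradientRestrict_ae_eq_gradient hD hΩ hφ hz' hzφ).trans
    ((gradientRestrict_ae_eq x).trans (snd_ae_eq_gradient hΩ hx hφ hxφ).restrict).symm

lemma eLpNorm_gradient_restrict_compl_eq_enorm (hφ : IsTestFunction Ω φ)
    (hx : x ∈ sobolevPairs q Ω) (hxφ : x.1 =ᵐ[volume.restrict Ω] reflectionExtension D χ Φ φ) :
    eLpNorm (gradient φ) q (volume.restrict Dᶜ) = ‖gradientRestrict q D Ω x‖ₑ := by
  rw [← eLpNorm_restrict_restrict_of_support_subset hD.measurableSet.compl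
    hφ.support_gradient_subset, Lp.enorm_def,
    eLpNorm_congr_ae (h.gradientRestrict_ae_eq_gradient hD hΩ hφ hx hxφ)]

lemma exists_enorm_snd_le (hq : q ≠ ⊤) :
    ∃ C : ℝ≥0, ∀ x ∈ sobolevPairsOf q Ω ((testFunctions Ω).map (reflectionExtension D χ Φ)),
      ‖x.2‖ₑ ≤ C * (‖x.1‖ₑ + ‖gradientRestrict q D Ω x‖ₑ) + ‖gradientRestrict q D Ω x‖ₑ := by
  have hq1 : 1 ≤ q := Fact.out
  obtain ⟨C, hC⟩ := h.exists_eLpNorm_gradient_reflectionExtension_le (Ω := Ω) hq1 hq hD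
  refine ⟨C, ?_⟩
  rintro x ⟨hx, _, ⟨φ, hφ, rfl⟩, hxφ⟩
  have hinside : eLpNorm x.2 q ((volume.restrict Ω).restrict D) ≤
      C * (‖x.1‖ₑ + ‖gradientRestrict q D Ω x‖ₑ) :=
    calc eLpNorm x.2 q ((volume.restrict Ω).restrict D)
        = eLpNorm (gradient (reflectionExtension D χ Φ φ)) q ((volume.restrict Ω).restrict D) :=
          eLpNorm_congr_ae
            (h.snd_ae_eq_gradient_reflectionExtension hD hΩ hφ hx hxφ).restrict
      _ ≤ eLpNorm (gradient (reflectionExtension D χ Φ φ)) q (volume.restrict D) :=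
          eLpNorm_mono_measure _ (Measure.restrict_mono_measure Measure.restrict_le_self D)
      _ ≤ C * (eLpNorm φ q (volume.restrict Dᶜ) + eLpNorm (gradient φ) q (volume.restrict Dᶜ)) :=
          hC φ hφ
      _ ≤ C * (‖x.1‖ₑ + ‖gradientRestrict q D Ω x‖ₑ) := by
          rw [h.eLpNorm_gradient_restrict_compl_eq_enorm hD hΩ hφ hx hxφ]
          gcongr
          exact eLpNorm_restrict_compl_le_enorm_of_ae_eq hD hφ hxφ
  have houtside : eLpNorm x.2 q ((volume.restrict Ω).restrict Dᶜ) =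
      ‖gradientRestrict q D Ω x‖ₑ := by
    rw [Lp.enorm_def, eLpNorm_congr_ae (gradientRestrict_ae_eq x)]
  rw [Lp.enorm_def x.2]
  refine (eLpNorm_le_restrict_add_restrict_compl hD.measurableSet hq1
    (Lp.aestronglyMeasurable x.2)).trans ?_
  rw [houtside]
  gcongr

lemma exists_norm_le (hq : q ≠ ⊤) :
    ∃ C : ℝ, ∀ x ∈ sobolevPairsOf q Ω ((testFunctions Ω).map (reflectionExtension D χ Φ)),
      ‖x‖ ≤ C * (‖gradientRestrict q D Ω x‖ + ‖x.1‖) := by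
  obtain ⟨C, hC⟩ := h.exists_enorm_snd_le (q := q) hD hΩ hq
  refine ⟨C + 1, fun x hx => ?_⟩
  have hsnd : ‖x.2‖ ≤ C * (‖x.1‖ + ‖gradientRestrict q D Ω x‖) + ‖gradientRestrict q D Ω x‖ := by
    have hnnnorm : ‖x.2‖₊ ≤
        C * (‖x.1‖₊ + ‖gradientRestrict q D Ω x‖₊) + ‖gradientRestrict q D Ω x‖₊ := by
      have hCx := hC x hx
      simp only [enorm_eq_nnnorm] at hCx
      exact_mod_cast hCx
    exact_mod_cast hnnnorm
  have hC0 : 0 ≤ (C : ℝ) * (‖gradientRestrict q D Ω x‖ + ‖x.1‖) := by positivity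
  rw [Prod.norm_def, max_le_iff]
  constructor <;> linarith [norm_nonneg (gradientRestrict q D Ω x), norm_nonneg x.1]

end IsReflectionCover

theorem isClosed_map_gradientRestrict (hq : q ≠ ⊤) (hD : HasLipschitzBoundary D) (hDo : IsOpen D)
    (hΩ : IsOpen Ω) (hΩb : Bornology.IsBounded Ω) (hDΩ : closure D ⊆ Ω) :
    IsClosed ((sobolevZero q Ω).map (gradientRestrict q D Ω).toLinearMap :
      Set (Lp (𝔼 n) q ((volume.restrict Ω).restrict Dᶜ))) := by
  have hDb : Bornology.IsBounded D := hΩb.subset (subset_closure.trans hDΩ)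
  have hDc : IsCompact (closure D) := hDb.isCompact_closure
  obtain ⟨T, χ, Φ, L, h⟩ := hD.exists_isReflectionCover hDo hDb
  obtain ⟨C, hC⟩ := h.exists_norm_le (q := q) hDo hΩ hq
  exact (isAlmostFiniteRankOn_fst_testFunctions hq hΩ hΩb).isClosed_map_topologicalClosure
    (h.sobolevPairsOf_map_reflectionExtension_le hDo hΩ hq hDc hDΩ)
    (h.map_gradientRestrict_testFunctions_le hDo hΩ hq hDc hDΩ) hC

end ClosedRange

section UniformConvexity

variable {V : Type*} [NormedAddCommGroup V] {p : ℝ} {a b : V}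

lemma norm_le_one_of_norm_rpow_add_norm_rpow_eq_one (hp : 0 < p)
    (h : ‖a‖ ^ p + ‖b‖ ^ p = 1) : ‖a‖ ≤ 1 := by
  have hb : 0 ≤ ‖b‖ ^ p := by positivity
  by_contra! hlt
  linarith [Real.one_lt_rpow hlt hp]

lemma isCompact_setOf_norm_rpow_add_norm_rpow_eq_one [ProperSpace V] (hp : 0 < p) :
    IsCompact {z : V × V | ‖z.1‖ ^ p + ‖z.2‖ ^ p = 1} := by
  have hclosed : IsClosed {z : V × V | ‖z.1‖ ^ p + ‖z.2‖ ^ p = 1} :=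
    isClosed_eq ((continuous_fst.norm.rpow_const fun _ => .inr hp.le).add
      (continuous_snd.norm.rpow_const fun _ => .inr hp.le)) continuous_const
  refine (isCompact_closedBall (0 : V × V) 1).of_isClosed_subset hclosed fun z hz => ?_
  rw [mem_closedBall_zero_iff, Prod.norm_def, max_le_iff]
  exact ⟨norm_le_one_of_norm_rpow_add_norm_rpow_eq_one hp hz,
    norm_le_one_of_norm_rpow_add_norm_rpow_eq_one hp ((add_comm _ _).trans hz)⟩

variable [NormedSpace ℝ V] [StrictConvexSpace ℝ V]

lemma two_mul_norm_half_add_rpow_lt (hp : 1 < p) (hab : a ≠ b) :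
    2 * ‖(1 / 2 : ℝ) • (a + b)‖ ^ p < ‖a‖ ^ p + ‖b‖ ^ p := by
  have hp0 : 0 < p := by linarith
  rcases eq_or_ne ‖a‖ ‖b‖ with hnorm | hnorm
  · have hmid : ‖(1 / 2 : ℝ) • (a + b)‖ < ‖a‖ := (norm_midpoint_lt_iff hnorm).mpr hab
    rw [← hnorm]
    linarith [Real.rpow_lt_rpow (norm_nonneg _) hmid hp0]
  · have hmid : ‖(1 / 2 : ℝ) • (a + b)‖ ≤ (1 / 2) * ‖a‖ + (1 / 2) * ‖b‖ := by
      rw [norm_smul, Real.norm_of_nonneg (by norm_num), ← mul_add]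
      gcongr
      exact norm_add_le a b
    have hconvex := (strictConvexOn_rpow hp).2 (norm_nonneg a) (norm_nonneg b) hnorm
      (show (0 : ℝ) < 1 / 2 by norm_num) (show (0 : ℝ) < 1 / 2 by norm_num) (by norm_num)
    simp only [smul_eq_mul] at hconvex
    linarith [Real.rpow_le_rpow (norm_nonneg _) hmid hp0.le]

lemma two_mul_norm_half_add_rpow_le (hp : 1 < p) (a b : V) :
    2 * ‖(1 / 2 : ℝ) • (a + b)‖ ^ p ≤ ‖a‖ ^ p + ‖b‖ ^ p := by
  rcases eq_or_ne a b with rfl | hab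
  · rw [← two_smul ℝ a, smul_smul, one_div, inv_mul_cancel₀ two_ne_zero, one_smul, two_mul]
  · exact (two_mul_norm_half_add_rpow_lt hp hab).le

variable [ProperSpace V]

variable (V) in
lemma exists_pos_le_one_sub_norm_half_add_rpow (hp : 1 < p) {ε : ℝ} (hε : 0 < ε) :
    ∃ δ > 0, ∀ a b : V, ‖a‖ ^ p + ‖b‖ ^ p = 1 → ε ≤ ‖a - b‖ ^ p →
      δ ≤ 1 - 2 * ‖(1 / 2 : ℝ) • (a + b)‖ ^ p := by
  have hp0 : 0 < p := by linarith
  have hcompact : IsCompact ({z : V × V | ‖z.1‖ ^ p + ‖z.2‖ ^ p = 1} ∩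
      {z | ε ≤ ‖z.1 - z.2‖ ^ p}) :=
    (isCompact_setOf_norm_rpow_add_norm_rpow_eq_one hp0).inter_right
      (isClosed_le continuous_const
        ((continuous_fst.sub continuous_snd).norm.rpow_const fun _ => .inr hp0.le))
  have hcont : Continuous fun z : V × V => 1 - 2 * ‖(1 / 2 : ℝ) • (z.1 + z.2)‖ ^ p :=
    continuous_const.sub (continuous_const.mul
      (((continuous_fst.add continuous_snd).const_smul (1 / 2 : ℝ)).norm.rpow_const
        fun _ => .inr hp0.le))
  obtain ⟨δ, hδ0, hδ⟩ := hcompact.exists_forall_le' hcont.continuousOn (a := 0) (by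
    rintro z ⟨hz, hzε : ε ≤ ‖z.1 - z.2‖ ^ p⟩
    have hne : z.1 ≠ z.2 := by
      intro heq
      rw [heq, sub_self, norm_zero, Real.zero_rpow hp0.ne'] at hzε
      linarith
    exact sub_pos.mpr ((two_mul_norm_half_add_rpow_lt hp hne).trans_eq hz))
  exact ⟨δ, hδ0, fun a b hab hε => hδ (a, b) ⟨hab, hε⟩⟩

variable (V) in
lemma exists_norm_sub_rpow_add_le_of_add_eq_one (hp : 1 < p) {ε : ℝ} (hε : 0 < ε) :
    ∃ C : ℝ, 0 ≤ C ∧ ∀ a b : V, ‖a‖ ^ p + ‖b‖ ^ p = 1 →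
      ‖a - b‖ ^ p + 2 * C * ‖(1 / 2 : ℝ) • (a + b)‖ ^ p ≤ ε + C := by
  have hp0 : 0 < p := by linarith
  obtain ⟨δ, hδ0, hδ⟩ := exists_pos_le_one_sub_norm_half_add_rpow V hp hε
  refine ⟨2 ^ p / δ, by positivity, fun a b hab => ?_⟩
  have : 0 < 2 ^ p / δ := by positivity
  rcases le_or_gt ε (‖a - b‖ ^ p) with hfar | hnear
  · have hdiff : ‖a - b‖ ^ p ≤ 2 ^ p := by
      refine Real.rpow_le_rpow (norm_nonneg _) ?_ hp0.le
      linarith [norm_sub_le a b, norm_le_one_of_norm_rpow_add_norm_rpow_eq_one hp0 hab,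
        norm_le_one_of_norm_rpow_add_norm_rpow_eq_one hp0 ((add_comm _ _).trans hab)]
    have hgap : 2 ^ p ≤ 2 ^ p / δ * (1 - 2 * ‖(1 / 2 : ℝ) • (a + b)‖ ^ p) := by
      calc (2 : ℝ) ^ p = 2 ^ p / δ * δ := (div_mul_cancel₀ _ hδ0.ne').symm
        _ ≤ _ := by gcongr; exact hδ a b hab hfar
    linarith
  · have hmid : 2 ^ p / δ * (2 * ‖(1 / 2 : ℝ) • (a + b)‖ ^ p) ≤ 2 ^ p / δ * 1 := by
      gcongr
      exact (two_mul_norm_half_add_rpow_le hp a b).trans_eq hab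
    linarith

variable (V) in
lemma exists_norm_sub_rpow_add_le (hp : 1 < p) {ε : ℝ} (hε : 0 < ε) :
    ∃ C : ℝ, 0 ≤ C ∧ ∀ a b : V, ‖a - b‖ ^ p + 2 * C * ‖(1 / 2 : ℝ) • (a + b)‖ ^ p ≤
      (ε + C) * (‖a‖ ^ p + ‖b‖ ^ p) := by
  have hp0 : 0 < p := by linarith
  obtain ⟨C, hC0, hC⟩ := exists_norm_sub_rpow_add_le_of_add_eq_one V hp hε
  refine ⟨C, hC0, fun a b => ?_⟩
  obtain ⟨t, ht0, ht⟩ : ∃ t : ℝ, 0 ≤ t ∧ t ^ p = ‖a‖ ^ p + ‖b‖ ^ p :=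
    ⟨(‖a‖ ^ p + ‖b‖ ^ p) ^ p⁻¹, by positivity, Real.rpow_inv_rpow (by positivity) hp0.ne'⟩
  rcases ht0.eq_or_lt with rfl | ht_pos
  · rw [Real.zero_rpow hp0.ne'] at ht
    have ha0 : ‖a‖ ^ p = 0 := by
      linarith [Real.rpow_nonneg (norm_nonneg a) p, Real.rpow_nonneg (norm_nonneg b) p]
    have hb0 : ‖b‖ ^ p = 0 := by linarith
    rw [Real.rpow_eq_zero (norm_nonneg _) hp0.ne', norm_eq_zero] at ha0 hb0
    simp [ha0, hb0, Real.zero_rpow hp0.ne']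
  · have hscale : ∀ c : V, t ^ p * ‖t⁻¹ • c‖ ^ p = ‖c‖ ^ p := fun c => by
      rw [← Real.mul_rpow ht0 (norm_nonneg _), norm_smul, norm_inv, Real.norm_of_nonneg ht0,
        mul_inv_cancel_left₀ ht_pos.ne']
    have htp : 0 < t ^ p := by positivity
    have hunit : ‖t⁻¹ • a‖ ^ p + ‖t⁻¹ • b‖ ^ p = 1 :=
      mul_left_cancel₀ htp.ne' (by rw [mul_add, hscale, hscale, mul_one, ht])
    have hle := mul_le_mul_of_nonneg_left (hC _ _ hunit) htp.le
    rw [← smul_sub, ← smul_add, smul_comm (1 / 2 : ℝ) t⁻¹, mul_add, mul_left_comm, hscale,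
      hscale, ht, mul_comm (‖a‖ ^ p + ‖b‖ ^ p)] at hle
    exact hle

end UniformConvexity

section FieldEnergy

variable {α V : Type*} {mα : MeasurableSpace α} {μ : Measure α} [NormedAddCommGroup V] {p : ℝ}
  {σ : α → ℝ≥0∞} {G H : α → V}

/-- The `p`-energy `∫ σ ‖G‖ ^ p` of a vector field `G`, which for `G = ∇u` is the energy of `u`. -/
noncomputable def fieldEnergy (p : ℝ) (σ : α → ℝ≥0∞) (μ : Measure α) (G : α → V) : ℝ≥0∞ :=
  ∫⁻ x, σ x * ENNReal.ofReal (‖G x‖ ^ p) ∂μ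

lemma fieldEnergy_congr_ae (h : ∀ᵐ x ∂μ, σ x ≠ 0 → G x = H x) :
    fieldEnergy p σ μ G = fieldEnergy p σ μ H :=
  lintegral_congr_ae (h.mono fun x hx => by
    rcases eq_or_ne (σ x) 0 with h0 | h0
    · simp [h0]
    · simp [hx h0])

lemma aemeasurable_mul_ofReal_norm_rpow (hσ : AEMeasurable σ μ) (hG : AEStronglyMeasurable G μ) :
    AEMeasurable (fun x => σ x * ENNReal.ofReal (‖G x‖ ^ p)) μ :=
  hσ.mul (hG.norm.aemeasurable.pow_const p).ennreal_ofReal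

lemma ae_eq_zero_of_fieldEnergy_eq_zero (hσ : AEMeasurable σ μ)
    (hG : AEStronglyMeasurable G μ) (h : fieldEnergy p σ μ G = 0) :
    ∀ᵐ x ∂μ, σ x ≠ 0 → G x = 0 := by
  filter_upwards [(lintegral_eq_zero_iff' (aemeasurable_mul_ofReal_norm_rpow hσ hG)).mp h]
    with x hx hσx
  by_contra hGx
  have hnorm : 0 < ‖G x‖ ^ p := Real.rpow_pos_of_pos (norm_pos_iff.mpr hGx) p
  exact mul_ne_zero hσx (ENNReal.ofReal_pos.mpr hnorm).ne' hx

lemma ae_eq_zero_of_fieldEnergy_ne_top (hσ : AEMeasurable σ μ)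
    (hG : AEStronglyMeasurable G μ) (h : fieldEnergy p σ μ G ≠ ⊤) :
    ∀ᵐ x ∂μ, σ x = ⊤ → G x = 0 := by
  filter_upwards [ae_lt_top' (aemeasurable_mul_ofReal_norm_rpow hσ hG) h] with x hx hσx
  by_contra hGx
  have hnorm : 0 < ‖G x‖ ^ p := Real.rpow_pos_of_pos (norm_pos_iff.mpr hGx) p
  rw [hσx, ENNReal.top_mul (ENNReal.ofReal_pos.mpr hnorm).ne'] at hx
  exact hx.ne rfl

lemma fieldEnergy_le_liminf (hp : 0 < p) (hσ : AEMeasurable σ μ) {g : ℕ → α → V}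
    (hg : ∀ k, AEStronglyMeasurable (g k) μ)
    (hlim : ∀ᵐ x ∂μ, σ x ≠ 0 → Tendsto (fun k => g k x) atTop (𝓝 (G x))) :
    fieldEnergy p σ μ G ≤ liminf (fun k => fieldEnergy p σ μ (g k)) atTop := by
  refine le_trans (lintegral_mono_ae ?_)
    (lintegral_liminf_le' fun k => aemeasurable_mul_ofReal_norm_rpow hσ (hg k))
  filter_upwards [hlim] with x hx
  rcases eq_or_ne (σ x * ENNReal.ofReal (‖G x‖ ^ p)) 0 with h0 | h0
  · simp [h0]
  · obtain ⟨hσx, hGx⟩ := mul_ne_zero_iff.mp h0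
    exact (ENNReal.Tendsto.const_mul (ENNReal.tendsto_ofReal
      ((hx hσx).norm.rpow_const (.inr hp.le))) (.inl hGx)).liminf_eq.ge

variable (V) in
lemma exists_fieldEnergy_sub_add_le [NormedSpace ℝ V] [StrictConvexSpace ℝ V] [ProperSpace V]
    (hp : 1 < p) {ε : ℝ≥0} (hε : 0 < ε) :
    ∃ C : ℝ≥0, ∀ {α : Type*} {_ : MeasurableSpace α} {μ : Measure α} {σ : α → ℝ≥0∞} {G H : α → V},
      AEMeasurable σ μ → AEStronglyMeasurable G μ → AEStronglyMeasurable H μ →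
      fieldEnergy p σ μ (G - H) + 2 * C * fieldEnergy p σ μ ((1 / 2 : ℝ) • (G + H)) ≤
        (ε + C) * (fieldEnergy p σ μ G + fieldEnergy p σ μ H) := by
  obtain ⟨C, hC0, hC⟩ := exists_norm_sub_rpow_add_le V hp (NNReal.coe_pos.mpr hε)
  lift C to ℝ≥0 using hC0
  refine ⟨C, fun {α _ μ σ G H} hσ hG hH => ?_⟩
  have hpointwise : ∀ x, ENNReal.ofReal (‖G x - H x‖ ^ p) +
      2 * C * ENNReal.ofReal (‖(1 / 2 : ℝ) • (G x + H x)‖ ^ p) ≤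
      (ε + C) * (ENNReal.ofReal (‖G x‖ ^ p) + ENNReal.ofReal (‖H x‖ ^ p)) := fun x => by
    have h := ENNReal.ofReal_le_ofReal (hC (G x) (H x))
    rw [ENNReal.ofReal_add (by positivity) (by positivity), ENNReal.ofReal_mul (by positivity),
      ENNReal.ofReal_mul (by positivity), ENNReal.ofReal_mul (by positivity),
      ENNReal.ofReal_add (by positivity) (by positivity),
      ENNReal.ofReal_add (by positivity) (by positivity)] at h
    simpa only [ENNReal.ofReal_coe_nnreal, ENNReal.ofReal_ofNat] using h
  simp only [fieldEnergy]
  rw [← lintegral_add_left' (aemeasurable_mul_ofReal_norm_rpow hσ hG),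
    ← lintegral_const_mul' _ _ (by finiteness),
    ← lintegral_add_left' (aemeasurable_mul_ofReal_norm_rpow hσ (hG.sub hH)),
    ← lintegral_const_mul' _ _ (by finiteness)]
  refine lintegral_mono fun x => ?_
  calc σ x * ENNReal.ofReal (‖G x - H x‖ ^ p) +
        2 * C * (σ x * ENNReal.ofReal (‖(1 / 2 : ℝ) • (G x + H x)‖ ^ p))
      = σ x * (ENNReal.ofReal (‖G x - H x‖ ^ p) +
          2 * C * ENNReal.ofReal (‖(1 / 2 : ℝ) • (G x + H x)‖ ^ p)) := by ring
    _ ≤ σ x * ((ε + C) * (ENNReal.ofReal (‖G x‖ ^ p) + ENNReal.ofReal (‖H x‖ ^ p))) :=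
        mul_le_mul_right (hpointwise x) _
    _ = (ε + C) * (σ x * ENNReal.ofReal (‖G x‖ ^ p) + σ x * ENNReal.ofReal (‖H x‖ ^ p)) := by
        ring

end FieldEnergy

section FieldEnergyNorm

variable {α V : Type*} {mα : MeasurableSpace α} {μ : Measure α} [NormedAddCommGroup V] {p : ℝ}
  {σ : α → ℝ≥0∞} {G : α → V} {S : Set α} {m : ℝ≥0∞}

lemma eLpNorm_ofReal_rpow (hp : 0 < p) :
    eLpNorm G (ENNReal.ofReal p) μ ^ p = ∫⁻ x, ENNReal.ofReal (‖G x‖ ^ p) ∂μ := by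
  rw [eLpNorm_eq_lintegral_rpow_enorm_toReal (ENNReal.ofReal_pos.mpr hp).ne' ENNReal.ofReal_ne_top,
    ENNReal.toReal_ofReal hp.le, ← ENNReal.rpow_mul, one_div_mul_cancel hp.ne', ENNReal.rpow_one]
  simp only [← ENNReal.ofReal_rpow_of_nonneg (norm_nonneg _) hp.le, ofReal_norm]

lemma mul_eLpNorm_rpow_le_fieldEnergy (hp : 0 < p) (hm : ∀ᵐ x ∂μ.restrict S, m ≤ σ x) :
    m * eLpNorm G (ENNReal.ofReal p) (μ.restrict S) ^ p ≤ fieldEnergy p σ μ G := by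
  rw [eLpNorm_ofReal_rpow hp]
  calc m * ∫⁻ x in S, ENNReal.ofReal (‖G x‖ ^ p) ∂μ
      ≤ ∫⁻ x in S, m * ENNReal.ofReal (‖G x‖ ^ p) ∂μ := lintegral_const_mul_le _ _
    _ ≤ ∫⁻ x in S, σ x * ENNReal.ofReal (‖G x‖ ^ p) ∂μ :=
        lintegral_mono_ae (hm.mono fun x hx => by gcongr)
    _ ≤ fieldEnergy p σ μ G := setLIntegral_le_lintegral _ _

lemma tendsto_eLpNorm_zero_of_tendsto_fieldEnergy {ι : Type*} {l : Filter ι} {G : ι → α → V}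
    (hp : 0 < p) (hm0 : m ≠ 0) (hm : ∀ᵐ x ∂μ.restrict S, m ≤ σ x)
    (h : Tendsto (fun i => fieldEnergy p σ μ (G i)) l (𝓝 0)) :
    Tendsto (fun i => eLpNorm (G i) (ENNReal.ofReal p) (μ.restrict S)) l (𝓝 0) := by
  refine ENNReal.tendsto_nhds_zero.mpr fun η hη => ?_
  have hmη : 0 < m * η ^ p :=
    ENNReal.mul_pos hm0 (ENNReal.rpow_pos_of_nonneg hη hp.le).ne'
  filter_upwards [h.eventually_lt_const hmη] with i hi
  by_contra! hlt
  have hle : m * η ^ p ≤ m * eLpNorm (G i) (ENNReal.ofReal p) (μ.restrict S) ^ p := by gcongr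
  exact (hle.trans (mul_eLpNorm_rpow_le_fieldEnergy hp hm)).not_gt hi

lemma fieldEnergy_lt_top (hp : 0 < p) (hG : MemLp G (ENNReal.ofReal p) μ) (hm : m ≠ ⊤)
    (hσ : ∀ᵐ x ∂μ, G x ≠ 0 → σ x ≤ m) : fieldEnergy p σ μ G < ⊤ := by
  calc fieldEnergy p σ μ G ≤ ∫⁻ x, m * ENNReal.ofReal (‖G x‖ ^ p) ∂μ :=
        lintegral_mono_ae (hσ.mono fun x hx => by
          rcases eq_or_ne (G x) 0 with h0 | h0
          · simp [h0, Real.zero_rpow hp.ne']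
          · gcongr
            exact hx h0)
    _ = m * eLpNorm G (ENNReal.ofReal p) μ ^ p := by
        rw [lintegral_const_mul' _ _ hm, eLpNorm_ofReal_rpow hp]
    _ < ⊤ := ENNReal.mul_lt_top hm.lt_top
        (ENNReal.rpow_lt_top_of_nonneg hp.le hG.eLpNorm_lt_top.ne)

end FieldEnergyNorm

section Energy

variable {n : ℕ} {p : ℝ} {Ω D : Set (𝔼 n)} {σ : 𝔼 n → ℝ≥0∞} {f u v : 𝔼 n → ℝ} {G : 𝔼 n → 𝔼 n}

lemma HasWeakGradient.pEnergy_eq (h : HasWeakGradient Ω u G) (hΩ : IsOpen Ω) :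
    pEnergy p Ω σ u = fieldEnergy p σ (volume.restrict Ω) G :=
  fieldEnergy_congr_ae ((h.weakGradient_ae_eq hΩ).mono fun _ hx _ => hx)

lemma MemSobolevZero.memSobolev_of_sub (hΩ : IsOpen Ω) (h : MemSobolevZero p Ω (u - f))
    (hf : MemSobolev p Ω f) : MemSobolev p Ω u := by
  simpa using h.memSobolev.add hΩ hf

lemma memSobolevZero_half_add_sub (hp : 1 ≤ p) (hΩ : IsOpen Ω) (hu : MemSobolevZero p Ω (u - f))
    (hv : MemSobolevZero p Ω (v - f)) : MemSobolevZero p Ω ((1 / 2 : ℝ) • (u + v) - f) := by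
  have : Fact (1 ≤ ENNReal.ofReal p) := ⟨ENNReal.one_le_ofReal.mpr hp⟩
  have hmid : (1 / 2 : ℝ) • (u + v) - f = (1 / 2 : ℝ) • (u - f + (v - f)) := by
    module
  rw [hmid]
  exact (hu.add hΩ hv).const_smul hΩ (1 / 2)

lemma exists_pEnergy_sub_add_le (hΩ : IsOpen Ω) (hσ : AEMeasurable σ (volume.restrict Ω))
    (hp : 1 < p) {ε : ℝ≥0} (hε : 0 < ε) :
    ∃ C : ℝ≥0, ∀ u v, MemSobolev p Ω u → MemSobolev p Ω v →
      pEnergy p Ω σ (u - v) + 2 * C * pEnergy p Ω σ ((1 / 2 : ℝ) • (u + v)) ≤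
        (ε + C) * (pEnergy p Ω σ u + pEnergy p Ω σ v) := by
  obtain ⟨C, hC⟩ := exists_fieldEnergy_sub_add_le (𝔼 n) hp hε
  refine ⟨C, fun u v hu hv => ?_⟩
  rw [(hu.hasWeakGradient.sub hv.hasWeakGradient).pEnergy_eq hΩ,
    ((hu.hasWeakGradient.add hv.hasWeakGradient).const_smul (1 / 2)).pEnergy_eq hΩ]
  exact hC hσ hu.memLp_weakGradient.1 hv.memLp_weakGradient.1

lemma tendsto_zero_of_forall_exists_add_le {ι : Type*} {l : Filter ι} {d s : ι → ℝ≥0∞} {I : ℝ≥0∞}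
    (hI : I ≠ ⊤) (hs : Tendsto s l (𝓝 (I + I)))
    (h : ∀ ε : ℝ≥0, 0 < ε → ∃ C : ℝ≥0, ∀ i, d i + 2 * C * I ≤ (ε + C) * s i) :
    Tendsto d l (𝓝 0) := by
  refine ENNReal.tendsto_nhds_zero.mpr fun η hη => ?_
  obtain ⟨ε, hε, hεη⟩ := ENNReal.exists_nnreal_pos_mul_lt (a := I + I) (by finiteness) hη.ne'
  obtain ⟨C, hC⟩ := h ε hε
  have hCI : 2 * C * I ≠ ⊤ := by finiteness
  have hlt : (ε + C) * (I + I) < η + 2 * C * I :=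
    calc (ε + C) * (I + I) = ε * (I + I) + 2 * C * I := by ring
      _ < η + 2 * C * I := ENNReal.add_lt_add_right hCI hεη
  filter_upwards [(ENNReal.Tendsto.const_mul hs (.inr (by finiteness))).eventually_lt_const hlt]
    with i hi
  exact (ENNReal.add_le_add_iff_right hCI).mp ((hC i).trans hi.le)

lemma tendsto_pEnergy_sub {ι : Type*} {l : Filter ι} {u v : ι → 𝔼 n → ℝ} {I : ℝ≥0∞}
    (hΩ : IsOpen Ω) (hσ : AEMeasurable σ (volume.restrict Ω)) (hp : 1 < p)
    (hf : MemSobolev p Ω f) (hI : I ≠ ⊤)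
    (hle : ∀ w, MemSobolevZero p Ω (w - f) → I ≤ pEnergy p Ω σ w)
    (hu : ∀ i, MemSobolevZero p Ω (u i - f)) (hv : ∀ i, MemSobolevZero p Ω (v i - f))
    (huI : Tendsto (fun i => pEnergy p Ω σ (u i)) l (𝓝 I))
    (hvI : Tendsto (fun i => pEnergy p Ω σ (v i)) l (𝓝 I)) :
    Tendsto (fun i => pEnergy p Ω σ (u i - v i)) l (𝓝 0) := by
  refine tendsto_zero_of_forall_exists_add_le hI (huI.add hvI) fun ε hε => ?_
  obtain ⟨C, hC⟩ := exists_pEnergy_sub_add_le hΩ hσ hp hε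
  refine ⟨C, fun i => le_trans ?_
    (hC (u i) (v i) ((hu i).memSobolev_of_sub hΩ hf) ((hv i).memSobolev_of_sub hΩ hf))⟩
  gcongr
  exact hle _ (memSobolevZero_half_add_sub hp.le hΩ (hu i) (hv i))

end Energy

section Existence

variable {n : ℕ} {p : ℝ} {Ω D : Set (𝔼 n)} {σ : 𝔼 n → ℝ≥0∞} {f u : 𝔼 n → ℝ}

lemma enorm_gradientRestrict_eq {q : ℝ≥0∞} [Fact (1 ≤ q)] {x : LpPair q Ω} (hΩ : IsOpen Ω)
    (hx : x ∈ sobolevPairs q Ω) (hxu : x.1 =ᵐ[volume.restrict Ω] u) :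
    ‖gradientRestrict q D Ω x‖ₑ =
      eLpNorm (weakGradient Ω u) q ((volume.restrict Ω).restrict Dᶜ) := by
  rw [Lp.enorm_def]
  exact eLpNorm_congr_ae
    ((gradientRestrict_ae_eq x).trans (weakGradient_ae_eq_snd hΩ hx hxu).restrict.symm)

lemma MemSobolev.hasWeakGradient_snd_add {q : ℝ≥0∞} {x : LpPair q Ω}
    (hf : MemSobolev p Ω f) (hx : x ∈ sobolevPairs q Ω)
    (hxu : x.1 =ᵐ[volume.restrict Ω] u - f) : HasWeakGradient Ω u (x.2 + weakGradient Ω f) := by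
  simpa only [sub_add_cancel] using (HasWeakGradient.congr_ae hx hxu .rfl).add hf.hasWeakGradient

lemma exists_minimizing_seq {α : Type*} {S : Set α} (hS : S.Nonempty) (E : α → ℝ≥0∞) :
    ∃ w : ℕ → α, (∀ k, w k ∈ S) ∧ Tendsto (fun k => E (w k)) atTop (𝓝 (⨅ v ∈ S, E v)) := by
  obtain ⟨s, -, hs, hmem⟩ := exists_seq_tendsto_sInf (hS.image E) (OrderBot.bddBelow _)
  choose w hwS hwE using hmem
  rw [sInf_image] at hs
  exact ⟨w, hwS, hs.congr fun k => (hwE k).symm⟩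

lemma exists_strictMono_tendsto_snd_ae {q : ℝ≥0∞} [Fact (1 ≤ q)] {x : ℕ → LpPair q Ω}
    {z : LpPair q Ω}
    (h : Tendsto (fun k => gradientRestrict q D Ω (x k)) atTop (𝓝 (gradientRestrict q D Ω z))) :
    ∃ ns : ℕ → ℕ, StrictMono ns ∧ ∀ᵐ y ∂(volume.restrict Ω).restrict Dᶜ,
      Tendsto (fun i => (x (ns i)).2 y) atTop (𝓝 (z.2 y)) := by
  obtain ⟨ns, hns, hae⟩ := (tendstoInMeasure_of_tendsto_Lp h).exists_seq_tendsto_ae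
  refine ⟨ns, hns, ?_⟩
  filter_upwards [hae, ae_all_iff.mpr fun i => gradientRestrict_ae_eq (D := D) (x (ns i)),
    gradientRestrict_ae_eq (D := D) z] with y hy hyx hyz
  simpa only [hyx, hyz] using hy

section Sequence

variable [Fact (1 ≤ ENNReal.ofReal p)] {x : ℕ → LpPair (ENNReal.ofReal p) Ω} {w : ℕ → 𝔼 n → ℝ}
  {I : ℝ≥0∞}

lemma cauchySeq_gradientRestrict {m : ℝ≥0∞} (hΩ : IsOpen Ω)
    (hσ : AEMeasurable σ (volume.restrict Ω)) (hp : 1 < p) (hf : MemSobolev p Ω f) (hm0 : m ≠ 0)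
    (hm : ∀ᵐ y ∂(volume.restrict Ω).restrict Dᶜ, m ≤ σ y) (hI : I ≠ ⊤)
    (hle : ∀ v, MemSobolevZero p Ω (v - f) → I ≤ pEnergy p Ω σ v)
    (hx : ∀ k, x k ∈ sobolevZero (ENNReal.ofReal p) Ω)
    (hxw : ∀ k, (x k).1 =ᵐ[volume.restrict Ω] w k - f)
    (hwI : Tendsto (fun k => pEnergy p Ω σ (w k)) atTop (𝓝 I)) :
    CauchySeq fun k => gradientRestrict (ENNReal.ofReal p) D Ω (x k) := by
  have hw : ∀ k, MemSobolevZero p Ω (w k - f) := fun k =>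
    (memSobolevZero_iff hΩ).mpr ⟨x k, hx k, hxw k⟩
  have hfst : Tendsto Prod.fst (atTop : Filter (ℕ × ℕ)) atTop := by
    rw [← prod_atTop_atTop_eq]
    exact tendsto_fst
  have hsnd : Tendsto Prod.snd (atTop : Filter (ℕ × ℕ)) atTop := by
    rw [← prod_atTop_atTop_eq]
    exact tendsto_snd
  have hE : Tendsto (fun z : ℕ × ℕ => pEnergy p Ω σ (w z.1 - w z.2)) atTop (𝓝 0) :=
    tendsto_pEnergy_sub hΩ hσ hp hf hI hle (fun z => hw z.1) (fun z => hw z.2) (hwI.comp hfst)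
      (hwI.comp hsnd)
  have hnorm := tendsto_eLpNorm_zero_of_tendsto_fieldEnergy (μ := volume.restrict Ω)
    (G := fun z : ℕ × ℕ => weakGradient Ω (w z.1 - w z.2)) (zero_lt_one.trans hp) hm0 hm hE
  rw [cauchySeq_iff_tendsto_dist_atTop_0]
  refine ((ENNReal.tendsto_toReal ENNReal.zero_ne_top).comp hnorm).congr fun z => ?_
  have hsub : (x z.1 - x z.2).1 =ᵐ[volume.restrict Ω] w z.1 - w z.2 := by
    filter_upwards [Lp.coeFn_sub (x z.1).1 (x z.2).1, hxw z.1, hxw z.2] with y hy hy1 hy2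
    rw [Prod.fst_sub, hy, Pi.sub_apply, hy1, hy2]
    simp only [Pi.sub_apply, sub_sub_sub_cancel_right]
  rw [dist_eq_norm, ← map_sub, ← toReal_enorm, enorm_gradientRestrict_eq hΩ
    (sobolevZero_le_sobolevPairs (sub_mem (hx z.1) (hx z.2))) hsub, Function.comp_apply]

lemma pEnergy_le_of_tendsto_gradientRestrict {z : LpPair (ENNReal.ofReal p) Ω} (hΩ : IsOpen Ω)
    (hD : IsOpen D) (hσ : AEMeasurable σ (volume.restrict Ω)) (hp : 0 < p)
    (hf : MemSobolev p Ω f) (hσD : ∀ y ∈ D, σ y = 0)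
    (hx : ∀ k, x k ∈ sobolevPairs (ENNReal.ofReal p) Ω)
    (hxw : ∀ k, (x k).1 =ᵐ[volume.restrict Ω] w k - f)
    (hz : z ∈ sobolevPairs (ENNReal.ofReal p) Ω) (hzu : z.1 =ᵐ[volume.restrict Ω] u - f)
    (hxz : Tendsto (fun k => gradientRestrict (ENNReal.ofReal p) D Ω (x k)) atTop
      (𝓝 (gradientRestrict (ENNReal.ofReal p) D Ω z)))
    (hwI : Tendsto (fun k => pEnergy p Ω σ (w k)) atTop (𝓝 I)) : pEnergy p Ω σ u ≤ I := by
  obtain ⟨ns, hns, hlim⟩ := exists_strictMono_tendsto_snd_ae hxz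
  rw [ae_restrict_iff' hD.measurableSet.compl] at hlim
  calc pEnergy p Ω σ u = fieldEnergy p σ (volume.restrict Ω) (z.2 + weakGradient Ω f : 𝔼 n → 𝔼 n) :=
        (hf.hasWeakGradient_snd_add hz hzu).pEnergy_eq hΩ
    _ ≤ liminf (fun i => fieldEnergy p σ (volume.restrict Ω)
          ((x (ns i)).2 + weakGradient Ω f : 𝔼 n → 𝔼 n)) atTop := by
        refine fieldEnergy_le_liminf hp hσ
          (fun i => (Lp.aestronglyMeasurable _).add hf.memLp_weakGradient.1) ?_
        filter_upwards [hlim] with y hy hσy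
        exact (hy fun hyD => hσy (hσD y hyD)).add_const _
    _ = liminf (fun i => pEnergy p Ω σ (w (ns i))) atTop := by
        congr with i
        exact ((hf.hasWeakGradient_snd_add (hx (ns i)) (hxw (ns i))).pEnergy_eq hΩ).symm
    _ = I := (hwI.comp hns.tendsto_atTop).liminf_eq

end Sequence

theorem exists_isEnergyMinimizer {m : ℝ≥0∞} (hD : HasLipschitzBoundary D) (hDo : IsOpen D)
    (hΩ : IsOpen Ω) (hΩb : Bornology.IsBounded Ω) (hDΩ : closure D ⊆ Ω)
    (hσ : AEMeasurable σ (volume.restrict Ω)) (hp : 1 < p) (hf : MemSobolev p Ω f)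
    (hσD : ∀ y ∈ D, σ y = 0) (hm0 : m ≠ 0)
    (hm : ∀ᵐ y ∂(volume.restrict Ω).restrict Dᶜ, m ≤ σ y)
    (hfin : ∃ v, MemSobolevZero p Ω (v - f) ∧ pEnergy p Ω σ v < ⊤) :
    ∃ u, IsEnergyMinimizer p Ω σ f u := by
  have : Fact (1 ≤ ENNReal.ofReal p) := ⟨ENNReal.one_le_ofReal.mpr hp.le⟩
  obtain ⟨v₀, hv₀, hv₀E⟩ := hfin
  obtain ⟨w, hw, hwI⟩ :=
    exists_minimizing_seq (S := {v | MemSobolevZero p Ω (v - f)}) ⟨v₀, hv₀⟩ (pEnergy p Ω σ)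
  set I : ℝ≥0∞ := ⨅ v ∈ {v | MemSobolevZero p Ω (v - f)}, pEnergy p Ω σ v
  have hle : ∀ v, MemSobolevZero p Ω (v - f) → I ≤ pEnergy p Ω σ v := fun v hv => iInf₂_le v hv
  choose x hx hxw using fun k => (memSobolevZero_iff hΩ).mp (hw k)
  obtain ⟨y, hy⟩ := cauchySeq_tendsto_of_complete
    (cauchySeq_gradientRestrict hΩ hσ hp hf hm0 hm ((hle v₀ hv₀).trans_lt hv₀E).ne hle hx hxw hwI)
  obtain ⟨z, hz, rfl⟩ : y ∈ (sobolevZero (ENNReal.ofReal p) Ω).map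
      (gradientRestrict (ENNReal.ofReal p) D Ω).toLinearMap :=
    (isClosed_map_gradientRestrict ENNReal.ofReal_ne_top hD hDo hΩ hΩb hDΩ).mem_of_tendsto hy
      (Eventually.of_forall fun k => Submodule.mem_map_of_mem (hx k))
  have hzu : z.1 =ᵐ[volume.restrict Ω] z.1 + f - f := by rw [add_sub_cancel_right]
  refine ⟨z.1 + f, (memSobolevZero_iff hΩ).mpr ⟨z, hz, hzu⟩, fun v hv => le_trans ?_ (hle v hv)⟩
  exact pEnergy_le_of_tendsto_gradientRestrict hΩ hDo hσ (zero_lt_one.trans hp) hf hσD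
    (fun k => sobolevZero_le_sobolevPairs (hx k)) hxw (sobolevZero_le_sobolevPairs hz) hzu hy hwI

end Existence

section CutOff

lemma memLp_of_support_subset {α F : Type*} {mα : MeasurableSpace α} {μ : Measure α}
    [NormedAddCommGroup F] {q : ℝ≥0∞} {s : Set α} {g : α → F} (hs : MeasurableSet s)
    (hg : MemLp g q (μ.restrict s)) (hgs : Function.support g ⊆ s) : MemLp g q μ := by
  rw [← Set.indicator_eq_self.mpr hgs]
  exact (memLp_indicator_iff_restrict hs).mpr hg

variable {n : ℕ} {p : ℝ} {Ω D K : Set (𝔼 n)} {σ : 𝔼 n → ℝ≥0∞} {f χ : 𝔼 n → ℝ} {G : 𝔼 n → 𝔼 n}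

lemma HasWeakGradient.testFunction_smul (h : HasWeakGradient Ω f G) (hχ : IsTestFunction Ω χ) :
    HasWeakGradient Set.univ (χ • f) (χ • G + f • gradient χ) := by
  have hχG := hχ.integrable_smul h.locallyIntegrableOn_grad
  have hfχ := hχ.integrable_smul_gradient h.locallyIntegrableOn
  refine of_integral_univ_eq ?_ ?_ fun φ hφ => ?_
  · exact (integrable_smul_of_tsupport_subset_left h.locallyIntegrableOn hχ.continuous
      hχ.hasCompactSupport hχ.tsupport_subset).locallyIntegrable.locallyIntegrableOn _
  · exact (hχG.add hfχ).locallyIntegrable.locallyIntegrableOn _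
  have hφχ : IsTestFunction Ω (φ * χ) := hχ.mul_left hφ.contDiff
  have hfφχ : Integrable fun x => f x • φ x • gradient χ x :=
    integrable_smul_of_tsupport_subset_right (φ := φ • gradient χ) h.locallyIntegrableOn
      (hφ.continuous.smul hχ.continuous_gradient) hχ.hasCompactSupport_gradient.smul_left
      ((tsupport_smul_subset_right φ (gradient χ)).trans
        ((tsupport_gradient_subset χ).trans hχ.tsupport_subset))
  have hfχφ : Integrable fun x => f x • χ x • gradient φ x :=
    integrable_smul_of_tsupport_subset_right (φ := χ • gradient φ) h.locallyIntegrableOn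
      (hχ.continuous.smul hφ.continuous_gradient) hχ.hasCompactSupport.smul_right
      ((tsupport_smul_subset_left χ (gradient φ)).trans hχ.tsupport_subset)
  have hφχG : Integrable fun x => φ x • χ x • G x := by
    simpa only [Pi.mul_apply, mul_smul] using hφχ.integrable_smul h.locallyIntegrableOn_grad
  have hprod : (∫ x, f x • φ x • gradient χ x) + ∫ x, f x • χ x • gradient φ x =
      -∫ x, φ x • χ x • G x := by
    rw [← integral_add hfφχ hfχφ]
    simpa only [gradient_mul (hφ.differentiable _) (hχ.differentiable _), smul_add, Pi.mul_apply,
      mul_smul] using h.integral_univ_eq hφχ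
  calc ∫ x, (χ • f) x • gradient φ x = ∫ x, f x • χ x • gradient φ x := by
        simp only [Pi.smul_apply', smul_assoc, smul_comm (χ _) (f _)]
    _ = -((∫ x, φ x • χ x • G x) + ∫ x, f x • φ x • gradient χ x) := by
        rw [neg_add, ← hprod]
        abel
    _ = -∫ x, φ x • (χ • G + f • gradient χ) x := by
        rw [← integral_add hφχG hfφχ]
        simp only [Pi.add_apply, Pi.smul_apply', smul_add, smul_comm (φ _) (f _)]

lemma MemSobolev.memSobolevZero_testFunction_smul (hp : 1 ≤ p) (hΩ : IsOpen Ω)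
    (hf : MemSobolev p Ω f) (hχ : IsTestFunction Ω χ) : MemSobolevZero p Ω (χ • f) := by
  have : Fact (1 ≤ ENNReal.ofReal p) := ⟨ENNReal.one_le_ofReal.mpr hp⟩
  have hsupp : Function.support (χ • f) ⊆ tsupport χ :=
    (Function.support_smul_subset_left _ _).trans (subset_tsupport χ)
  have hχf : MemLp (χ • f) (ENNReal.ofReal p) :=
    memLp_of_support_subset hΩ.measurableSet (hf.memLp.smul (p := ⊤) (hχ.memLp _ _))
      ((Function.support_smul_subset_left _ _).trans hχ.support_subset)
  have hχG : MemLp (χ • weakGradient Ω f) (ENNReal.ofReal p) :=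
    memLp_of_support_subset hΩ.measurableSet (hf.memLp_weakGradient.smul (p := ⊤) (hχ.memLp _ _))
      ((Function.support_smul_subset_left _ _).trans hχ.support_subset)
  have hfχ : MemLp (f • gradient χ) (ENNReal.ofReal p) :=
    memLp_of_support_subset hΩ.measurableSet ((hχ.memLp_gradient _ _).smul (q := ⊤) hf.memLp)
      ((Function.support_smul_subset_right f (gradient χ)).trans hχ.support_gradient_subset)
  exact (memSobolevZero_iff hΩ).mpr (exists_mem_sobolevZero_of_support_subset
    ENNReal.ofReal_ne_top (hf.hasWeakGradient.testFunction_smul hχ) hχf (hχG.add hfχ)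
    hχ.hasCompactSupport hΩ hχ.tsupport_subset hsupp)

open scoped Manifold in
lemma exists_isTestFunction_eventuallyEq_one (hK : IsCompact K) (hΩ : IsOpen Ω) (hKΩ : K ⊆ Ω) :
    ∃ χ, IsTestFunction Ω χ ∧ ∀ x ∈ K, χ =ᶠ[𝓝 x] 1 := by
  obtain ⟨K₁, hK₁, hKK₁, hK₁Ω⟩ := exists_compact_between hK hΩ hKΩ
  obtain ⟨χ, hχ_one, hχ_zero, -⟩ := exists_contMDiffMap_one_nhds_of_subset_interior
    (n := (⊤ : ℕ∞)) 𝓘(ℝ, 𝔼 n) hK.isClosed hKK₁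
  have hsupp : tsupport χ ⊆ K₁ :=
    closure_minimal (fun x hx => not_not.mp fun h => hx (hχ_zero x h)) hK₁.isClosed
  exact ⟨χ, ⟨χ.contMDiff.contDiff, hK₁.of_isClosed_subset (isClosed_tsupport _) hsupp,
    hsupp.trans hK₁Ω⟩, fun x hx => hχ_one.filter_mono (nhds_le_nhdsSet hx)⟩

lemma exists_pEnergy_lt_top {M : ℝ≥0∞} (hΩ : IsOpen Ω) (hΩb : Bornology.IsBounded Ω) (hp : 1 ≤ p)
    (hDΩ : closure D ⊆ Ω) (hMtop : M ≠ ⊤) (hM : ∀ᵐ x ∂volume.restrict Ω, x ∉ D → σ x ≤ M)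
    (hf : MemSobolev p Ω f) : ∃ v, MemSobolevZero p Ω (v - f) ∧ pEnergy p Ω σ v < ⊤ := by
  have : Fact (1 ≤ ENNReal.ofReal p) := ⟨ENNReal.one_le_ofReal.mpr hp⟩
  obtain ⟨χ, hχ, hχ_one⟩ := exists_isTestFunction_eventuallyEq_one
    (hΩb.subset (subset_closure.trans hDΩ)).isCompact_closure hΩ hDΩ
  have hzero : MemSobolevZero p Ω (f - χ • f - f) := by
    simpa [sub_sub_cancel_left] using
      (hf.memSobolevZero_testFunction_smul hp hΩ hχ).const_smul hΩ (-1)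
  have hgrad := hf.hasWeakGradient.sub
    ((hf.hasWeakGradient.testFunction_smul hχ).mono (Set.subset_univ Ω))
  refine ⟨f - χ • f, hzero, fieldEnergy_lt_top (zero_lt_one.trans_le hp)
    (hzero.memSobolev_of_sub hΩ hf).memLp_weakGradient hMtop ?_⟩
  filter_upwards [hgrad.weakGradient_ae_eq hΩ, hM] with x hx hxM hne
  refine hxM fun hxD => hne ?_
  have hχx := hχ_one x (subset_closure hxD)
  have hgradχ : gradient χ x = 0 := hχx.gradient_eq.trans (gradient_const x 1)
  rw [hx]
  simp [hχx.eq_of_nhds, hgradχ]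

end CutOff

section Minimizers

variable {n : ℕ} {p : ℝ} {Ω D : Set (𝔼 n)} {σ : 𝔼 n → ℝ≥0∞} {f u v : 𝔼 n → ℝ}

namespace IsEnergyMinimizer

lemma pEnergy_eq (hu : IsEnergyMinimizer p Ω σ f u) (hv : IsEnergyMinimizer p Ω σ f v) :
    pEnergy p Ω σ u = pEnergy p Ω σ v :=
  le_antisymm (hu.2 v hv.1) (hv.2 u hu.1)

lemma pEnergy_sub_eq_zero (hΩ : IsOpen Ω) (hσ : AEMeasurable σ (volume.restrict Ω)) (hp : 1 < p)
    (hf : MemSobolev p Ω f) (hu : IsEnergyMinimizer p Ω σ f u) (hv : IsEnergyMinimizer p Ω σ f v)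
    (hfin : pEnergy p Ω σ u ≠ ⊤) : pEnergy p Ω σ (v - u) = 0 :=
  tendsto_nhds_unique tendsto_const_nhds
    (tendsto_pEnergy_sub (l := (pure () : Filter Unit)) (u := fun _ => v) (v := fun _ => u)
      hΩ hσ hp hf hfin hu.2 (fun _ => hv.1) (fun _ => hu.1)
      ((hu.pEnergy_eq hv).symm ▸ tendsto_const_nhds) tendsto_const_nhds)

lemma memSobolevZero_sub (hp : 1 ≤ p) (hΩ : IsOpen Ω) (hu : IsEnergyMinimizer p Ω σ f u)
    (hv : IsEnergyMinimizer p Ω σ f v) : MemSobolevZero p Ω (v - u) := by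
  have : Fact (1 ≤ ENNReal.ofReal p) := ⟨ENNReal.one_le_ofReal.mpr hp⟩
  simpa only [sub_sub_sub_cancel_right] using hv.1.sub hΩ hu.1

lemma of_weakGradient_sub_ae_eq_zero (hp : 1 ≤ p) (hΩ : IsOpen Ω) (hf : MemSobolev p Ω f)
    (hu : IsEnergyMinimizer p Ω σ f u) (hvu : MemSobolevZero p Ω (v - u))
    (h : ∀ᵐ x ∂volume.restrict Ω, σ x ≠ 0 → weakGradient Ω (v - u) x = 0) :
    IsEnergyMinimizer p Ω σ f v := by
  have : Fact (1 ≤ ENNReal.ofReal p) := ⟨ENNReal.one_le_ofReal.mpr hp⟩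
  have hgrad : HasWeakGradient Ω v (weakGradient Ω (v - u) + weakGradient Ω u) := by
    simpa only [sub_add_cancel] using
      hvu.memSobolev.hasWeakGradient.add (hu.1.memSobolev_of_sub hΩ hf).hasWeakGradient
  have hE : pEnergy p Ω σ v = pEnergy p Ω σ u :=
    (hgrad.pEnergy_eq hΩ).trans (fieldEnergy_congr_ae (h.mono fun x hx hσx => by simp [hx hσx]))
  refine ⟨?_, fun w hw => hE.trans_le (hu.2 w hw)⟩
  simpa only [sub_add_sub_cancel] using hvu.add hΩ hu.1

theorem iff_weakGradient_sub_ae_eq_zero (hΩ : IsOpen Ω) (hσ : AEMeasurable σ (volume.restrict Ω))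
    (hp : 1 < p) (hf : MemSobolev p Ω f) (hu : IsEnergyMinimizer p Ω σ f u)
    (hfin : pEnergy p Ω σ u ≠ ⊤) :
    IsEnergyMinimizer p Ω σ f v ↔ MemSobolevZero p Ω (v - u) ∧
      ∀ᵐ x ∂volume.restrict Ω, σ x ≠ 0 → weakGradient Ω (v - u) x = 0 := by
  refine ⟨fun hv => ?_, fun h => hu.of_weakGradient_sub_ae_eq_zero hp.le hΩ hf h.1 h.2⟩
  have hvu := hu.memSobolevZero_sub hp.le hΩ hv
  exact ⟨hvu, ae_eq_zero_of_fieldEnergy_eq_zero hσ hvu.memSobolev.memLp_weakGradient.1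
    (hu.pEnergy_sub_eq_zero hΩ hσ hp hf hv hfin)⟩

end IsEnergyMinimizer

lemma MemSobolev.hasWeakGradient_zero_of_pEnergy_ne_top (hσ : AEMeasurable σ (volume.restrict Ω))
    (hu : MemSobolev p Ω u) (hD : IsOpen D) (hDΩ : D ⊆ Ω) (hσD : ∀ x ∈ D, σ x = ⊤)
    (hfin : pEnergy p Ω σ u ≠ ⊤) : HasWeakGradient D u 0 := by
  refine (hu.hasWeakGradient.mono hDΩ).congr_ae .rfl ?_
  filter_upwards [ae_mono (Measure.restrict_mono hDΩ le_rfl)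
    (ae_eq_zero_of_fieldEnergy_ne_top hσ hu.memLp_weakGradient.1 hfin),
    ae_restrict_mem hD.measurableSet] with x hx hxD
  exact hx (hσD x hxD)

end Minimizers

section FirstVariation

variable {V : Type*} [NormedAddCommGroup V] {p : ℝ}

lemma norm_rpow_sub_two_smul_self [NormedSpace ℝ V] (hp : 1 < p) (v : V) :
    ‖‖v‖ ^ (p - 2) • v‖ = ‖v‖ ^ (p - 1) := by
  rw [norm_smul, Real.norm_of_nonneg (by positivity)]
  rcases (norm_nonneg v).eq_or_lt with h0 | h0
  · rw [← h0, mul_zero, Real.zero_rpow (sub_pos.mpr hp).ne']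
  · rw [← Real.rpow_add_one h0.ne']
    ring_nf

lemma hasDerivAt_norm_add_smul_rpow [InnerProductSpace ℝ V] (hp : 1 < p) (v w : V) (t : ℝ) :
    HasDerivAt (fun s : ℝ => ‖v + s • w‖ ^ p)
      (p * inner ℝ (‖v + t • w‖ ^ (p - 2) • (v + t • w)) w) t := by
  have hline : HasDerivAt (fun s : ℝ => v + s • w) w t := by
    simpa only [one_smul, id] using ((hasDerivAt_id t).smul_const w).const_add v
  refine ((hasFDerivAt_norm_rpow (v + t • w) hp).comp_hasDerivAt t hline).congr_deriv ?_
  rw [real_inner_smul_left, ← mul_assoc]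
  rfl

lemma abs_inner_norm_rpow_smul_le [InnerProductSpace ℝ V] (hp : 1 < p) (v w : V) {t : ℝ}
    (ht : |t| ≤ 1) :
    |inner ℝ (‖v + t • w‖ ^ (p - 2) • (v + t • w)) w| ≤ (‖v‖ + ‖w‖) ^ p := by
  have : 0 ≤ p - 1 := sub_nonneg.mpr hp.le
  have hadd : ‖v + t • w‖ ≤ ‖v‖ + ‖w‖ :=
    calc ‖v + t • w‖ ≤ ‖v‖ + |t| * ‖w‖ := (norm_add_le _ _).trans_eq (by rw [norm_smul,
          Real.norm_eq_abs])
      _ ≤ ‖v‖ + ‖w‖ := by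
        gcongr
        exact mul_le_of_le_one_left (norm_nonneg w) ht
  calc |inner ℝ (‖v + t • w‖ ^ (p - 2) • (v + t • w)) w|
      ≤ ‖v + t • w‖ ^ (p - 1) * ‖w‖ := by
        rw [← norm_rpow_sub_two_smul_self hp]
        exact abs_real_inner_le_norm _ _
    _ ≤ (‖v‖ + ‖w‖) ^ (p - 1) * (‖v‖ + ‖w‖) := by
        gcongr
        exact le_add_of_nonneg_left (norm_nonneg v)
    _ = (‖v‖ + ‖w‖) ^ p := by
        rw [← Real.rpow_add_one' (by positivity) (by linarith), sub_add_cancel]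

variable {α : Type*} {mα : MeasurableSpace α} {μ : Measure α} {a : α → ℝ} {C : ℝ} {G H : α → V}

lemma integrable_norm_rpow_ofReal (hp : 0 < p) (hG : MemLp G (ENNReal.ofReal p) μ) :
    Integrable (fun x => ‖G x‖ ^ p) μ := by
  simpa only [ENNReal.toReal_ofReal hp.le] using
    hG.integrable_norm_rpow (ENNReal.ofReal_pos.mpr hp).ne' ENNReal.ofReal_ne_top

lemma integrable_mul_norm_rpow_smul_self [NormedSpace ℝ V] [IsFiniteMeasure μ] (hp : 1 < p)
    (ha : AEStronglyMeasurable a μ) (haC : ∀ᵐ x ∂μ, |a x| ≤ C)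
    (hG : MemLp G (ENNReal.ofReal p) μ) :
    Integrable (fun x => (a x * ‖G x‖ ^ (p - 2)) • G x) μ := by
  have hpow : Integrable (fun x => ‖G x‖ ^ (p - 1)) μ :=
    integrable_norm_rpow_ofReal (sub_pos.mpr hp)
      (hG.mono_exponent (ENNReal.ofReal_le_ofReal (sub_le_self p zero_le_one)))
  refine (hpow.const_mul C).mono'
    ((ha.mul (hG.1.norm.aemeasurable.pow_const (p - 2)).aestronglyMeasurable).smul hG.1) ?_
  filter_upwards [haC] with x hx
  rw [mul_smul, norm_smul, norm_rpow_sub_two_smul_self hp, Real.norm_eq_abs]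
  gcongr

variable [InnerProductSpace ℝ V]

lemma hasDerivAt_integral_mul_norm_add_smul_rpow (hp : 1 < p) (ha : AEStronglyMeasurable a μ)
    (haC : ∀ᵐ x ∂μ, |a x| ≤ C) (hG : MemLp G (ENNReal.ofReal p) μ)
    (hH : MemLp H (ENNReal.ofReal p) μ) :
    HasDerivAt (fun t : ℝ => ∫ x, a x * ‖G x + t • H x‖ ^ p ∂μ)
      (p * ∫ x, inner ℝ ((a x * ‖G x‖ ^ (p - 2)) • G x) (H x) ∂μ) 0 := by
  have hp0 : 0 < p := zero_lt_one.trans hp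
  have hmeas : ∀ t : ℝ, AEStronglyMeasurable (fun x => G x + t • H x) μ := fun t =>
    hG.1.add (hH.1.const_smul t)
  have hdom : Integrable (fun x => C * (p * (‖G x‖ + ‖H x‖) ^ p)) μ :=
    ((integrable_norm_rpow_ofReal hp0 (hG.norm.add hH.norm)).congr (ae_of_all _ fun x => by
      simp only [Pi.add_apply, Real.norm_of_nonneg (add_nonneg (norm_nonneg (G x))
        (norm_nonneg (H x)))])).const_mul p |>.const_mul C
  refine (hasDerivAt_integral_of_dominated_loc_of_deriv_le (𝕜 := ℝ)
    (F := fun t x => a x * ‖G x + t • H x‖ ^ p) (F' := fun t x => a x *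
      (p * inner ℝ (‖G x + t • H x‖ ^ (p - 2) • (G x + t • H x)) (H x)))
    (Metric.ball_mem_nhds (0 : ℝ) one_pos) (Eventually.of_forall fun t =>
      ha.mul ((hmeas t).norm.aemeasurable.pow_const p).aestronglyMeasurable) ?_ ?_ ?_ hdom
    (ae_of_all _ fun x t _ =>
      (hasDerivAt_norm_add_smul_rpow hp (G x) (H x) t).const_mul (a x))).2.congr_deriv ?_
  · simpa only [zero_smul, add_zero] using (integrable_norm_rpow_ofReal hp0 hG).bdd_mul ha haC
  · exact ha.mul (((((hmeas 0).norm.aemeasurable.pow_const (p - 2)).aestronglyMeasurable.smul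
      (hmeas 0)).inner hH.1).const_mul p)
  · filter_upwards [haC] with x hx t ht
    have ht1 : |t| ≤ 1 := by simpa using (Metric.mem_ball.mp ht).le
    have hbound := abs_inner_norm_rpow_smul_le hp (G x) (H x) ht1
    rw [Real.norm_eq_abs, abs_mul, abs_mul, abs_of_pos hp0]
    have hC : 0 ≤ C := (abs_nonneg _).trans hx
    gcongr
  · rw [← integral_const_mul]
    congr with x
    simp only [zero_smul, add_zero, real_inner_smul_left]
    ring

end FirstVariation

section FieldEnergyVariation

variable {α V : Type*} {mα : MeasurableSpace α} {μ : Measure α} [NormedAddCommGroup V] {p : ℝ}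
  {σ : α → ℝ≥0∞} {G H : α → V} {s : Set α} {M : ℝ≥0∞}

lemma fieldEnergy_restrict_le_of_eq_off (hs : MeasurableSet s) (hGH : ∀ x ∉ s, G x = H x)
    (hfin : fieldEnergy p σ μ G ≠ ⊤) (hle : fieldEnergy p σ μ G ≤ fieldEnergy p σ μ H) :
    fieldEnergy p σ (μ.restrict s) G ≤ fieldEnergy p σ (μ.restrict s) H := by
  have hsplit (F : α → V) : fieldEnergy p σ (μ.restrict s) F + fieldEnergy p σ (μ.restrict sᶜ) F =
      fieldEnergy p σ μ F := lintegral_add_compl _ hs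
  have hoff : fieldEnergy p σ (μ.restrict sᶜ) G = fieldEnergy p σ (μ.restrict sᶜ) H :=
    fieldEnergy_congr_ae ((ae_restrict_mem hs.compl).mono fun x hx _ => hGH x hx)
  rw [← hsplit, ← hsplit, hoff] at hle
  rw [← hsplit, hoff] at hfin
  exact ENNReal.le_of_add_le_add_right (ENNReal.add_ne_top.mp hfin).2 hle

lemma ae_abs_toReal_le_toReal (hMtop : M ≠ ⊤) (hM : ∀ᵐ x ∂μ, σ x ≤ M) :
    ∀ᵐ x ∂μ, |(σ x).toReal| ≤ M.toReal :=
  hM.mono fun x hx => by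
    rw [abs_of_nonneg ENNReal.toReal_nonneg]
    exact ENNReal.toReal_mono hMtop hx

lemma fieldEnergy_eq_ofReal_integral (hp : 0 < p) (hσ : AEMeasurable σ μ) (hMtop : M ≠ ⊤)
    (hM : ∀ᵐ x ∂μ, σ x ≤ M) (hG : MemLp G (ENNReal.ofReal p) μ) :
    fieldEnergy p σ μ G = ENNReal.ofReal (∫ x, (σ x).toReal * ‖G x‖ ^ p ∂μ) := by
  have hint : Integrable (fun x => (σ x).toReal * ‖G x‖ ^ p) μ :=
    (integrable_norm_rpow_ofReal hp hG).bdd_mul hσ.ennreal_toReal.aestronglyMeasurable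
      (ae_abs_toReal_le_toReal hMtop hM)
  rw [ofReal_integral_eq_lintegral_ofReal hint (ae_of_all _ fun x => by positivity)]
  refine lintegral_congr_ae (hM.mono fun x hx => ?_)
  simp only [ENNReal.ofReal_mul ENNReal.toReal_nonneg,
    ENNReal.ofReal_toReal (hx.trans_lt hMtop.lt_top).ne]

theorem integral_inner_flux_eq_zero [InnerProductSpace ℝ V] (hp : 1 < p) (hσ : AEMeasurable σ μ)
    (hMtop : M ≠ ⊤) (hM : ∀ᵐ x ∂μ, σ x ≤ M) (hG : MemLp G (ENNReal.ofReal p) μ)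
    (hH : MemLp H (ENNReal.ofReal p) μ)
    (hmin : ∀ t : ℝ, fieldEnergy p σ μ G ≤ fieldEnergy p σ μ (G + t • H)) :
    ∫ x, inner ℝ (((σ x).toReal * ‖G x‖ ^ (p - 2)) • G x) (H x) ∂μ = 0 := by
  have hp0 : 0 < p := zero_lt_one.trans hp
  have hderiv := hasDerivAt_integral_mul_norm_add_smul_rpow hp
    hσ.ennreal_toReal.aestronglyMeasurable (ae_abs_toReal_le_toReal hMtop hM) hG hH
  have hlocal : IsLocalMin (fun t : ℝ => ∫ x, (σ x).toReal * ‖G x + t • H x‖ ^ p ∂μ) 0 := by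
    refine Eventually.of_forall fun t => ?_
    have hle := hmin t
    rw [fieldEnergy_eq_ofReal_integral hp0 hσ hMtop hM hG, fieldEnergy_eq_ofReal_integral hp0 hσ
      hMtop hM (hG.add (hH.const_smul t)), ENNReal.ofReal_le_ofReal_iff
        (integral_nonneg fun x => by positivity)] at hle
    simpa only [zero_smul, add_zero, Pi.add_apply, Pi.smul_apply] using hle
  exact (mul_eq_zero.mp (hlocal.hasDerivAt_eq_zero hderiv)).resolve_left hp0.ne'

end FieldEnergyVariation

section EulerLagrange

variable {n : ℕ} {p : ℝ} {Ω U : Set (𝔼 n)} {σ : 𝔼 n → ℝ≥0∞} {f u φ : 𝔼 n → ℝ} {M : ℝ≥0∞}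

lemma IsTestFunction.memSobolevZero (hp : 1 ≤ p) (hΩ : IsOpen Ω) (hφ : IsTestFunction Ω φ) :
    MemSobolevZero p Ω φ := by
  have : Fact (1 ≤ ENNReal.ofReal p) := ⟨ENNReal.one_le_ofReal.mpr hp⟩
  exact (memSobolevZero_iff hΩ).mpr ⟨_, Submodule.le_topologicalClosure _
    hφ.toLp_mem_sobolevPairsOf, (hφ.memLp _ _).coeFn_toLp⟩

namespace IsEnergyMinimizer

lemma fieldEnergy_restrict_le (hp : 1 ≤ p) (hΩ : IsOpen Ω) (hU : IsOpen U) (hUΩ : U ⊆ Ω)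
    (hf : MemSobolev p Ω f) (hu : IsEnergyMinimizer p Ω σ f u) (hfin : pEnergy p Ω σ u ≠ ⊤)
    (hφ : IsTestFunction U φ) (t : ℝ) :
    fieldEnergy p σ (volume.restrict U) (weakGradient Ω u) ≤
      fieldEnergy p σ (volume.restrict U) (weakGradient Ω u + t • gradient φ) := by
  have : Fact (1 ≤ ENNReal.ofReal p) := ⟨ENNReal.one_le_ofReal.mpr hp⟩
  have hadm : MemSobolevZero p Ω (u + t • φ - f) := by
    simpa only [sub_add_eq_add_sub] using
      hu.1.add hΩ (((hφ.mono hUΩ).memSobolevZero hp hΩ).const_smul hΩ t)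
  have hgrad := (hu.1.memSobolev_of_sub hΩ hf).hasWeakGradient.add
    ((hφ.hasWeakGradient.mono (Set.subset_univ Ω)).const_smul t)
  rw [← Measure.restrict_restrict_of_subset hUΩ]
  refine fieldEnergy_restrict_le_of_eq_off hU.measurableSet (fun x hx => ?_) hfin
    ((hu.2 _ hadm).trans_eq (hgrad.pEnergy_eq hΩ))
  simp only [Pi.add_apply, Pi.smul_apply, hφ.gradient_eq_zero_of_notMem hx, smul_zero, add_zero]

theorem isWeakSolution (hΩ : IsOpen Ω) (hU : IsOpen U) (hUb : Bornology.IsBounded U)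
    (hUΩ : U ⊆ Ω) (hp : 1 < p) (hσ : AEMeasurable σ (volume.restrict Ω)) (hMtop : M ≠ ⊤)
    (hM : ∀ᵐ x ∂volume.restrict U, σ x ≤ M) (hf : MemSobolev p Ω f)
    (hu : IsEnergyMinimizer p Ω σ f u) (hfin : pEnergy p Ω σ u ≠ ⊤) : IsWeakSolution p U σ u := by
  have husob := hu.1.memSobolev_of_sub hΩ hf
  have hgrad : HasWeakGradient U u (weakGradient Ω u) := husob.hasWeakGradient.mono hUΩ
  have hmono := Measure.restrict_mono hUΩ (le_refl (volume : Measure (𝔼 n)))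
  have hσU : AEMeasurable σ (volume.restrict U) := hσ.mono_measure hmono
  have hLp : MemLp (weakGradient Ω u) (ENNReal.ofReal p) (volume.restrict U) :=
    husob.memLp_weakGradient.mono_measure hmono
  have : IsFiniteMeasure (volume.restrict U) := ⟨by simpa using hUb.measure_lt_top⟩
  refine ⟨⟨_, hgrad⟩, ?_, fun φ hφ => ?_⟩
  · exact IntegrableOn.locallyIntegrableOn (integrable_mul_norm_rpow_smul_self hp
      hσU.ennreal_toReal.aestronglyMeasurable (ae_abs_toReal_le_toReal hMtop hM)
      (hLp.ae_eq (hgrad.weakGradient_ae_eq hU).symm))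
  · rw [← integral_inner_flux_eq_zero hp hσU hMtop hM hLp (hφ.memLp_gradient _ _)
      (hu.fieldEnergy_restrict_le hp.le hΩ hU hUΩ hf hfin hφ)]
    refine integral_congr_ae ?_
    filter_upwards [hgrad.weakGradient_ae_eq hU] with x hx
    rw [hx]

end IsEnergyMinimizer

end EulerLagrange

section LevelSets

lemma closure_subset_of_disjoint_frontier {X : Type*} [TopologicalSpace X] {s t : Set X}
    (hst : s ⊆ t) (h : Disjoint (closure s) (frontier t)) : closure s ⊆ t := fun _ hx =>
  interior_subset (by_contra fun hxt => Set.disjoint_left.mp h hx ⟨closure_mono hst hx, hxt⟩)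

lemma ae_restrict_of_ae_restrict_sdiff_union {α : Type*} {mα : MeasurableSpace α} {μ : Measure α}
    {s A B : Set α} {P : α → Prop} (hs : MeasurableSet s) (hA : MeasurableSet A)
    (hB : MeasurableSet B) (h : ∀ᵐ x ∂μ.restrict (s \ (A ∪ B)), P x) (hPB : ∀ x ∈ B, P x) :
    ∀ᵐ x ∂μ.restrict s, x ∉ A → P x := by
  rw [ae_restrict_iff' (hs.diff (hA.union hB))] at h
  rw [ae_restrict_iff' hs]
  filter_upwards [h] with x hx hxs hxA
  by_cases hxB : x ∈ B
  · exact hPB x hxB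
  · exact hx ⟨hxs, fun hxAB => hxAB.elim hxA hxB⟩

variable {n : ℕ} {Ω : Set (𝔼 n)} {σ : 𝔼 n → ℝ≥0∞}

lemma levelSet_subset (c : ℝ≥0∞) : levelSet Ω σ c ⊆ Ω := Set.sep_subset _ _

lemma ae_restrict_sdiff_levelSet_iff {c : ℝ≥0∞} {P : 𝔼 n → Prop} (hΩ : MeasurableSet Ω)
    (hc : MeasurableSet (levelSet Ω σ c)) :
    (∀ᵐ x ∂volume.restrict (Ω \ levelSet Ω σ c), P x) ↔
      ∀ᵐ x ∂volume.restrict Ω, σ x ≠ c → P x := by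
  rw [ae_restrict_iff' (hΩ.diff hc), ae_restrict_iff' hΩ]
  refine eventually_congr (Eventually.of_forall fun x => ?_)
  simp only [levelSet, Set.mem_sdiff, Set.mem_ofPred_eq]
  tauto

end LevelSets

theorem mainTheorem4_general {n : ℕ}
    (Ω : Set (EuclideanSpace ℝ (Fin n))) (hΩ_open : IsOpen Ω) (hΩ_bdd : Bornology.IsBounded Ω)
    (σ : EuclideanSpace ℝ (Fin n) → ℝ≥0∞) (hσ : AEMeasurable σ (volume.restrict Ω))
    (D₀ D_inf : Set (EuclideanSpace ℝ (Fin n)))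
    (hD₀ : D₀ = levelSet Ω σ 0) (hD_inf : D_inf = levelSet Ω σ ⊤)
    (hD₀_open : IsOpen D₀) (hD_inf_open : IsOpen D_inf)
    (hdisj₀ : Disjoint (closure D₀) (frontier Ω))
    (hdisj_inf : Disjoint (closure D_inf) (frontier Ω))
    (hσ_bdd : ∃ m M : ℝ, 0 < m ∧ ∀ᵐ x ∂(volume.restrict (Ω \ (D₀ ∪ D_inf))),
      ENNReal.ofReal m ≤ σ x ∧ σ x ≤ ENNReal.ofReal M)
    (hD₀_lip : HasLipschitzBoundary D₀)
    (p : ℝ) (hp : 1 < p)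
    (f : EuclideanSpace ℝ (Fin n) → ℝ) (hf : MemSobolev p Ω f) :
    (∃ u, IsEnergyMinimizer p Ω σ f u) ∧
    ∀ u, IsEnergyMinimizer p Ω σ f u →
      pEnergy p Ω σ u < ⊤ ∧
      (∀ v, IsEnergyMinimizer p Ω σ f v ↔
        MemSobolevZero p Ω (v - u) ∧
          ∀ᵐ x ∂(volume.restrict (Ω \ D₀)), weakGradient Ω (v - u) x = 0) ∧
      IsWeakSolution p (Ω \ (closure D₀ ∪ closure D_inf)) σ u ∧
      HasWeakGradient D_inf u 0 := by
  subst hD₀ hD_inf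
  obtain ⟨m, M, hm, hbdd⟩ := hσ_bdd
  have hD₀Ω := closure_subset_of_disjoint_frontier (levelSet_subset 0) hdisj₀
  have hD_infΩ := closure_subset_of_disjoint_frontier (levelSet_subset ⊤) hdisj_inf
  have hlower := ae_restrict_of_ae_restrict_sdiff_union hΩ_open.measurableSet
    hD₀_open.measurableSet hD_inf_open.measurableSet (hbdd.mono fun _ h => h.1)
    fun x hx => hx.2.symm ▸ le_top
  have hupper := ae_restrict_of_ae_restrict_sdiff_union hΩ_open.measurableSet
    hD_inf_open.measurableSet hD₀_open.measurableSet
    (Set.union_comm _ _ ▸ hbdd.mono fun _ h => h.2) fun x hx => hx.2.symm ▸ zero_le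
  have hfin := exists_pEnergy_lt_top hΩ_open hΩ_bdd hp.le hD_infΩ ENNReal.ofReal_ne_top hupper hf
  refine ⟨exists_isEnergyMinimizer hD₀_lip hD₀_open hΩ_open hΩ_bdd hD₀Ω hσ hp hf
    (fun x hx => hx.2) (ENNReal.ofReal_pos.mpr hm).ne'
    ((ae_restrict_iff' hD₀_open.measurableSet.compl).mpr hlower) hfin, fun u hu => ?_⟩
  have huE : pEnergy p Ω σ u < ⊤ := hfin.elim fun v hv => (hu.2 v hv.1).trans_lt hv.2
  refine ⟨huE, fun v => ?_, ?_, ?_⟩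
  · rw [ae_restrict_sdiff_levelSet_iff hΩ_open.measurableSet hD₀_open.measurableSet]
    exact hu.iff_weakGradient_sub_ae_eq_zero hΩ_open hσ hp hf huE.ne
  · have hU := hΩ_open.sdiff (isClosed_closure (s := levelSet Ω σ 0) |>.union
      (isClosed_closure (s := levelSet Ω σ ⊤)))
    exact hu.isWeakSolution hΩ_open hU (hΩ_bdd.subset Set.sdiff_subset) Set.sdiff_subset hp hσ
      ENNReal.ofReal_ne_top (ae_mono (Measure.restrict_mono (Set.sdiff_subset_sdiff_right
        (Set.union_subset_union subset_closure subset_closure)) le_rfl)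
        (hbdd.mono fun _ h => h.2)) hf huE.ne
  · exact (hu.1.memSobolev_of_sub hΩ_open hf).hasWeakGradient_zero_of_pEnergy_ne_top hσ
      hD_inf_open (levelSet_subset ⊤) (fun x hx => hx.2) huE.ne

theorem mainTheorem4 {n : ℕ} (hn : 1 ≤ n)
    (Ω : Set (EuclideanSpace ℝ (Fin n))) (hΩ_open : IsOpen Ω) (hΩ_bdd : Bornology.IsBounded Ω)
    (σ : EuclideanSpace ℝ (Fin n) → ℝ≥0∞) (hσ : AEMeasurable σ (volume.restrict Ω))
    (D₀ D_inf : Set (EuclideanSpace ℝ (Fin n)))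
    (hD₀ : D₀ = levelSet Ω σ 0) (hD_inf : D_inf = levelSet Ω σ ⊤)
    (hD₀_open : IsOpen D₀) (hD_inf_open : IsOpen D_inf)
    (hdisj : Disjoint (closure D₀) (closure D_inf))
    (hdisj₀ : Disjoint (closure D₀) (frontier Ω))
    (hdisj_inf : Disjoint (closure D_inf) (frontier Ω))
    (hσ_bdd : ∃ m M : ℝ, 0 < m ∧ ∀ᵐ x ∂(volume.restrict (Ω \ (D₀ ∪ D_inf))),
      ENNReal.ofReal m ≤ σ x ∧ σ x ≤ ENNReal.ofReal M)
    (hD₀_lip : HasLipschitzBoundary D₀)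
    (p : ℝ) (hp : 1 < p)
    (f : EuclideanSpace ℝ (Fin n) → ℝ) (hf : MemSobolev p Ω f) :
    (∃ u, IsEnergyMinimizer p Ω σ f u) ∧
    ∀ u, IsEnergyMinimizer p Ω σ f u →
      pEnergy p Ω σ u < ⊤ ∧
      (∀ v, IsEnergyMinimizer p Ω σ f v ↔
        MemSobolevZero p Ω (v - u) ∧
          ∀ᵐ x ∂(volume.restrict (Ω \ D₀)), weakGradient Ω (v - u) x = 0) ∧
      IsWeakSolution p (Ω \ (closure D₀ ∪ closure D_inf)) σ u ∧
      HasWeakGradient D_inf u 0 :=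
  mainTheorem4_general Ω hΩ_open hΩ_bdd σ hσ D₀ D_inf hD₀ hD_inf hD₀_open hD_inf_open hdisj₀
    hdisj_inf hσ_bdd hD₀_lip p hp f hf
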